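/- Let $k$ be a field of characteristic $0$, let $m_1,\dots,m_{M+N}\ge 1$, and put $m_{0}=m_1+\cdots+m_M$, $m_{\bar 1}=m_{M+1}+\cdots+m_{M+N}$, $m=m_0+m_{\bar 1}$; assume $m_{0}\ge m_{\bar 1}$. Let $\pi\in S_{M+N}$ be an $(M,N)$-shuffle, i.e. $\pi(1)<\dots<\pi(M)$ and $\pi(M+1)<\dots<\pi(M+N)$. Write matrices in $\mathfrak{gl}(m_0|m_{\bar 1})$ in blocks $B_{ij}$ of size $m_i\times m_j$ (the first $M$ blocks even, the last $N$ odd), and let $\mathfrak n_\pi=\{B : B_{ij}=0 \text{ unless } \pi(i)<\pi(j)\}$ be the nilpotent radical of the even parabolic $\mathfrak p_\pi=\{B : B_{ij}=0 \text{ unless } \pi(i)\le\pi(j)\}$. Let $T$ be the diagonal torus, with coordinates $s=(s_{ip})_{1\le i\le M+N,\,1\le p\le m_i}$, also numbered $s_1,\dots,s_m$ in lexicographic order; the block $B_{ij}$ is regarded as $\mathrm{Hom}(k^{m_i},k^{m_j})$, of character $\sum_{p,q}s_{jq}/s_{ip}$. Let $$F_\pi(s)=\sum_{\lambda\in\mathbb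 Z^{m}}\chi\big(H^\bullet(\mathfrak n_\pi,k)_\lambda\big)s^\lambda ,$$ where $H^\bullet(\mathfrak n_\pi,k)$ is the cohomology of the Chevalley--Eilenberg complex $S(\mathfrak n_\pi^*[-1])$ of the Lie superalgebra $\mathfrak n_\pi$, the subscript $\lambda$ denotes the $T$-weight space, and $\chi$ is the dimension of the even part minus that of the odd part for the total parity (cochain degree plus internal parity). Put $n=m_0$ and $\alpha_{ab}=e_a-e_b\in\mathbb Z^{2n}$. Embed $\mathbb Z^{m}$ in $\mathbb Z^{2n}$ by adding zeros in the positions $m+1,\dots,2n$. Let $\Pi\in S_{2n}$ be the $(n,n)$-shuffle that fixes $m+1,\dots,2n$ and for which, for $a,b\le m$ in the blocks $i,j$, $\Pi(a)<\Pi(b)$ if and only if $\pi(i)<\pi(j)$, or $i=j$ and $a<b$. Let $\Pi_1$ be the $(n,n)$-shuffle that arranges the indices in the order $1,n+1,2,n+2,\dots,n,2n$. For an $(n,n)$-shuffle $\tau$ let $\delta^\tau=\sum_{a\le n<b,\ \tau(b)<\tau(a)}\alpha_{ba}$. For a bijection $\phi:\{1,\dots,n\}\to\{n+1,\dots,2n\}$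 let $N(\phi,\tau)$ be the number of intersecting pairs among the $n$ chords joining $\tau(a)$ and $\tau(\phi(a))$, for $2n$ points numbered in cyclic order on a circle. Put $I^\phi_\tau(\lambda)=(-1)^{N(\phi,\tau)}$ if $\lambda=\sum_{a=1}^n x_a\alpha_{a,\phi(a)}$ with integers $x_a$ such that $x_a\ge 0$ when $\tau(a)<\tau(\phi(a))$ and $x_a<0$ when $\tau(a)>\tau(\phi(a))$, and $I^\phi_\tau(\lambda)=0$ otherwise. Let $\rho_{m_i}$ and $\rho^*_{m_i}$ be the weights equal to $(m_i-1,\dots,1,0)$ and $(0,1,\dots,m_i-1)$ in the positions of the $i$-th block and to zero elsewhere. Then all spaces $H^\bullet(\mathfrak n_\pi,k)_\lambda$ are finite-dimensional, and $$F_\pi(s)=\sum_{\alpha}c^\pi_{[\alpha]}\,\sigma_{\alpha^{(1)}}(s_1)\cdots\sigma_{\alpha^{(M+N)}}(s_{M+N}),$$ where $s_i=(s_{i1},\dots,s_{i,m_i})$, the sum is over all block-dominant $\alpha=(\alpha^{(1)},\dots,\alpha^{(M+N)})\in\mathbb Z^{m}$ (each $\alpha^{(i)}=(\alpha^{(i)}_1\ge\dots\ge\alpha^{(i)}_{m_i})$),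 $\sigma_{\alpha^{(i)}}=\det(z^{\alpha^{(i)}+\rho})/\det(z^{\rho})$ is the Schur (Laurent) polynomial in $m_i$ variables, $$c^\pi_{[\alpha]}=(-1)^{\sum_i m_i(m_i-1)/2}\sum_{\phi}I^\phi_\Pi\Big(\alpha-\delta^{\Pi_1}+\delta^{\Pi}+\sum_{i=1}^{M+N}(\rho_{m_i}-\rho^*_{m_i})\Big),$$ the sum being over all bijections $\phi:\{1,\dots,n\}\to\{n+1,\dots,2n\}$, and for each monomial $s^\lambda$ only finitely many $\alpha$ contribute to its coefficient. -/

import Mathlib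

open scoped TensorProduct

noncomputable section

namespace SuperKostant

/-! ### The Chevalley–Eilenberg complex of a finite-dimensional Lie superalgebra

A Lie superalgebra `𝔫` over `k` is given by a finite homogeneous basis `(e i)`, the predicate `odd`
telling which `e i` are odd, and structure constants, `[e i, e j] = ∑ l, c i j l • e l`.
The cochain algebra `S(𝔫^*[-1])` is the free supercommutative algebra on the coordinates `ξ i`
dual to `e i`, with the parity of `ξ i` opposite to that of `e i`: it is polynomial on the
`ξ i` with `e i` odd, and exterior on the `ξ i` with `e i` even. -/

section ChevalleyEilenberg

variable (k : Type*) [Field k] {ι : Type} (odd : ι → Prop)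

/-- The algebra of cochains `S(𝔫^*[-1])`. -/
abbrev Cochains : Type _ :=
  MvPolynomial {i : ι // odd i} k ⊗[k] ExteriorAlgebra k ({i : ι // ¬ odd i} → k)

variable [DecidableEq ι] [DecidablePred odd]

/-- The coordinate `ξ i`, a generator of the cochain algebra. -/
def coord (i : ι) : Cochains k odd :=
  if h : odd i then MvPolynomial.X ⟨i, h⟩ ⊗ₜ[k] 1
  else 1 ⊗ₜ[k] ExteriorAlgebra.ι k (Pi.single ⟨i, h⟩ 1)

/-- The left partial superderivative `∂ / ∂ξ i`. -/
def coordDeriv (i : ι) : Cochains k odd →ₗ[k] Cochains k odd :=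
  if h : odd i then
    TensorProduct.map (MvPolynomial.pderiv ⟨i, h⟩).toLinearMap LinearMap.id
  else
    TensorProduct.map LinearMap.id
      (CliffordAlgebra.contractLeft (Q := (0 : QuadraticForm k ({i : ι // ¬ odd i} → k)))
        (LinearMap.proj ⟨i, h⟩))

variable [Fintype ι]

/-- The Chevalley–Eilenberg differential: the odd superderivation of the cochain algebra with
`d (ξ l) = - 1/2 ∑ i j, (-1)^|e i| * c i j l * ξ i * ξ j`, i.e. `d = ∑ l, d (ξ l) ∂ / ∂ξ l`. -/
def ceDiff (c : ι → ι → ι → k) : Cochains k odd →ₗ[k] Cochains k odd :=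
  ∑ l, LinearMap.mulLeft k
      (-(2⁻¹ : k) • ∑ i, ∑ j,
        ((if odd i then -1 else 1) * c i j l) • (coord k odd i * coord k odd j)) ∘ₗ
    coordDeriv k odd l

variable {odd} in
/-- The action on cochains of the diagonal linear map with `ξ i ↦ u i • ξ i`. -/
def diagAct (u : ι → k) : Cochains k odd →ₐ[k] Cochains k odd :=
  Algebra.TensorProduct.map
    (MvPolynomial.aeval fun i => MvPolynomial.C (u i) * MvPolynomial.X i)
    (ExteriorAlgebra.map (LinearMap.pi fun i => u i • LinearMap.proj i))

/-- The cochains of total parity `ε`: the eigenspace of eigenvalue `(-1)^ε` of the parity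
involution, which is `1` on the polynomial generators and `-1` on the exterior generators. -/
def parityPart (ε : Fin 2) : Submodule k (Cochains k odd) :=
  Module.End.eigenspace
    (TensorProduct.map LinearMap.id
      (CliffordAlgebra.involute
        (Q := (0 : QuadraticForm k ({i : ι // ¬ odd i} → k)))).toLinearMap :
      Module.End k (Cochains k odd))
    ((-1) ^ (ε : ℕ))

end ChevalleyEilenberg

/-! ### The nilpotent radical `𝔫_π(m_1, …, m_M | m_{M+1}, …, m_{M+N})` -/

section Parabolic

variable {M N : ℕ} (m : Fin (M + N) → ℕ) (π : Equiv.Perm (Fin (M + N)))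

/-- The pairs `(i, p)` with `i` a block and `p` a position in it: they index the rows and the
columns of the matrices in `𝔤𝔩(m₀ | m₁)`, and the variables `s_{ip}`. -/
abbrev Idx : Type := (i : Fin (M + N)) × Fin (m i)

/-- The first `M` blocks are even, the last `N` blocks are odd. -/
def IdxOdd (a : Idx m) : Prop := M ≤ (a.1 : ℕ)

instance : DecidablePred (IdxOdd m) := fun a => inferInstanceAs (Decidable (M ≤ (a.1 : ℕ)))

/-- `m₀ = m_1 + ⋯ + m_M`. -/
def evenDim : ℕ := ∑ i : Fin M, m (Fin.castAdd N i)

/-- `m₁ = m_{M+1} + ⋯ + m_{M+N}`. -/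
def oddDim : ℕ := ∑ j : Fin N, m (Fin.natAdd M j)

/-- `π` is an `(M, N)`-shuffle. -/
def IsShuffle (π : Equiv.Perm (Fin (M + N))) : Prop :=
  StrictMono (fun i : Fin M => π (Fin.castAdd N i)) ∧
    StrictMono (fun j : Fin N => π (Fin.natAdd M j))

/-- The matrix units `E_{ab}` that span `𝔫_π`, those with `π (block of a) < π (block of b)`. -/
abbrev NilRoot : Type := {r : Idx m × Idx m // π r.1.1 < π r.2.1}

/-- `E_{ab}` is odd if exactly one of `a`, `b` is. -/
def NilRoot.odd (r : NilRoot m π) : Prop := ¬ (IdxOdd m r.1.1 ↔ IdxOdd m r.1.2)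

instance : DecidablePred (NilRoot.odd m π) := fun r =>
  inferInstanceAs (Decidable (¬ (IdxOdd m r.1.1 ↔ IdxOdd m r.1.2)))

variable (k : Type*) [Field k]

/-- The matrix unit in `𝔤𝔩(m₀ | m₁)`. -/
def NilRoot.unit (r : NilRoot m π) : Matrix (Idx m) (Idx m) k := Matrix.single r.1.1 r.1.2 1

/-- The supercommutator `[E_r, E_r'] = E_r E_r' - (-1)^{|r||r'|} E_r' E_r`. -/
def superBracket (r r' : NilRoot m π) : Matrix (Idx m) (Idx m) k :=
  r.unit m π k * r'.unit m π k -
    (if r.odd m π ∧ r'.odd m π then (-1 : k) else 1) • (r'.unit m π k * r.unit m π k)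

/-- The structure constants of `𝔫_π` in the basis of matrix units. -/
def structConst (r r' r'' : NilRoot m π) : k := superBracket m π k r r' r''.1.1 r''.1.2

/-- The cochain algebra `C^•(𝔫_π, k)`. -/
abbrev NilCochains : Type _ := Cochains k (NilRoot.odd m π)

/-- The differential of `C^•(𝔫_π, k)`. -/
def nilDiff : NilCochains m π k →ₗ[k] NilCochains m π k :=
  ceDiff k (NilRoot.odd m π) (structConst m π k)

variable {m} in
/-- The action on cochains of an element `t` of the maximal torus `T` of the Levi subgroup.
The `(i, j)` block of a matrix in `𝔫_π` is regarded as a map `k^{m_i} → k^{m_j}`; so `E_{ab}` has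
weight `e_b - e_a`, and the dual coordinate has weight `e_a - e_b`. -/
def torusAct (t : Idx m → kˣ) : NilCochains m π k →ₐ[k] NilCochains m π k :=
  diagAct k fun r => ((t r.1.1 * (t r.1.2)⁻¹ : kˣ) : k)

/-- The cochains of weight `wt`, on which each `t ∈ T` acts as `t^wt`. -/
def weightPart (wt : Idx m → ℤ) : Submodule k (NilCochains m π k) :=
  ⨅ t : Idx m → kˣ,
    Module.End.eigenspace (torusAct π k t).toLinearMap ((∏ a, t a ^ wt a : kˣ) : k)

/-- The component of weight `wt` and parity `ε` of `H^•(𝔫_π, k) = ker d / im d`: the classes of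
the cocycles of weight `wt` and parity `ε`. -/
def cohomologyPart (ε : Fin 2) (wt : Idx m → ℤ) :
    Submodule k (NilCochains m π k ⧸ LinearMap.range (nilDiff m π k)) :=
  (LinearMap.ker (nilDiff m π k) ⊓ weightPart m π k wt ⊓
    parityPart k (NilRoot.odd m π) ε).map (LinearMap.range (nilDiff m π k)).mkQ

/-- `χ(H^•(𝔫_π, k)_wt)`, the coefficient of `s^wt` in the generating function `F_π(s)`. -/
def eulerChar (wt : Idx m → ℤ) : ℤ :=
  (Module.finrank k (cohomologyPart m π k 0 wt) : ℤ) -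
    Module.finrank k (cohomologyPart m π k 1 wt)

end Parabolic

/-! ### Schur polynomials -/

section Schur

/-- The ring of Laurent polynomials with integer coefficients in variables indexed by `I`. -/
abbrev Laurent (I : Type) : Type := AddMonoidAlgebra ℤ (I → ℤ)

/-- `det (z^β) = ∑ w ∈ S_r, sgn(w) z^{w(β)}`. -/
def alternant {r : ℕ} (β : Fin r → ℤ) : Laurent (Fin r) :=
  ∑ w : Equiv.Perm (Fin r),
    AddMonoidAlgebra.single (fun p => β (w p)) ((Equiv.Perm.sign w : ℤˣ) : ℤ)

/-- `ρ_r = (r - 1, …, 1, 0)`. -/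
def rho {r : ℕ} (p : Fin r) : ℤ := (r : ℤ) - 1 - (p : ℕ)

/-- `ρ*_r = (0, 1, …, r - 1)`. -/
def rhoStar {r : ℕ} (p : Fin r) : ℤ := (p : ℕ)

/-- `alternant β`, for `β` with entries in `ℕ`, as a determinant. -/
theorem alternant_natCast {r : ℕ} (b : Fin r → ℕ) :
    alternant (fun p => (b p : ℤ)) = Matrix.det (Matrix.of fun a i : Fin r =>
      (AddMonoidAlgebra.single (Pi.single i 1) 1 : Laurent (Fin r)) ^ b a) := by
  rw [Matrix.det_apply', alternant]
  refine Finset.sum_congr rfl fun w _ => ?_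
  have h1 : ∀ (g : Fin r → Fin r → ℤ) (s : Finset (Fin r)),
      (∏ i ∈ s, AddMonoidAlgebra.single (g i) 1 : Laurent (Fin r)) =
        AddMonoidAlgebra.single (∑ i ∈ s, g i) 1 := by
    intro g s
    classical
    induction s using Finset.induction_on with
    | empty => simp [AddMonoidAlgebra.one_def]
    | insert a s ha ih =>
      rw [Finset.prod_insert ha, Finset.sum_insert ha, ih, AddMonoidAlgebra.single_mul_single,
        one_mul]
  have h2 : ∀ i : Fin r, (AddMonoidAlgebra.single (Pi.single i 1) 1 : Laurent (Fin r)) ^ b (w i) =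
      AddMonoidAlgebra.single (Pi.single i (b (w i) : ℤ)) 1 := by
    intro i
    rw [AddMonoidAlgebra.single_pow, one_pow, ← Pi.single_smul]
    simp
  simp only [Matrix.of_apply, h2, h1, Finset.univ_sum_single]
  rw [← zsmul_eq_mul, AddMonoidAlgebra.smul_single]
  simp

/-- The division that defines the Schur polynomials is possible. -/
theorem exists_schur {r : ℕ} (α : Fin r → ℤ) :
    ∃ f : Laurent (Fin r), f * alternant rho = alternant (α + rho) := by
  nontriviality Laurent (Fin r)
  obtain ⟨c, hc⟩ : ∃ c : ℕ, ∀ p, 0 ≤ α p + rho p + c := by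
    refine ⟨∑ p, (α p + rho p).natAbs, fun p => ?_⟩
    have : (α p + rho p).natAbs ≤ ∑ p, (α p + rho p).natAbs :=
      Finset.single_le_sum (f := fun p => (α p + rho p).natAbs)
        (fun _ _ => Nat.zero_le _) (Finset.mem_univ p)
    omega
  let b : Fin r → ℕ := fun p => (α p + rho p + c).toNat
  have hb : (fun p => (b p : ℤ)) = fun p => α p + rho p + c :=
    funext fun p => Int.toNat_of_nonneg (hc p)
  let x : Fin r → Laurent (Fin r) := fun i => AddMonoidAlgebra.single (Pi.single i 1) 1
  let Q : Polynomial (Laurent (Fin r)) := ∏ i, (Polynomial.X - Polynomial.C (x i))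
  have hQ : Q.Monic := Polynomial.monic_prod_X_sub_C _ _
  have hdeg : Q.natDegree = r := by simp [Q]
  let G : Matrix (Fin r) (Fin r) (Laurent (Fin r)) :=
    Matrix.of fun a l => ((Polynomial.X ^ b a) %ₘ Q).coeff (l.rev : ℕ)
  have hmul : (Matrix.of fun a i : Fin r => x i ^ b a) =
      G * Matrix.of fun l i : Fin r => x i ^ (l.rev : ℕ) := by
    ext1 a i
    have hev : ((Polynomial.X ^ b a) %ₘ Q).eval (x i) = x i ^ b a := by
      have h := congrArg (Polynomial.eval (x i)) (Polynomial.modByMonic_add_div (Polynomial.X ^ b a) Q)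
      have h0 : Q.eval (x i) = 0 := by
        rw [Polynomial.eval_prod]
        exact Finset.prod_eq_zero (Finset.mem_univ i) (by simp)
      simpa [h0] using h
    by_cases hr : r = 0
    · exact absurd i.isLt (by omega)
    have hlt : ((Polynomial.X ^ b a) %ₘ Q).natDegree < r := by
      have := Polynomial.natDegree_modByMonic_lt (Polynomial.X ^ b a) hQ
        (fun h => hr (by rw [← hdeg, h, Polynomial.natDegree_one]))
      omega
    rw [Matrix.mul_apply, Matrix.of_apply, ← hev, Polynomial.eval_eq_sum_range' hlt,
      ← Fin.sum_univ_eq_sum_range (fun n => ((Polynomial.X ^ b a) %ₘ Q).coeff n * x i ^ n)]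
    exact (Equiv.sum_comp Fin.revPerm
      (fun l : Fin r => ((Polynomial.X ^ b a) %ₘ Q).coeff l * x i ^ (l : ℕ))).symm
  have hrho : (rho : Fin r → ℤ) = fun p => ((p.rev : ℕ) : ℤ) := by
    funext p
    simp only [rho, Fin.val_rev]
    omega
  refine ⟨AddMonoidAlgebra.single (fun _ => -(c : ℤ)) 1 * G.det, ?_⟩
  have h1 : G.det * alternant rho = alternant (fun p => (b p : ℤ)) := by
    rw [hrho, alternant_natCast, alternant_natCast]
    exact (Matrix.det_mul _ _).symm.trans (congrArg Matrix.det hmul.symm)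
  rw [mul_assoc, h1, hb, alternant, alternant, Finset.mul_sum]
  refine Finset.sum_congr rfl fun w _ => ?_
  rw [AddMonoidAlgebra.single_mul_single, one_mul]
  congr 1
  funext p
  simp only [Pi.add_apply]
  ring

/-- The Schur (Laurent) polynomial `σ_α = det (z^{α + ρ}) / det (z^ρ)`. -/
def schur {r : ℕ} (α : Fin r → ℤ) : Laurent (Fin r) := (exists_schur α).choose

variable {M N : ℕ} (m : Fin (M + N) → ℕ)

/-- `σ_{α^{(1)}}(s_1) ⋯ σ_{α^{(M+N)}}(s_{M+N})`, a Laurent polynomial in all the variables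
`s_{ip}`; here `α^{(i)} = (α_{i1}, …, α_{i,m_i})`. -/
def schurProd (α : Idx m → ℤ) : Laurent (Idx m) :=
  ∏ i, (schur fun p => α ⟨i, p⟩).mapDomain
    fun μ : Fin (m i) → ℤ => ∑ p, Pi.single (⟨i, p⟩ : Idx m) (μ p)

/-- `α` is block-dominant: `α_{i1} ≥ ⋯ ≥ α_{i,m_i}` for each block `i`. -/
def BlockDominant (α : Idx m → ℤ) : Prop := ∀ i, Antitone fun p : Fin (m i) => α ⟨i, p⟩

end Schur

/-! ### The sector sum for a Borel subalgebra of `𝔤𝔩(n | n)`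

The indices `1, …, n` (even) and `n + 1, …, 2n` (odd) are `Fin.castAdd n i` and `Fin.natAdd n j`
in `Fin (n + n)`. A bijection from the first set to the second is given by `φ : Perm (Fin n)`,
which stands for `i ↦ n + φ i`. -/

section Sector

variable {n : ℕ}

/-- The root `α_{ij} = e_i - e_j`. -/
def root (i j : Fin (n + n)) : Fin (n + n) → ℤ := Pi.single i 1 - Pi.single j 1

/-- `δ^π`, the sum of the roots `α_{ji}` over `i ≤ n < j` with `π(j) < π(i)`. -/
def deltaShift (π : Equiv.Perm (Fin (n + n))) : Fin (n + n) → ℤ :=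
  ∑ i : Fin n, ∑ j : Fin n,
    if π (Fin.natAdd n j) < π (Fin.castAdd n i) then root (Fin.natAdd n j) (Fin.castAdd n i) else 0

/-- For points numbered in their order on a circle: the chords `[a, b]` and `[c, d]` (with four
different ends) intersect. -/
def ChordsCross (a b c d : Fin (n + n)) : Prop :=
  (min a b < min c d ∧ min c d < max a b ∧ max a b < max c d) ∨
    (min c d < min a b ∧ min a b < max c d ∧ max c d < max a b)

open Classical in
/-- `N(φ, π)`, the number of intersecting pairs of the chords `[π(i), π(φ(i))]`. -/
def crossingNumber (φ : Equiv.Perm (Fin n)) (π : Equiv.Perm (Fin (n + n))) : ℕ :=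
  (Finset.univ.filter fun q : Fin n × Fin n => q.1 < q.2 ∧
    ChordsCross (π (Fin.castAdd n q.1)) (π (Fin.natAdd n (φ q.1)))
      (π (Fin.castAdd n q.2)) (π (Fin.natAdd n (φ q.2)))).card

/-- The `(φ, π)`-sector in `ℤ^{2n}`: the combinations of the `α_{i,φ(i)}` with coefficients that
are `≥ 0` if `π(i) < π(φ(i))` and `< 0` otherwise. -/
def sector (φ : Equiv.Perm (Fin n)) (π : Equiv.Perm (Fin (n + n))) : Set (Fin (n + n) → ℤ) :=
  {wt | ∃ a : Fin n → ℤ,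
    (∀ i, π (Fin.castAdd n i) < π (Fin.natAdd n (φ i)) → 0 ≤ a i) ∧
    (∀ i, π (Fin.natAdd n (φ i)) < π (Fin.castAdd n i) → a i < 0) ∧
    wt = ∑ i, a i • root (Fin.castAdd n i) (Fin.natAdd n (φ i))}

open Classical in
/-- `I_φ^π(wt)`, which is `(-1)^{N(φ, π)}` on the `(φ, π)`-sector and `0` elsewhere. -/
def sectorIndicator (φ : Equiv.Perm (Fin n)) (π : Equiv.Perm (Fin (n + n)))
    (wt : Fin (n + n) → ℤ) : ℤ :=
  if wt ∈ sector φ π then (-1) ^ crossingNumber φ π else 0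

/-- The alternating shuffle, for which the order of the indices is `1, n + 1, 2, n + 2, …, n, 2n`. -/
def altShuffle (n : ℕ) : Equiv.Perm (Fin (n + n)) where
  toFun a := ⟨if (a : ℕ) < n then 2 * a else 2 * (a - n) + 1, by split_ifs <;> omega⟩
  invFun a := ⟨if (a : ℕ) % 2 = 0 then a / 2 else n + a / 2, by split_ifs <;> omega⟩
  left_inv a := by
    ext
    simp only
    split_ifs <;> omega
  right_inv a := by
    ext
    simp only
    split_ifs <;> omega

end Sector

/-! ### The coefficients for a parabolic subalgebra -/

section Coefficients

variable {M N : ℕ} (m : Fin (M + N) → ℕ) (π : Equiv.Perm (Fin (M + N)))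

/-- A vector indexed by the variables `s_{ip}`, written in the order of the variables as
`(x_1, …, x_{m₀+m₁})`, and completed by zeros to an element of `ℤ^{2n}`. -/
def complete (n : ℕ) (x : Idx m → ℤ) : Fin (n + n) → ℤ := fun a =>
  if h : (a : ℕ) < ∑ i, m i then x (finSigmaFinEquiv.symm ⟨a, h⟩) else 0

/-- `π (i)` if the `a`-th variable is in the block `i`; a larger value for the additional
variables. -/
def blockKey (n : ℕ) (a : Fin (n + n)) : ℕ :=
  if h : (a : ℕ) < ∑ i, m i then (π (finSigmaFinEquiv.symm ⟨a, h⟩).1 : ℕ) else M + N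

/-- The refinement `Π` of `π`: the permutation such that `Π(a) < Π(b)` if `a`, `b` are in blocks
`i`, `j` with `π(i) < π(j)`, or if `a < b` are in the same block. It fixes the additional indices,
which come last. (`Tuple.sort` sorts stably and lists the sorted indices; its inverse gives their
places in this list.) -/
def refine (n : ℕ) : Equiv.Perm (Fin (n + n)) := (Tuple.sort (blockKey m π n))⁻¹

/-- `∑ i, ρ_{m_i}`. -/
def blockRho : Idx m → ℤ := fun a => rho a.2

/-- `∑ i, ρ*_{m_i}`. -/
def blockRhoStar : Idx m → ℤ := fun a => rhoStar a.2

/-- The coefficient `c_{[α]}^π`, with `n = m₀` (it is assumed that `m₁ ≤ m₀`). -/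
def schurCoeff (α : Idx m → ℤ) : ℤ :=
  (-1) ^ (∑ i, (m i).choose 2) *
    ∑ φ : Equiv.Perm (Fin (evenDim m)),
      sectorIndicator φ (refine m π (evenDim m))
        (complete m (evenDim m) (α + blockRho m - blockRhoStar m) -
          deltaShift (altShuffle (evenDim m)) + deltaShift (refine m π (evenDim m)))

end Coefficients

end SuperKostant

end

open SuperKostant

/-! The cohomology enters only through its Euler characteristic. The differential preserves the
torus weight and reverses the total parity. The weight spaces of the cochains are
finite-dimensional, because a linear height is positive on all roots of the radical. By the
Euler–Poincaré principle (`finrank_cohomology_sub`, `eulerChar_eq_nilChar`) the cohomology may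
therefore be replaced by the cochains. These have a basis of monomials, polynomial in the odd root
vectors and exterior in the even ones, so `F_π` is the expansion of `∏_{even}(1 - s_a/s_b) /
∏_{odd}(1 - s_a/s_b)`, the products running over the roots of the radical. This is `nilChar`.

The other ingredient is Cauchy's determinant, `∑_φ sgn φ ∏_i 1/(1 - x_i w_{φ(i)}) = ∏_{i<j} (x_j -
x_i)(w_j - w_i) / ∏_{i,j} (1 - x_i w_j)`, with `x_i = s_i` and `w_j = 1/s_{n+j}`. Each factor on the
left is expanded in the direction prescribed by the order `Π`: `1/(1 - z)` is `∑_{a≥0} z^a` or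
`-∑_{a<0} z^a`. The term of `φ` becomes a signed indicator of a sector. The expansion signs together
with `sgn φ` equal `(-1)^{N(φ,Π)}` up to a sign independent of `φ` (`neg_one_pow_crossingNumber`).
This gives the denominator identity of `𝔤𝔩(n|n)` in `act_sectorSum`; the shifts `δ^{Π_1}` and `δ^Π`
are the monomials needed to rewrite the Vandermonde products and the odd factors through positive
roots. The variables beyond `m` come last in the order. Every positive root involving them has
positive level for a suitable linear form, so restricting to level zero removes them and leaves the
identity of `𝔤𝔩(m₀|m₁)` (`act_sectorSum_complete`).

The even positive roots of `𝔤𝔩(m₀|m₁)` are those of the radical and those of the Levi subgroup.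
Comparing the two descriptions, `F_π` times the product of `1 - s_a/s_b` over the positive roots of
the Levi subgroup is the sum over the sectors (`act_denom_nilChar`). Up to a sign and the monomial
`s^{ρ*}` this product is the Weyl denominator. Since `F_π` is invariant under the Weyl group of the
Levi subgroup, its product with the Weyl denominator is antisymmetric, hence a combination of
alternants whose coefficients are its values at the weights `α + ρ`. Dividing by the Weyl
denominator turns alternants into Schur polynomials (`eq_finsum_schurProd`).

Infinite series in several directions have no product. They are treated as functions on the weight
lattice, on which Laurent polynomials act by convolution, and an expansion is pinned down by the
equation it satisfies after clearing denominators. Uniqueness holds because `1 - s^r` is injective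
on functions supported in a half-space (`eq_of_act_prod_eq`), or on functions with finite support
for given block sums (`eq_of_act_denom_blockPair_eq`). -/

open scoped TensorProduct

noncomputable section

namespace SuperKostant

/-! ### Laurent polynomials acting on functions by convolution -/

section Convolution

variable {Λ : Type*} [AddCommGroup Λ]

/-- Laurent polynomials act on functions on the weights, the monomial `s^r` by translation
by `r`. -/
def act : AddMonoidAlgebra ℤ Λ →ₐ[ℤ] Module.End ℤ (Λ → ℤ) :=
  AddMonoidAlgebra.lift ℤ _ _
    { toFun := fun r => LinearMap.funLeft ℤ ℤ fun x => x - r.toAdd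
      map_one' := by ext; simp [LinearMap.funLeft]
      map_mul' := fun a b => by
        ext h x
        simp only [LinearMap.funLeft, toAdd_mul, LinearMap.coe_mk, AddHom.coe_mk,
          Function.comp_apply, Module.End.mul_apply]
        congr 1
        abel }

/-- The monomial `s^r`. -/
abbrev mono (r : Λ) : AddMonoidAlgebra ℤ Λ := AddMonoidAlgebra.single r 1

theorem mono_mul (a b : Λ) : mono a * mono b = mono (a + b) := by
  simp [mono, AddMonoidAlgebra.single_mul_single]

theorem mono_zero : mono (0 : Λ) = 1 := rfl

theorem prod_mono {ι : Type*} (s : Finset ι) (g : ι → Λ) :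
    ∏ i ∈ s, mono (g i) = mono (∑ i ∈ s, g i) := by
  classical
  induction s using Finset.induction_on with
  | empty => simp [mono_zero]
  | insert a s ha ih => rw [Finset.prod_insert ha, Finset.sum_insert ha, ih, mono_mul]

theorem act_single (r : Λ) (c : ℤ) (h : Λ → ℤ) (x : Λ) :
    act (AddMonoidAlgebra.single r c) h x = c * h (x - r) := by
  simp [act, AddMonoidAlgebra.lift_single, LinearMap.funLeft]

theorem act_mono (r : Λ) (h : Λ → ℤ) (x : Λ) : act (mono r) h x = h (x - r) := by
  simp [act_single]

theorem act_one_sub (r : Λ) (h : Λ → ℤ) (x : Λ) :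
    act (1 - mono r) h x = h x - h (x - r) := by
  simp [act_mono]

theorem act_mul (p q : AddMonoidAlgebra ℤ Λ) (h : Λ → ℤ) : act (p * q) h = act p (act q h) := by
  rw [map_mul, Module.End.mul_apply]

theorem act_neg_one_pow (n : ℕ) (h : Λ → ℤ) : act ((-1) ^ n) h = (-1) ^ n • h := by
  rcases neg_one_pow_eq_or (AddMonoidAlgebra ℤ Λ) n with h1 | h1 <;>
    rcases n.even_or_odd with h2 | h2 <;> simp [h2]

theorem act_coeff (p q : AddMonoidAlgebra ℤ Λ) : act p q.coeff = (p * q).coeff := by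
  induction p using AddMonoidAlgebra.induction_linear with
  | zero => ext; simp
  | add f g hf hg => rw [map_add, LinearMap.add_apply, hf, hg, add_mul]; rfl
  | single r c =>
    ext x
    rw [act_single, AddMonoidAlgebra.coeff_single_mul_eq_mul_coeff (x - r)]
    intro y _
    constructor <;> rintro rfl <;> abel

/-- Writing a Laurent polynomial as an operator applied to the delta function at `0` lets the
results on pulling back `act` along homomorphisms apply to polynomial right-hand sides as well. -/
theorem act_eq_coeff {p : AddMonoidAlgebra ℤ Λ} : act p (1 : AddMonoidAlgebra ℤ Λ).coeff =
    p.coeff := by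
  rw [act_coeff, mul_one]

/-- A product of the operators `1 - s^r` is injective on a class of functions that is stable
under these operators, and in which no nonzero function is invariant under some `s^r`. -/
theorem eq_zero_of_act_prod {ι : Type*} (S : Finset ι) (w : ι → Λ) (U : (Λ → ℤ) → Prop)
    (hU : ∀ h, U h → ∀ i ∈ S, U (act (1 - mono (w i)) h))
    (hv : ∀ h, U h → ∀ i ∈ S, ∀ x, ∃ n : ℕ, h (x - n • w i) = 0)
    {h : Λ → ℤ} (hh : U h) (h0 : act (∏ i ∈ S, (1 - mono (w i))) h = 0) : h = 0 := by
  classical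
  induction S using Finset.induction_on generalizing h with
  | empty => simpa using h0
  | insert a S ha ih =>
    rw [Finset.prod_insert ha, mul_comm, act_mul] at h0
    have h1 : act (1 - mono (w a)) h = 0 :=
      ih (fun h hh i hi => hU h hh i (Finset.mem_insert_of_mem hi))
        (fun h hh i hi => hv h hh i (Finset.mem_insert_of_mem hi))
        (hU h hh a (Finset.mem_insert_self _ _)) h0
    have h2 : ∀ x, h (x - w a) = h x := fun x => by
      have := congrFun h1 x
      rw [act_one_sub, Pi.zero_apply] at this
      omega
    have h3 : ∀ (n : ℕ) x, h (x - n • w a) = h x := by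
      intro n
      induction n with
      | zero => simp
      | succ n ihn =>
        intro x
        rw [succ_nsmul, ← sub_sub, h2, ihn]
    ext x
    obtain ⟨n, hn⟩ := hv h hh a (Finset.mem_insert_self _ _) x
    rw [← h3 n x, hn]
    rfl

/-- The functions with support in a half-space. -/
def BoundedBelow (ht : Λ →+ ℤ) (h : Λ → ℤ) : Prop := ∃ C : ℤ, ∀ x, h x ≠ 0 → C ≤ ht x

theorem BoundedBelow.sub {ht : Λ →+ ℤ} {f g : Λ → ℤ} (hf : BoundedBelow ht f)
    (hg : BoundedBelow ht g) : BoundedBelow ht (f - g) := by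
  obtain ⟨C, hC⟩ := hf
  obtain ⟨D, hD⟩ := hg
  refine ⟨min C D, fun x hx => ?_⟩
  by_cases h : f x = 0
  · exact (min_le_right _ _).trans (hD x fun h' => hx (by simp [h, h']))
  · exact (min_le_left _ _).trans (hC x h)

theorem BoundedBelow.act_one_sub {ht : Λ →+ ℤ} {f : Λ → ℤ} (hf : BoundedBelow ht f) (r : Λ) :
    BoundedBelow ht (act (1 - mono r) f) := by
  obtain ⟨C, hC⟩ := hf
  refine ⟨min C (C + ht r), fun x hx => ?_⟩
  rw [SuperKostant.act_one_sub] at hx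
  by_cases h : f x = 0
  · have := hC (x - r) (fun h' => hx (by rw [h, h']; rfl))
    rw [map_sub] at this
    exact (min_le_right _ _).trans (by omega)
  · exact (min_le_left _ _).trans (hC x h)

theorem BoundedBelow.act_prod {ι : Type*} {ht : Λ →+ ℤ} {f : Λ → ℤ} (hf : BoundedBelow ht f)
    (S : Finset ι) (w : ι → Λ) : BoundedBelow ht (act (∏ i ∈ S, (1 - mono (w i))) f) := by
  classical
  induction S using Finset.induction_on with
  | empty => simpa using hf
  | insert a S ha ih =>
    rw [Finset.prod_insert ha, act_mul]
    exact ih.act_one_sub _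

theorem BoundedBelow.exists_eq_zero {ht : Λ →+ ℤ} {f : Λ → ℤ} (hf : BoundedBelow ht f) {r : Λ}
    (hr : 0 < ht r) (x : Λ) : ∃ n : ℕ, f (x - n • r) = 0 := by
  obtain ⟨C, hC⟩ := hf
  -- Each translation lowers the height by at least `1`, so this many of them bring it strictly
  -- below the bound `C`.
  refine ⟨(ht x - C).toNat + 1, ?_⟩
  by_contra h
  have h1 := hC _ h
  rw [map_sub, map_nsmul, nsmul_eq_mul] at h1
  push_cast at h1
  nlinarith [Int.self_le_toNat (ht x - C)]

/-- A nonzero function invariant under translation by `r` with `0 < ht r` has nonzero values at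
arbitrarily low height, so division by `1 - s^r` is unique among functions supported in a
half-space. Expansions of rational functions in a prescribed direction are identified in this way.
-/
theorem eq_of_act_prod_eq {ι : Type*} {ht : Λ →+ ℤ} (S : Finset ι) (w : ι → Λ)
    (hw : ∀ i ∈ S, 0 < ht (w i)) {f g : Λ → ℤ} (hf : BoundedBelow ht f) (hg : BoundedBelow ht g)
    (h : act (∏ i ∈ S, (1 - mono (w i))) f = act (∏ i ∈ S, (1 - mono (w i))) g) : f = g := by
  rw [← sub_eq_zero, ← map_sub] at h
  rw [← sub_eq_zero]
  exact eq_zero_of_act_prod S w (BoundedBelow ht) (fun _ hh _ _ => hh.act_one_sub _)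
    (fun _ hh i hi x => hh.exists_eq_zero (hw i hi) x) (hf.sub hg) h

/-- Translations by weights of positive level do not change the level-zero part of a function
that vanishes in negative level. -/
theorem act_prod_of_pos {ι : Type*} (L : Λ →+ ℤ) (S : Finset ι) (w : ι → Λ)
    (hw : ∀ i ∈ S, 0 < L (w i)) {f : Λ → ℤ} (hf : ∀ x, L x < 0 → f x = 0) :
    (∀ x, L x < 0 → act (∏ i ∈ S, (1 - mono (w i))) f x = 0) ∧
      ∀ x, L x = 0 → act (∏ i ∈ S, (1 - mono (w i))) f x = f x := by
  classical
  induction S using Finset.induction_on with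
  | empty => simpa using hf
  | insert a S ha ih =>
    obtain ⟨h1, h2⟩ := ih fun i hi => hw i (Finset.mem_insert_of_mem hi)
    have h3 := hw a (Finset.mem_insert_self _ _)
    rw [Finset.prod_insert ha, act_mul]
    refine ⟨fun x hx => ?_, fun x hx => ?_⟩
    · rw [act_one_sub, h1 x hx, h1 (x - w a) (by rw [map_sub]; omega), sub_zero]
    · rw [act_one_sub, h2 x hx, h1 (x - w a) (by rw [map_sub]; omega), sub_zero]

/-- The operators `1 - s^r` commute with pulling back along a homomorphism. -/
theorem act_prod_comp {Λ' ι : Type*} [AddCommGroup Λ'] (c : Λ' →+ Λ) (S : Finset ι) (w : ι → Λ')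
    (f : Λ → ℤ) : act (∏ i ∈ S, (1 - mono (c (w i)))) f ∘ c =
      act (∏ i ∈ S, (1 - mono (w i))) (f ∘ c) := by
  classical
  induction S using Finset.induction_on with
  | empty => simp
  | insert a S ha ih =>
    rw [Finset.prod_insert ha, Finset.prod_insert ha, act_mul, act_mul, ← ih]
    ext x
    rw [Function.comp_apply, act_one_sub, act_one_sub, Function.comp_apply, Function.comp_apply,
      map_sub c]

end Convolution

/-! ### Signed partition functions -/

section Partition

variable {Λ E P : Type*} [AddCommGroup Λ]

/-- The coefficients of `∏ (1 - s^{v i}) / ∏ (1 - s^{w j})`. -/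
def partitionFun [Fintype E] (v : E → Λ) (w : P → Λ) (x : Λ) : ℤ :=
  ∑ A : Finset E, (-1) ^ A.card *
    (Set.ncard {e : P →₀ ℕ | ∑ i ∈ A, v i + Finsupp.linearCombination ℕ w e = x} : ℤ)

theorem exists_of_partitionFun_ne_zero [Fintype E] (w : P → Λ) (v : E → Λ) {x : Λ}
    (h : partitionFun v w x ≠ 0) :
    ∃ (A : Finset E) (e : P →₀ ℕ), ∑ i ∈ A, v i + Finsupp.linearCombination ℕ w e = x := by
  obtain ⟨A, _, hA⟩ := Finset.exists_ne_zero_of_sum_ne_zero h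
  have h1 : {e : P →₀ ℕ | ∑ i ∈ A, v i + Finsupp.linearCombination ℕ w e = x}.Nonempty := by
    rw [Set.nonempty_iff_ne_empty]
    intro h
    rw [h] at hA
    simp at hA
  exact ⟨A, h1⟩

theorem partitionFun_eq [Fintype E] (v : E → Λ) (w : P → Λ) :
    partitionFun v w = act (∏ i, (1 - mono (v i)))
      (fun x => (Set.ncard {e : P →₀ ℕ | Finsupp.linearCombination ℕ w e = x} : ℤ)) := by
  classical
  ext x
  simp only [sub_eq_add_neg, Finset.prod_one_add, Finset.prod_neg, map_sum,
    LinearMap.sum_apply, Finset.sum_apply, act_mul, prod_mono, act_neg_one_pow, Finset.powerset_univ, partitionFun]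
  refine Finset.sum_congr rfl fun A _ => ?_
  rw [Pi.smul_apply, act_mono, smul_eq_mul]
  simp only [eq_sub_iff_add_eq, add_comm]

variable [Fintype P] (ht : Λ →+ ℤ) (w : P → Λ)

theorem map_linearCombination (e : P →₀ ℕ) :
    ht (Finsupp.linearCombination ℕ w e) = ∑ i, (e i : ℤ) * ht (w i) := by
  rw [Finsupp.linearCombination_apply, Finsupp.sum_fintype _ _ (by simp), map_sum]
  simp

theorem map_linearCombination_nonneg (hw : ∀ i, 0 ≤ ht (w i)) (e : P →₀ ℕ) :
    0 ≤ ht (Finsupp.linearCombination ℕ w e) := by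
  rw [map_linearCombination]
  exact Finset.sum_nonneg fun i _ => mul_nonneg (by positivity) (hw i)

theorem finite_linearCombination_le (hw : ∀ i, 0 < ht (w i)) (c : ℤ) :
    {e : P →₀ ℕ | ht (Finsupp.linearCombination ℕ w e) ≤ c}.Finite := by
  classical
  -- Every part has height at least `1`, so no multiplicity can exceed `c`.
  refine (Set.finite_Icc 0 (Finsupp.equivFunOnFinite.symm fun _ : P => c.toNat)).subset
    fun e he => ⟨zero_le, ?_⟩
  simp only [Set.mem_ofPred_eq, map_linearCombination] at he
  intro i
  have h1 : (e i : ℤ) * ht (w i) ≤ ∑ i, (e i : ℤ) * ht (w i) :=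
    Finset.single_le_sum (f := fun i => (e i : ℤ) * ht (w i))
      (fun i _ => mul_nonneg (by positivity) (hw i).le) (Finset.mem_univ i)
  have h2 : (e i : ℤ) ≤ e i * ht (w i) := by nlinarith [hw i]
  simp only [Finsupp.equivFunOnFinite_symm_apply_apply]
  omega

theorem finite_linearCombination_eq (hw : ∀ i, 0 < ht (w i)) (x : Λ) :
    {e : P →₀ ℕ | Finsupp.linearCombination ℕ w e = x}.Finite :=
  (finite_linearCombination_le ht w hw (ht x)).subset fun e he => by
    simp only [Set.mem_ofPred_eq] at he ⊢
    rw [he]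

/-- The recursion for the number of partitions in which some parts are not allowed. -/
theorem act_prod_ncard (hw : ∀ i, 0 < ht (w i)) (S : Finset P) :
    act (∏ i ∈ S, (1 - mono (w i)))
      (fun x => (Set.ncard {e : P →₀ ℕ | Finsupp.linearCombination ℕ w e = x} : ℤ)) =
    fun x => (Set.ncard
      {e : P →₀ ℕ | (∀ i ∈ S, e i = 0) ∧ Finsupp.linearCombination ℕ w e = x} : ℤ) := by
  classical
  induction S using Finset.induction_on with
  | empty => simp
  | insert a S ha ih =>
    rw [Finset.prod_insert ha, act_mul, ih]
    ext x
    rw [act_one_sub]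
    have hfin : ∀ x, {e : P →₀ ℕ | (∀ i ∈ S, e i = 0) ∧
        Finsupp.linearCombination ℕ w e = x}.Finite := fun x =>
      (finite_linearCombination_eq ht w hw x).subset fun e he => he.2
    -- Either the part `a` does not occur, or one copy of it can be removed; removal is a bijection
    -- onto the partitions of `x - w a`.
    have hsplit : {e : P →₀ ℕ | (∀ i ∈ S, e i = 0) ∧ Finsupp.linearCombination ℕ w e = x} =
        {e : P →₀ ℕ | (∀ i ∈ insert a S, e i = 0) ∧ Finsupp.linearCombination ℕ w e = x} ∪
        (fun e => e + Finsupp.single a 1) ''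
          {e : P →₀ ℕ | (∀ i ∈ S, e i = 0) ∧ Finsupp.linearCombination ℕ w e = x - w a} := by
      ext e
      simp only [Set.mem_ofPred_eq, Set.mem_union, Set.mem_image, Finset.forall_mem_insert]
      constructor
      · rintro ⟨h1, h2⟩
        by_cases hea : e a = 0
        · exact Or.inl ⟨⟨hea, h1⟩, h2⟩
        · have h3 : e - Finsupp.single a 1 + Finsupp.single a 1 = e :=
            tsub_add_cancel_of_le (Finsupp.single_le_iff.2 (by omega))
          refine Or.inr ⟨e - Finsupp.single a 1, ⟨fun i hi => ?_, ?_⟩, h3⟩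
          · simp [h1 i hi]
          · rw [eq_sub_iff_add_eq, ← h2]
            conv_rhs => rw [← h3, map_add]
            simp
      · rintro (⟨⟨_, h1⟩, h2⟩ | ⟨e, ⟨h1, h2⟩, rfl⟩)
        · exact ⟨h1, h2⟩
        · refine ⟨fun i hi => ?_, by simp [h2]⟩
          have : a ≠ i := fun h => ha (h ▸ hi)
          simp [h1 i hi, this]
    have hdisj : Disjoint
        {e : P →₀ ℕ | (∀ i ∈ insert a S, e i = 0) ∧ Finsupp.linearCombination ℕ w e = x}
        ((fun e => e + Finsupp.single a 1) ''
          {e : P →₀ ℕ | (∀ i ∈ S, e i = 0) ∧ Finsupp.linearCombination ℕ w e = x - w a}) := by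
      rw [Set.disjoint_left]
      rintro e ⟨h1, -⟩ ⟨e', -, rfl⟩
      have := h1 a (Finset.mem_insert_self _ _)
      simp at this
    rw [hsplit, Set.ncard_union_eq hdisj ((hfin x).subset fun e he =>
      ⟨fun i hi => he.1 i (Finset.mem_insert_of_mem hi), he.2⟩) ((hfin _).image _),
      Set.ncard_image_of_injective _ (add_left_injective _)]
    push_cast
    ring

theorem act_prod_ncard_univ (hw : ∀ i, 0 < ht (w i)) :
    act (∏ i, (1 - mono (w i)))
      (fun x => (Set.ncard {e : P →₀ ℕ | Finsupp.linearCombination ℕ w e = x} : ℤ)) =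
    (1 : AddMonoidAlgebra ℤ Λ).coeff := by
  classical
  rw [act_prod_ncard ht w hw]
  ext x
  have : {e : P →₀ ℕ | (∀ i ∈ Finset.univ, e i = 0) ∧ Finsupp.linearCombination ℕ w e = x} =
      if 0 = x then {0} else ∅ := by
    ext e
    have h1 : (∀ i ∈ Finset.univ, e i = 0) ↔ e = 0 := by simp [Finsupp.ext_iff]
    rw [Set.mem_ofPred_eq, h1]
    split_ifs with h
    · constructor
      · exact fun h => h.1
      · rintro rfl
        simp [h]
    · simp only [Set.mem_empty_iff_false, iff_false]
      rintro ⟨rfl, h2⟩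
      exact h (by simpa using h2)
  rw [this, AddMonoidAlgebra.one_def, AddMonoidAlgebra.coeff_single, Finsupp.single_apply]
  split_ifs <;> simp

variable [Fintype E] (v : E → Λ)

/-- The geometric series in the denominator cancel. With support in a half-space, this equation
determines the partition function, and only the equation is used to compare it with other
expansions. -/
theorem act_partitionFun (hw : ∀ i, 0 < ht (w i)) :
    act (∏ i, (1 - mono (w i))) (partitionFun v w) =
      (∏ i, (1 - mono (v i)) : AddMonoidAlgebra ℤ Λ).coeff := by
  rw [partitionFun_eq, ← act_mul, mul_comm, act_mul, act_prod_ncard_univ ht w hw, act_coeff,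
    mul_one]

/-- The linear form need only be nonnegative on the parts, so this also applies to forms that vanish
on many of them, such as `extraLevel`. -/
theorem partitionFun_nonneg (hv : ∀ i, 0 ≤ ht (v i)) (hw : ∀ i, 0 ≤ ht (w i)) {x : Λ}
    (h : partitionFun v w x ≠ 0) : 0 ≤ ht x := by
  obtain ⟨A, e, rfl⟩ := exists_of_partitionFun_ne_zero w v h
  rw [map_add, map_sum]
  exact add_nonneg (Finset.sum_nonneg fun i _ => hv i) (map_linearCombination_nonneg ht w hw e)

theorem finite_partitionFun (hv : ∀ i, 0 ≤ ht (v i)) (hw : ∀ i, 0 < ht (w i)) (c : ℤ) :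
    {x : Λ | partitionFun v w x ≠ 0 ∧ ht x ≤ c}.Finite := by
  refine (((Set.finite_univ (α := Finset E)).prod (finite_linearCombination_le ht w hw c)).image
    fun q => ∑ i ∈ q.1, v i + Finsupp.linearCombination ℕ w q.2).subset ?_
  rintro x ⟨hx, hc⟩
  obtain ⟨A, e, rfl⟩ := exists_of_partitionFun_ne_zero w v hx
  refine ⟨(A, e), ⟨Set.mem_univ _, ?_⟩, rfl⟩
  rw [map_add, map_sum] at hc
  have := Finset.sum_nonneg (s := A) fun i _ => hv i
  simp only [Set.mem_ofPred_eq]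
  omega

end Partition

/-! ### Cauchy's determinant -/

section Cauchy

open Finset in
-- The `(i, j)` entry is the value at `x i` of a polynomial of degree less than `n` that depends
-- only on `j`. The matrix is therefore the Vandermonde matrix of `x` times a matrix `D` of
-- coefficients, and `D` does not depend on `x`.
theorem det_cauchy_field {K : Type*} [Field K] {n : ℕ} (x w : Fin n → K)
    (hw : Function.Injective w) (h0 : ∀ i, w i ≠ 0) :
    (Matrix.of fun i j => ∏ j' ∈ {j}ᶜ, (1 - x i * w j')).det =
      ∏ i, ∏ j ∈ Ioi i, ((x j - x i) * (w j - w i)) := by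
  let p : Fin n → Polynomial K := fun j => ∏ j' ∈ {j}ᶜ, (1 - Polynomial.X * Polynomial.C (w j'))
  have hp : ∀ j, (p j).natDegree < n := by
    intro j
    have h1 : (p j).natDegree ≤ ∑ _j' ∈ ({j}ᶜ : Finset (Fin n)), 1 :=
      (Polynomial.natDegree_prod_le _ _).trans (sum_le_sum fun j' _ => by
        compute_degree)
    rw [sum_const, card_compl, card_singleton, Fintype.card_fin, smul_eq_mul, mul_one] at h1
    have := j.isLt
    omega
  let D : Matrix (Fin n) (Fin n) K := Matrix.of fun l j => (p j).coeff l
  have hM : ∀ y : Fin n → K, (Matrix.of fun i j => ∏ j' ∈ {j}ᶜ, (1 - y i * w j')) =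
      Matrix.vandermonde y * D := by
    intro y
    ext i j
    have h1 : (p j).eval (y i) = ∏ j' ∈ {j}ᶜ, (1 - y i * w j') := by
      simp only [p, Polynomial.eval_prod, Polynomial.eval_sub, Polynomial.eval_one,
        Polynomial.eval_mul, Polynomial.eval_X, Polynomial.eval_C]
    rw [Matrix.of_apply, ← h1, Polynomial.eval_eq_sum_range' (hp j), Matrix.mul_apply,
      ← Fin.sum_univ_eq_sum_range (fun l => (p j).coeff l * y i ^ l)]
    exact sum_congr rfl fun l _ => by
      rw [Matrix.vandermonde_apply, mul_comm]; rfl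
  -- At `x i = (w i)⁻¹` every off-diagonal entry contains a vanishing factor, so the determinant is
  -- a product of diagonal entries. Cancelling the Vandermonde determinant of the inverses yields
  -- `det D`.
  have hD : D.det = ∏ i, ∏ j ∈ Ioi i, (w j - w i) := by
    have h1 := congrArg Matrix.det (hM fun i => (w i)⁻¹)
    have h2 : (Matrix.of fun i j => ∏ j' ∈ {j}ᶜ, (1 - (w i)⁻¹ * w j')) =
        Matrix.diagonal fun j => ∏ j' ∈ {j}ᶜ, (1 - (w j)⁻¹ * w j') := by
      ext i j
      rw [Matrix.diagonal_apply, Matrix.of_apply]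
      split_ifs with h
      · rw [h]
      · exact prod_eq_zero (i := i) (by simpa using h) (by simp [h0])
    rw [h2, Matrix.det_diagonal, Matrix.det_mul, Matrix.det_vandermonde,
      ← prod_prod_Ioi_mul_eq_prod_prod_off_diag (fun j' j => 1 - (w j)⁻¹ * w j')] at h1
    have h3 : ∏ i, ∏ j ∈ Ioi i, ((w j)⁻¹ - (w i)⁻¹) ≠ 0 := by
      refine prod_ne_zero_iff.2 fun i _ => prod_ne_zero_iff.2 fun j hj => ?_
      rw [sub_ne_zero]
      exact fun h => (mem_Ioi.1 hj).ne' (hw (inv_injective h))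
    refine mul_left_cancel₀ h3 (h1.symm.trans ?_)
    simp only [← prod_mul_distrib]
    refine prod_congr rfl fun i _ => prod_congr rfl fun j _ => ?_
    have := h0 i
    have := h0 j
    field_simp
  rw [hM, Matrix.det_mul, Matrix.det_vandermonde, hD]
  simp only [prod_mul_distrib]

open Finset in
/-- Cauchy's determinant, multiplied by the common denominator. -/
theorem det_cauchy {R : Type*} [CommRing R] [IsDomain R] {n : ℕ} (x w : Fin n → R)
    (hw : Function.Injective w) (h0 : ∀ i, w i ≠ 0) :
    (Matrix.of fun i j => ∏ j' ∈ {j}ᶜ, (1 - x i * w j')).det =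
      ∏ i, ∏ j ∈ Ioi i, ((x j - x i) * (w j - w i)) := by
  have hinj := IsFractionRing.injective R (FractionRing R)
  apply hinj
  have h1 := det_cauchy_field (fun i => algebraMap R (FractionRing R) (x i))
    (fun i => algebraMap R (FractionRing R) (w i)) (hinj.comp hw)
    fun i => by simpa using h0 i
  rw [RingHom.map_det]
  convert h1 using 1
  · congr 1
    ext i j
    simp [map_prod]
  · simp [map_prod]

end Cauchy

/-! ### The sign of a sector -/

section Sign

variable {n : ℕ}

/-- `-1` if the proposition holds and `1` otherwise. -/
def signOf (p : Prop) [Decidable p] : ℤ := if p then -1 else 1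

theorem signOf_mul_self (p : Prop) [Decidable p] : signOf p * signOf p = 1 := by
  unfold signOf
  split_ifs <;> simp

open Classical in
-- Once `a < c` is fixed, the parity of the crossing is the parity of a count of inversions. Written
-- as a product of separate comparisons, it can be multiplied over all pairs of chords and
-- regrouped.
theorem chordsCross_sign {a b c d : Fin (n + n)} (hac : a < c) (had : a ≠ d)
    (hbc : b ≠ c) (hcd : c ≠ d) (hbd : b ≠ d) :
    signOf (ChordsCross a b c d) =
      -1 * (if b < d then 1 else -1) * (signOf (d < a) * signOf (b < c)) := by
  have key : ChordsCross a b c d ↔ (b < d ∧ ((a < d ∧ c < b) ∨ (d < a ∧ b < c))) ∨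
      (d < b ∧ ((d < a ∧ c < b) ∨ (a < d ∧ b < c))) := by
    unfold ChordsCross
    rcases le_total a b with h1 | h1 <;> rcases le_total c d with h2 | h2 <;>
      simp only [h1, h2, min_eq_left, max_eq_right, min_eq_right, max_eq_left] <;>
      simp only [Fin.lt_def, Fin.le_def, ne_eq, Fin.ext_iff] at * <;> omega
  unfold signOf
  rw [if_congr key rfl rfl]
  simp only [Fin.lt_def, ne_eq, Fin.ext_iff] at *
  split_ifs <;> first | rfl | omega

open Finset in
theorem prod_prod_eq_diag_mul {M : Type*} [CommMonoid M] (f : Fin n → Fin n → M) :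
    ∏ i, ∏ j, f i j = (∏ i, f i i) * ∏ i, ∏ j ∈ Ioi i, (f j i * f i j) := by
  rw [prod_prod_Ioi_mul_eq_prod_prod_off_diag (fun i j => f i j), prod_comm,
    ← prod_mul_distrib]
  refine prod_congr rfl fun i _ => ?_
  rw [← prod_compl_mul_prod {i}, prod_singleton, mul_comm]

open Finset in
open Classical in
-- For each pair of chords, `chordsCross_sign` gives an inversion of `φ` and two inversions between
-- a first and a second endpoint. The latter, with the signs of the single chords, run over all
-- pairs `(i, j)`, so their product no longer depends on `φ`. What remains is `sgn φ`, as a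
-- determinant requires.
theorem neg_one_pow_crossingNumber (φ : Equiv.Perm (Fin n)) (π : Equiv.Perm (Fin (n + n)))
    (h1 : StrictMono fun i => π (Fin.castAdd n i))
    (h2 : StrictMono fun i => π (Fin.natAdd n i)) :
    (-1 : ℤ) ^ crossingNumber φ π *
        ∏ i, signOf (π (Fin.natAdd n (φ i)) < π (Fin.castAdd n i)) =
      (∏ i, ∏ j, signOf (π (Fin.natAdd n j) < π (Fin.castAdd n i))) *
        ((∏ i : Fin n, ∏ _j ∈ Ioi i, -1) * (Equiv.Perm.sign φ : ℤ)) := by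
  have hne : ∀ i j, π (Fin.castAdd n i) ≠ π (Fin.natAdd n j) := by
    intro i j h
    have := congrArg Fin.val (π.injective h)
    simp at this
    omega
  have hN : (-1 : ℤ) ^ crossingNumber φ π = ∏ i, ∏ j ∈ Ioi i,
      signOf (ChordsCross (π (Fin.castAdd n i)) (π (Fin.natAdd n (φ i)))
        (π (Fin.castAdd n j)) (π (Fin.natAdd n (φ j)))) := by
    unfold crossingNumber signOf
    rw [← prod_const, prod_filter, ← univ_product_univ, prod_product]
    refine prod_congr rfl fun i _ => ?_
    rw [← filter_lt_eq_Ioi, prod_filter]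
    refine prod_congr rfl fun j _ => ?_
    by_cases h : i < j <;> simp [h]
  have hsign : ((Equiv.Perm.sign φ : ℤˣ) : ℤ) = ∏ i, ∏ j ∈ Ioi i, if φ i < φ j then 1 else -1 := by
    rw [Equiv.Perm.sign_eq_prod_prod_Ioi]
    push_cast
    refine prod_congr rfl fun i _ => prod_congr rfl fun j _ => ?_
    split_ifs <;> rfl
  have hinv : ∏ i, ∏ j, signOf (π (Fin.natAdd n j) < π (Fin.castAdd n i)) =
      (∏ i, signOf (π (Fin.natAdd n (φ i)) < π (Fin.castAdd n i))) * ∏ i, ∏ j ∈ Ioi i,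
        (signOf (π (Fin.natAdd n (φ i)) < π (Fin.castAdd n j)) *
          signOf (π (Fin.natAdd n (φ j)) < π (Fin.castAdd n i))) := by
    rw [← prod_prod_eq_diag_mul fun i j => signOf (π (Fin.natAdd n (φ j)) < π (Fin.castAdd n i))]
    exact prod_congr rfl fun i _ =>
      (Equiv.prod_comp φ fun j => signOf (π (Fin.natAdd n j) < π (Fin.castAdd n i))).symm
  rw [hN, hsign, hinv, mul_comm, mul_assoc]
  congr 1
  simp only [← prod_mul_distrib]
  refine prod_congr rfl fun i _ => prod_congr rfl fun j hj => ?_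
  have hij := mem_Ioi.1 hj
  have hφ : π (Fin.natAdd n (φ i)) ≠ π (Fin.natAdd n (φ j)) := fun h => hij.ne
    (φ.injective (Fin.natAdd_injective n n (π.injective h)))
  rw [chordsCross_sign (h1 hij) (hne _ _) (hne _ _).symm (hne _ _) hφ]
  simp only [h2.lt_iff_lt]
  ring

end Sign

/-! ### Functions supported on a sector -/

section Sector

variable {n : ℕ}

open Finset in
/-- On an orthant of a lattice, a product of the operators `1 - s^{e i}`. -/
theorem act_prod_orthant (neg : Fin n → Prop) [DecidablePred neg] (S : Finset (Fin n)) :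
    act (∏ i ∈ S, (1 - mono (Pi.single i 1 : Fin n → ℤ)))
        (fun a => ∏ i, if neg i then (if a i < 0 then 1 else 0) else if 0 ≤ a i then 1 else 0) =
      fun a => ∏ i, if i ∈ S then signOf (neg i) * (if a i = 0 then 1 else 0)
        else if neg i then (if a i < 0 then 1 else 0) else if 0 ≤ a i then 1 else 0 := by
  induction S using Finset.induction_on with
  | empty => simp
  | insert j S hj ih =>
    let g : Fin n → ℤ → ℤ := fun i t => if i ∈ S then signOf (neg i) * (if t = 0 then 1 else 0)
      else if neg i then (if t < 0 then 1 else 0) else if 0 ≤ t then 1 else 0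
    replace ih : act (∏ i ∈ S, (1 - mono (Pi.single i 1 : Fin n → ℤ))) _ =
      fun a => ∏ i, g i (a i) := ih
    rw [prod_insert hj, act_mul, ih]
    ext a
    have h1 : ∏ i ∈ univ.erase j, g i ((a - Pi.single j 1 : Fin n → ℤ) i) =
        ∏ i ∈ univ.erase j, g i (a i) := prod_congr rfl fun i hi => by
      simp [(mem_erase.1 hi).1]
    have h2 : ∀ i ∈ univ.erase j, (i ∈ insert j S ↔ i ∈ S) := fun i hi => by
      simp [(mem_erase.1 hi).1]
    rw [act_one_sub, ← mul_prod_erase univ _ (mem_univ j), ← mul_prod_erase univ _ (mem_univ j),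
      ← mul_prod_erase univ _ (mem_univ j), h1, ← sub_mul]
    congr 1
    -- In one coordinate, the indicator of `t ≥ 0` minus its translate by `1` is the delta function
    -- at `0`, and the indicator of `t < 0` gives minus that delta function.
    · simp only [g, hj, mem_insert_self, if_true, if_false, Pi.sub_apply, Pi.single_eq_same, signOf]
      split_ifs <;> omega
    · exact prod_congr rfl fun i hi => by rw [if_congr (h2 i hi) rfl rfl]

theorem act_prod_eq_zero_of_notMem_range {Λ Λ' ι : Type*} [AddCommGroup Λ] [AddCommGroup Λ']
    (c : Λ' →+ Λ) (S : Finset ι) (w : ι → Λ') {f : Λ → ℤ} (hf : ∀ x, x ∉ Set.range c → f x = 0) :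
    ∀ x, x ∉ Set.range c → act (∏ i ∈ S, (1 - mono (c (w i)))) f x = 0 := by
  classical
  induction S using Finset.induction_on with
  | empty => simpa using hf
  | insert a S ha ih =>
    intro x hx
    rw [Finset.prod_insert ha, act_mul, act_one_sub, ih x hx, ih, sub_zero]
    rintro ⟨y, hy⟩
    exact hx ⟨y + w a, by rw [map_add, hy, sub_add_cancel]⟩

/-- The sum of the roots `α_{i,φ(i)}` with given coefficients. -/
def chordSum (φ : Equiv.Perm (Fin n)) : (Fin n → ℤ) →+ (Fin (n + n) → ℤ) where
  toFun a := ∑ i, a i • root (Fin.castAdd n i) (Fin.natAdd n (φ i))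
  map_zero' := by simp
  map_add' a b := by simp [add_smul, Finset.sum_add_distrib]

theorem chordSum_single (φ : Equiv.Perm (Fin n)) (i : Fin n) :
    chordSum φ (Pi.single i 1) = root (Fin.castAdd n i) (Fin.natAdd n (φ i)) := by
  simp only [chordSum, AddMonoidHom.coe_mk, ZeroHom.coe_mk]
  rw [Finset.sum_eq_single i] <;> simp +contextual

theorem chordSum_castAdd (φ : Equiv.Perm (Fin n)) (a : Fin n → ℤ) (i : Fin n) :
    chordSum φ a (Fin.castAdd n i) = a i := by
  have h1 : ∀ j, Fin.castAdd n i ≠ Fin.natAdd n (φ j) := fun j h => by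
    have := congrArg Fin.val h
    simp at this
    omega
  simp only [chordSum, AddMonoidHom.coe_mk, ZeroHom.coe_mk, Finset.sum_apply, root, Pi.smul_apply,
    Pi.sub_apply, Pi.single_eq_of_ne (h1 _), sub_zero, smul_eq_mul]
  rw [Finset.sum_eq_single i]
  · rw [Pi.single_eq_same, mul_one]
  · intro j _ hj
    rw [Pi.single_eq_of_ne, mul_zero]
    exact fun h => hj (Fin.castAdd_injective n n h).symm
  · simp

theorem chordSum_injective (φ : Equiv.Perm (Fin n)) : Function.Injective (chordSum φ) := by
  intro a b h
  ext i
  rw [← chordSum_castAdd φ a, ← chordSum_castAdd φ b, h]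

theorem castAdd_ne_natAdd (π : Equiv.Perm (Fin (n + n))) (i j : Fin n) :
    π (Fin.castAdd n i) ≠ π (Fin.natAdd n j) := by
  intro h
  have := congrArg Fin.val (π.injective h)
  simp at this
  omega

theorem chordSum_mem_sector (φ : Equiv.Perm (Fin n)) (π : Equiv.Perm (Fin (n + n)))
    (a : Fin n → ℤ) : chordSum φ a ∈ sector φ π ↔
      ∀ i, if π (Fin.natAdd n (φ i)) < π (Fin.castAdd n i) then a i < 0 else 0 ≤ a i := by
  constructor
  · rintro ⟨b, h1, h2, h3⟩ i
    obtain rfl : a = b := chordSum_injective φ h3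
    split_ifs with h
    · exact h2 i h
    · exact h1 i (lt_of_le_of_ne (not_lt.1 h) (castAdd_ne_natAdd π _ _))
  · intro h
    refine ⟨a, fun i hi => ?_, fun i hi => ?_, rfl⟩
    · exact (if_neg (not_lt.2 hi.le)).mp (h i)
    · exact (if_pos hi).mp (h i)

open Finset in
-- The sector is an orthant of the lattice spanned by the chord roots, so its indicator expands `∏
-- 1/(1 - s_i/s_{φ(i)})` up to sign. A chord traversed backwards contributes `-1`, since `1/(1 - z)
-- = -∑_{a<0} z^a`. Outside the lattice both sides vanish.
theorem act_prod_sectorIndicator (φ : Equiv.Perm (Fin n)) (π : Equiv.Perm (Fin (n + n))) :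
    act (∏ i, (1 - mono (root (Fin.castAdd n i) (Fin.natAdd n (φ i))))) (sectorIndicator φ π) =
      ((-1 : ℤ) ^ crossingNumber φ π *
        ∏ i, signOf (π (Fin.natAdd n (φ i)) < π (Fin.castAdd n i))) •
      ⇑(1 : AddMonoidAlgebra ℤ (Fin (n + n) → ℤ)).coeff := by
  classical
  simp only [← chordSum_single]
  ext x
  by_cases hx : x ∈ Set.range (chordSum φ)
  · obtain ⟨a, rfl⟩ := hx
    have h1 : sectorIndicator φ π ∘ chordSum φ = (-1 : ℤ) ^ crossingNumber φ π • fun a => ∏ i,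
        if π (Fin.natAdd n (φ i)) < π (Fin.castAdd n i) then (if a i < 0 then 1 else 0)
          else if 0 ≤ a i then 1 else 0 := by
      ext a
      rw [Function.comp_apply, sectorIndicator, if_congr (chordSum_mem_sector φ π a) rfl rfl,
        Pi.smul_apply, smul_eq_mul]
      split_ifs with h
      · rw [prod_eq_one, mul_one]
        intro i _
        have := h i
        split_ifs at this ⊢ <;> rfl
      · push Not at h
        obtain ⟨i, hi⟩ := h
        rw [prod_eq_zero (mem_univ i), mul_zero]
        split_ifs at hi ⊢ <;> rfl
    rw [← Function.comp_apply (f := act _ _) (g := chordSum φ), act_prod_comp, h1, map_smul,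
      act_prod_orthant fun i => π (Fin.natAdd n (φ i)) < π (Fin.castAdd n i)]
    simp only [Pi.smul_apply, smul_eq_mul, mem_univ, if_true, prod_mul_distrib, mul_assoc]
    congr 2
    rw [AddMonoidAlgebra.one_def, AddMonoidAlgebra.coeff_single, Finsupp.single_apply]
    split_ifs with h
    · rw [← map_zero (chordSum φ)] at h
      obtain rfl := chordSum_injective φ h
      simp
    · have h2 : ∃ i, a i ≠ 0 := by
        by_contra h'
        push Not at h'
        exact h (by rw [funext h', ← Pi.zero_def, map_zero])
      obtain ⟨i, hi⟩ := h2
      exact prod_eq_zero (mem_univ i) (if_neg hi)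
  · rw [act_prod_eq_zero_of_notMem_range _ _ _ _ x hx]
    · rw [Pi.smul_apply, AddMonoidAlgebra.one_def, AddMonoidAlgebra.coeff_single,
        Finsupp.single_apply, if_neg, smul_zero]
      rintro rfl
      exact hx ⟨0, map_zero _⟩
    · intro y hy
      refine if_neg ?_
      rintro ⟨a, -, -, rfl⟩
      exact hy ⟨a, rfl⟩

end Sector

/-! ### The sum over the sectors as a solution of the product equation -/

section SectorSum

variable {n : ℕ}

theorem root_eq_neg (a b : Fin (n + n)) : root a b = -root b a := by
  simp [root]

theorem mono_root (a b : Fin (n + n)) :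
    mono (root a b) = mono (Pi.single a 1) * mono (-Pi.single b 1) := by
  rw [mono_mul, root, sub_eq_add_neg]

theorem mono_mul_mono_neg {Λ : Type*} [AddCommGroup Λ] (a : Λ) : mono a * mono (-a) = 1 := by
  rw [mono_mul, add_neg_cancel, mono_zero]

/-- The odd root between `i` and `n + j` that is positive for `π`. -/
def posRoot (π : Equiv.Perm (Fin (n + n))) (i j : Fin n) : Fin (n + n) → ℤ :=
  if π (Fin.natAdd n j) < π (Fin.castAdd n i) then root (Fin.natAdd n j) (Fin.castAdd n i)
  else root (Fin.castAdd n i) (Fin.natAdd n j)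

/-- This is `1 - z⁻¹ = -z⁻¹(1 - z)` for each inverted pair. The monomials `z⁻¹` multiply up to
`s^{δ^π}`, which is how `deltaShift` arises. -/
theorem one_sub_mono_posRoot (π : Equiv.Perm (Fin (n + n))) (i j : Fin n) :
    1 - mono (posRoot π i j) =
      ((signOf (π (Fin.natAdd n j) < π (Fin.castAdd n i)) : ℤ) : AddMonoidAlgebra ℤ _) *
        mono (if π (Fin.natAdd n j) < π (Fin.castAdd n i) then
          root (Fin.natAdd n j) (Fin.castAdd n i) else 0) *
        (1 - mono (root (Fin.castAdd n i) (Fin.natAdd n j))) := by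
  unfold posRoot signOf
  split_ifs
  · rw [root_eq_neg (Fin.castAdd n i), mul_sub, mul_assoc, mul_assoc, mono_mul_mono_neg]
    push_cast
    ring
  · rw [mono_zero]
    push_cast
    ring

open Finset in
theorem prod_one_sub_mono_posRoot (π : Equiv.Perm (Fin (n + n))) :
    ∏ i, ∏ j, (1 - mono (posRoot π i j)) =
      ((∏ i, ∏ j, signOf (π (Fin.natAdd n j) < π (Fin.castAdd n i)) : ℤ) :
        AddMonoidAlgebra ℤ _) * mono (deltaShift π) *
        ∏ i, ∏ j, (1 - mono (root (Fin.castAdd n i) (Fin.natAdd n j))) := by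
  simp only [one_sub_mono_posRoot, prod_mul_distrib, prod_mono, deltaShift, Int.cast_prod]

open Finset in
-- The inverted pairs of the alternating shuffle are indexed by `i < j`, and each contributes
-- `y_i/x_j`, where `x_i = s_i` and `y_j = s_{n+j}`. This is the factor in `-(x_j - x_i)(1/y_j -
-- 1/y_i) · y_i/x_j = (1 - x_i/x_j)(1 - y_i/y_j)`, which converts Cauchy's numerator into even
-- positive roots.
theorem mono_deltaShift_altShuffle : mono (deltaShift (altShuffle n)) =
    ∏ i, ∏ j ∈ Ioi i, (mono (-Pi.single (Fin.castAdd n j) 1) *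
      mono (Pi.single (Fin.natAdd n i) 1)) := by
  simp only [mono_mul, prod_mono, deltaShift]
  congr 1
  rw [sum_comm]
  refine sum_congr rfl fun i _ => ?_
  rw [← filter_lt_eq_Ioi, sum_filter]
  refine sum_congr rfl fun j _ => ?_
  have : altShuffle n (Fin.natAdd n i) < altShuffle n (Fin.castAdd n j) ↔ i < j := by
    simp only [altShuffle, Equiv.coe_fn_mk, Fin.lt_def, Fin.val_natAdd, Fin.val_castAdd]
    split_ifs <;> omega
  rw [if_congr this rfl rfl, root, sub_eq_neg_add]

open Finset in
theorem sum_sign_mul_prod : ∑ φ : Equiv.Perm (Fin n),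
    (((Equiv.Perm.sign φ : ℤˣ) : ℤ) : AddMonoidAlgebra ℤ _) *
      ∏ i, ∏ j ∈ {φ i}ᶜ, (1 - mono (root (Fin.castAdd n i) (Fin.natAdd n j))) =
    ∏ i, ∏ j ∈ Ioi i,
      ((mono (Pi.single (Fin.castAdd n j) 1) - mono (Pi.single (Fin.castAdd n i) 1)) *
      (mono (-Pi.single (Fin.natAdd n j) 1) - mono (-Pi.single (Fin.natAdd n i) 1))) := by
  rw [← det_cauchy, ← Matrix.det_transpose, Matrix.det_apply']
  · simp only [Matrix.transpose_apply, Matrix.of_apply, mono_root]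
  · intro i j h
    have h1 := (AddMonoidAlgebra.single_left_inj one_ne_zero).1 h
    have h2 := congrFun (neg_injective h1) (Fin.natAdd n i)
    by_contra hij
    rw [Pi.single_eq_same, Pi.single_eq_of_ne fun h => hij (Fin.natAdd_injective n n h)] at h2
    exact one_ne_zero h2
  · intro i
    exact AddMonoidAlgebra.single_ne_zero.2 one_ne_zero

/-- The sum over `φ` of the signed indicators of the sectors, suitably translated. -/
def sectorSum (π : Equiv.Perm (Fin (n + n))) (x : Fin (n + n) → ℤ) : ℤ :=
  ∑ φ : Equiv.Perm (Fin n), sectorIndicator φ π (x - deltaShift (altShuffle n) + deltaShift π)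

open Finset in
/-- The denominator identity of `𝔤𝔩(n | n)`. -/
theorem act_sectorSum (π : Equiv.Perm (Fin (n + n)))
    (h1 : StrictMono fun i => π (Fin.castAdd n i)) (h2 : StrictMono fun i => π (Fin.natAdd n i)) :
    act (∏ i, ∏ j, (1 - mono (posRoot π i j))) (sectorSum π) =
      (∏ i : Fin n, ∏ j ∈ Ioi i, ((1 - mono (root (Fin.castAdd n i) (Fin.castAdd n j))) *
        (1 - mono (root (Fin.natAdd n i) (Fin.natAdd n j)))) :
          AddMonoidAlgebra ℤ (Fin (n + n) → ℤ)).coeff := by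
  set ε : ℤ := ∏ i, ∏ j, signOf (π (Fin.natAdd n j) < π (Fin.castAdd n i)) with hε
  have hεε : ε * ε = 1 := by
    simp only [hε, ← prod_mul_distrib, signOf_mul_self, prod_const_one]
  have hG : sectorSum π = act (mono (deltaShift (altShuffle n) - deltaShift π))
      (∑ φ : Equiv.Perm (Fin n), sectorIndicator φ π) := by
    ext x
    rw [act_mono, Finset.sum_apply, sectorSum]
    refine sum_congr rfl fun φ _ => ?_
    congr 1
    abel
  -- Among all odd factors, those on the chords of `φ` cancel the sector, and the others form the
  -- `φ`-term of the determinant expansion.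
  have hφ : ∀ φ : Equiv.Perm (Fin n),
      act (∏ i, ∏ j, (1 - mono (root (Fin.castAdd n i) (Fin.natAdd n j)))) (sectorIndicator φ π) =
      ⇑(AddMonoidAlgebra.coeff (((ε * ∏ i : Fin n, ∏ _j ∈ Ioi i, -1 : ℤ) :
          AddMonoidAlgebra ℤ (Fin (n + n) → ℤ)) *
        ((((Equiv.Perm.sign φ : ℤˣ) : ℤ) : AddMonoidAlgebra ℤ _) *
        ∏ i, ∏ j ∈ {φ i}ᶜ, (1 - mono (root (Fin.castAdd n i) (Fin.natAdd n j)))))) := by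
    intro φ
    have : ∏ i, ∏ j, (1 - mono (root (Fin.castAdd n i) (Fin.natAdd n j))) =
        (∏ i, ∏ j ∈ {φ i}ᶜ, (1 - mono (root (Fin.castAdd n i) (Fin.natAdd n j)))) *
        ∏ i, (1 - mono (root (Fin.castAdd n i) (Fin.natAdd n (φ i)))) := by
      rw [← prod_mul_distrib]
      refine prod_congr rfl fun i _ => ?_
      rw [← prod_compl_mul_prod {φ i}, prod_singleton]
    rw [this, act_mul, act_prod_sectorIndicator, neg_one_pow_crossingNumber φ π h1 h2, map_smul,
      act_eq_coeff, ← hε]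
    rw [← Finsupp.coe_smul, ← AddMonoidAlgebra.coeff_smul, zsmul_eq_mul]
    push_cast
    ring_nf
  have hsum : act (∏ i, ∏ j, (1 - mono (root (Fin.castAdd n i) (Fin.natAdd n j))))
      (∑ φ : Equiv.Perm (Fin n), sectorIndicator φ π) =
      ⇑(AddMonoidAlgebra.coeff (((ε * ∏ i : Fin n, ∏ _j ∈ Ioi i, -1 : ℤ) :
          AddMonoidAlgebra ℤ (Fin (n + n) → ℤ)) * ∏ i, ∏ j ∈ Ioi i,
      ((mono (Pi.single (Fin.castAdd n j) 1) - mono (Pi.single (Fin.castAdd n i) 1)) *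
      (mono (-Pi.single (Fin.natAdd n j) 1) - mono (-Pi.single (Fin.natAdd n i) 1))))) := by
    rw [map_sum, ← sum_sign_mul_prod, mul_sum, AddMonoidAlgebra.coeff_sum, Finsupp.coe_finsetSum]
    exact sum_congr rfl fun φ _ => hφ φ
  have hmono : mono (deltaShift π) * mono (deltaShift (altShuffle n) - deltaShift π) =
      mono (deltaShift (altShuffle n)) := by
    rw [mono_mul, add_sub_cancel]
  rw [prod_one_sub_mono_posRoot, hG, ← act_mul, mul_right_comm, mul_assoc _ (mono _) (mono _),
    hmono, act_mul, hsum, act_coeff, mono_deltaShift_altShuffle]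
  congr 2
  -- The sign `ε` occurs once from reorienting the odd roots and once from the crossing numbers, and
  -- `ε² = 1`.
  have h3 : ∀ p q : AddMonoidAlgebra ℤ (Fin (n + n) → ℤ), (ε : AddMonoidAlgebra ℤ _) * p *
      (((ε * ∏ i : Fin n, ∏ _j ∈ Ioi i, -1 : ℤ) : AddMonoidAlgebra ℤ _) * q) =
      p * (((∏ i : Fin n, ∏ _j ∈ Ioi i, -1 : ℤ) : AddMonoidAlgebra ℤ _) * q) := by
    intro p q
    have h4 : (ε : AddMonoidAlgebra ℤ (Fin (n + n) → ℤ)) * ε = 1 := by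
      rw [← Int.cast_mul, hεε, Int.cast_one]
    push_cast at h4 ⊢
    linear_combination (p * (∏ i : Fin n, ∏ _j ∈ Ioi i, -1) * q) * h4
  rw [h3]
  simp only [Int.cast_prod, ← prod_mul_distrib]
  refine prod_congr rfl fun i _ => prod_congr rfl fun j _ => ?_
  have e1 := mono_mul_mono_neg (Pi.single (Fin.castAdd n j) 1 : Fin (n + n) → ℤ)
  have e2 := mono_mul_mono_neg (Pi.single (Fin.natAdd n i) 1 : Fin (n + n) → ℤ)
  rw [mono_root, mono_root]
  push_cast
  generalize mono (Pi.single (Fin.castAdd n j) 1 : Fin (n + n) → ℤ) = a at *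
  generalize mono (-Pi.single (Fin.castAdd n j) 1 : Fin (n + n) → ℤ) = b at *
  generalize mono (Pi.single (Fin.natAdd n i) 1 : Fin (n + n) → ℤ) = c at *
  generalize mono (-Pi.single (Fin.natAdd n i) 1 : Fin (n + n) → ℤ) = d at *
  generalize mono (-Pi.single (Fin.natAdd n j) 1 : Fin (n + n) → ℤ) = u at *
  generalize mono (Pi.single (Fin.castAdd n i) 1 : Fin (n + n) → ℤ) = v at *
  linear_combination (c * (d - u)) * e1 + (1 - v * b) * e2

end SectorSum

/-! ### Products over pairs of indices -/

section Denominator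

variable {J : Type} [DecidableEq J] [Fintype J]

/-- The weight `e_a - e_b`. -/
def rootOf (q : J × J) : J → ℤ := Pi.single q.1 1 - Pi.single q.2 1

open Classical in
/-- The product of `1 - s_a / s_b` over a set of pairs. -/
def denom (C : J × J → Prop) : AddMonoidAlgebra ℤ (J → ℤ) :=
  ∏ q with C q, (1 - mono (rootOf q))

theorem denom_eq_prod (C : J × J → Prop) [DecidablePred C] :
    denom C = ∏ q with C q, (1 - mono (rootOf q)) := by
  unfold denom
  congr

theorem denom_eq_prod_ite (C : J × J → Prop) [DecidablePred C] :
    denom C = ∏ a, ∏ b, if C (a, b) then 1 - mono (rootOf (a, b)) else 1 := by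
  rw [denom_eq_prod, Finset.prod_filter, Fintype.prod_prod_type]

theorem denom_eq_prod_subtype (C : J × J → Prop) [Fintype {q // C q}] :
    denom C = ∏ q : {q // C q}, (1 - mono (rootOf q.1)) := by
  unfold denom
  exact Finset.prod_subtype _ (by simp) _

theorem denom_congr {C D : J × J → Prop} (h : ∀ q, C q ↔ D q) : denom C = denom D := by
  obtain rfl : C = D := funext fun q => propext (h q)
  rfl

/-- The weighted sum of the coordinates. -/
def weightedSum (g : J → ℤ) : (J → ℤ) →+ ℤ where
  toFun x := ∑ a, g a * x a
  map_zero' := by simp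
  map_add' x y := by simp [mul_add, Finset.sum_add_distrib]

theorem weightedSum_single (g : J → ℤ) (a : J) (c : ℤ) :
    weightedSum g (Pi.single a c) = g a * c := by
  simp only [weightedSum, AddMonoidHom.coe_mk, ZeroHom.coe_mk]
  rw [Finset.sum_eq_single a] <;> simp +contextual

theorem weightedSum_rootOf (g : J → ℤ) (q : J × J) :
    weightedSum g (rootOf q) = g q.1 - g q.2 := by
  rw [rootOf, map_sub, weightedSum_single, weightedSum_single, mul_one, mul_one]

end Denominator

/-! ### The sum over the sectors as a partition function for `𝔤𝔩(n|n)` -/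

section FullDenominator

variable {n : ℕ}

/-- Pairs of indices of the same parity that are in the order prescribed by `π`. -/
def EvenPos (π : Equiv.Perm (Fin (n + n))) (q : Fin (n + n) × Fin (n + n)) : Prop :=
  π q.1 < π q.2 ∧ ((q.1 : ℕ) < n ↔ (q.2 : ℕ) < n)

/-- Pairs of indices of different parity that are in the order prescribed by `π`. -/
def OddPos (π : Equiv.Perm (Fin (n + n))) (q : Fin (n + n) × Fin (n + n)) : Prop :=
  π q.1 < π q.2 ∧ ¬((q.1 : ℕ) < n ↔ (q.2 : ℕ) < n)

theorem denom_oddPos (π : Equiv.Perm (Fin (n + n))) :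
    denom (OddPos π) = ∏ i, ∏ j, (1 - mono (posRoot π i j)) := by
  classical
  rw [denom_eq_prod_ite]
  simp only [Fin.prod_univ_add, OddPos, Fin.val_castAdd, Fin.val_natAdd, Fin.is_lt, iff_true,
    not_true, and_false, if_false, Finset.prod_const_one, one_mul, mul_one,
    add_lt_iff_neg_left, not_lt_zero, not_false_iff, and_true, iff_false]
  rw [Finset.prod_comm (s := Finset.univ) (t := Finset.univ) (f := fun i j =>
    if π (Fin.natAdd n i) < π (Fin.castAdd n j) then _ else _), ← Finset.prod_mul_distrib]
  refine Finset.prod_congr rfl fun i _ => ?_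
  rw [← Finset.prod_mul_distrib]
  refine Finset.prod_congr rfl fun j _ => ?_
  have := castAdd_ne_natAdd π i j
  unfold posRoot
  by_cases h : π (Fin.natAdd n j) < π (Fin.castAdd n i)
  · rw [if_neg h.not_gt, if_pos h, if_pos h, one_mul]
    rfl
  · rw [if_pos (lt_of_le_of_ne (not_lt.1 h) this), if_neg h, if_neg h, mul_one]
    rfl

open Finset in
theorem denom_evenPos (π : Equiv.Perm (Fin (n + n)))
    (h1 : StrictMono fun i => π (Fin.castAdd n i)) (h2 : StrictMono fun i => π (Fin.natAdd n i)) :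
    denom (EvenPos π) = ∏ i : Fin n, ∏ j ∈ Ioi i,
      ((1 - mono (root (Fin.castAdd n i) (Fin.castAdd n j))) *
        (1 - mono (root (Fin.natAdd n i) (Fin.natAdd n j)))) := by
  classical
  rw [denom_eq_prod_ite]
  have h1' : ∀ i j, π (Fin.castAdd n i) < π (Fin.castAdd n j) ↔ i < j := fun i j => h1.lt_iff_lt
  have h2' : ∀ i j, π (Fin.natAdd n i) < π (Fin.natAdd n j) ↔ i < j := fun i j => h2.lt_iff_lt
  simp only [Fin.prod_univ_add, EvenPos, Fin.val_castAdd, Fin.val_natAdd, Fin.is_lt, iff_true,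
    not_true, and_false, if_false, Finset.prod_const_one, one_mul, mul_one,
    add_lt_iff_neg_left, not_lt_zero, not_false_iff, and_true, iff_false, h1', h2',
    ← filter_lt_eq_Ioi, prod_filter]
  rw [← Finset.prod_mul_distrib]
  refine Finset.prod_congr rfl fun i _ => ?_
  rw [← Finset.prod_mul_distrib]
  refine Finset.prod_congr rfl fun j _ => ?_
  split_ifs
  · rfl
  · rw [one_mul]

/-- The height for which the roots `e_a - e_b` with `π a < π b` are positive. -/
def permHeight (π : Equiv.Perm (Fin (n + n))) : (Fin (n + n) → ℤ) →+ ℤ :=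
  weightedSum fun a => -((π a : ℕ) : ℤ)

theorem permHeight_pos {π : Equiv.Perm (Fin (n + n))} {q : Fin (n + n) × Fin (n + n)}
    (h : π q.1 < π q.2) : 0 < permHeight π (rootOf q) := by
  rw [permHeight, weightedSum_rootOf]
  rw [Fin.lt_def] at h
  omega

theorem permHeight_nonneg_of_mem_sector {φ : Equiv.Perm (Fin n)} {π : Equiv.Perm (Fin (n + n))}
    {x : Fin (n + n) → ℤ} (h : x ∈ sector φ π) : 0 ≤ permHeight π x := by
  obtain ⟨a, h1, h2, rfl⟩ := h
  rw [map_sum]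
  refine Finset.sum_nonneg fun i _ => ?_
  rw [map_zsmul, smul_eq_mul]
  rcases lt_or_gt_of_ne (castAdd_ne_natAdd π i (φ i)) with h | h
  · exact mul_nonneg (h1 i h) (permHeight_pos (q := (_, _)) h).le
  · have h3 := permHeight_pos (q := (Fin.natAdd n (φ i), Fin.castAdd n i)) h
    rw [root_eq_neg, map_neg]
    have h4 := h2 i h
    change 0 < permHeight π (root _ _) at h3
    nlinarith

theorem sectorSum_boundedBelow (π : Equiv.Perm (Fin (n + n))) :
    BoundedBelow (permHeight π) (sectorSum π) := by
  refine ⟨permHeight π (deltaShift (altShuffle n) - deltaShift π), fun x hx => ?_⟩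
  obtain ⟨φ, _, hφ⟩ := Finset.exists_ne_zero_of_sum_ne_zero hx
  have h1 : x - deltaShift (altShuffle n) + deltaShift π ∈ sector φ π := by
    by_contra h
    exact hφ (if_neg h)
  have h2 := permHeight_nonneg_of_mem_sector h1
  rw [map_add, map_sub] at h2
  rw [map_sub]
  omega

/-- The sum over the sectors vanishes where some linear form that is nonnegative on the positive
roots is negative. -/
theorem sectorSum_eq_zero (π : Equiv.Perm (Fin (n + n)))
    (h1 : StrictMono fun i => π (Fin.castAdd n i)) (h2 : StrictMono fun i => π (Fin.natAdd n i))
    (L : (Fin (n + n) → ℤ) →+ ℤ) (hL : ∀ q, π q.1 < π q.2 → 0 ≤ L (rootOf q))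
    {x : Fin (n + n) → ℤ} (hx : L x < 0) : sectorSum π x = 0 := by
  classical
  let v : {q // EvenPos π q} → Fin (n + n) → ℤ := fun q => rootOf q.1
  let w : {q // OddPos π q} → Fin (n + n) → ℤ := fun q => rootOf q.1
  -- Both functions solve the same product equation and have half-space support. For the partition
  -- function it is evident that the support lies in the cone of positive roots, which is not
  -- visible from the sectors.
  have h3 : sectorSum π = partitionFun v w := by
    refine eq_of_act_prod_eq (ht := permHeight π) Finset.univ w
      (fun q _ => permHeight_pos q.2.1) (sectorSum_boundedBelow π)
      ⟨0, fun x hx => partitionFun_nonneg _ w v (fun q => (permHeight_pos q.2.1).le)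
        (fun q => (permHeight_pos q.2.1).le) hx⟩ ?_
    rw [act_partitionFun (permHeight π) w v fun q => permHeight_pos q.2.1,
      ← denom_eq_prod_subtype, ← denom_eq_prod_subtype, denom_oddPos, denom_evenPos π h1 h2,
      act_sectorSum π h1 h2]
  rw [h3]
  by_contra h
  have := partitionFun_nonneg L w v (fun q => hL _ q.2.1) (fun q => hL _ q.2.1) h
  omega

end FullDenominator

/-! ### The embedding of the variables of a parabolic subalgebra -/

section Embedding

variable {M N : ℕ} (m : Fin (M + N) → ℕ) (π : Equiv.Perm (Fin (M + N)))

theorem finSigmaFinEquiv_strictMono {s t : Idx m} (h : s.1 < t.1) :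
    finSigmaFinEquiv s < finSigmaFinEquiv t := by
  rw [Fin.lt_def, finSigmaFinEquiv_apply, finSigmaFinEquiv_apply]
  -- Extending `m` by zero turns the partial sums over `Fin k` into sums over ranges, which compare
  -- by inclusion.
  let f : ℕ → ℕ := fun k => if h : k < M + N then m ⟨k, h⟩ else 0
  have hf : ∀ k : Fin (M + N), ∑ i : Fin k, m (Fin.castLE k.2.le i) =
      ∑ i ∈ Finset.range k, f i := by
    intro k
    rw [Finset.sum_range]
    refine Finset.sum_congr rfl fun i _ => ?_
    have : (i : ℕ) < M + N := i.2.trans k.2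
    simp only [f, this, dif_pos]
    rfl
  rw [hf, hf]
  have h1 : ∑ i ∈ Finset.range (s.1 + 1), f i ≤ ∑ i ∈ Finset.range t.1, f i :=
    Finset.sum_le_sum_of_subset (Finset.range_mono h)
  rw [Finset.sum_range_succ] at h1
  have h2 : f s.1 = m s.1 := by simp [f]
  have h3 := s.2.2
  omega

theorem finSigmaFinEquiv_lt_iff {i : Fin (M + N)} {p q : Fin (m i)} :
    finSigmaFinEquiv (⟨i, p⟩ : Idx m) < finSigmaFinEquiv (⟨i, q⟩ : Idx m) ↔ p < q := by
  rw [Fin.lt_def, finSigmaFinEquiv_apply, finSigmaFinEquiv_apply]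
  simp

theorem fst_le_of_finSigmaFinEquiv_le {s t : Idx m}
    (h : finSigmaFinEquiv s ≤ finSigmaFinEquiv t) : s.1 ≤ t.1 := by
  by_contra h'
  exact absurd (finSigmaFinEquiv_strictMono m (not_le.1 h')) (not_lt.2 h)

theorem sum_eq_evenDim_add_oddDim : ∑ i, m i = evenDim m + oddDim m := Fin.sum_univ_add _

theorem finSigmaFinEquiv_lt_evenDim_iff (s : Idx m) :
    (finSigmaFinEquiv s : ℕ) < evenDim m ↔ (s.1 : ℕ) < M := by
  have hsum : evenDim m = ∑ i : Fin M, m (Fin.castLE (Nat.le_add_right M N) i) := rfl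
  let f : ℕ → ℕ := fun k => if h : k < M + N then m ⟨k, h⟩ else 0
  have hf : ∀ k (hk : k ≤ M + N), ∑ i : Fin k, m (Fin.castLE hk i) =
      ∑ i ∈ Finset.range k, f i := by
    intro k hk
    rw [Finset.sum_range]
    refine Finset.sum_congr rfl fun i _ => ?_
    have : (i : ℕ) < M + N := i.2.trans_le hk
    simp only [f, this, dif_pos]
    rfl
  rw [finSigmaFinEquiv_apply, hsum, hf, hf]
  constructor
  · intro h
    by_contra h'
    have h1 : ∑ i ∈ Finset.range M, f i ≤ ∑ i ∈ Finset.range s.1, f i :=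
      Finset.sum_le_sum_of_subset (Finset.range_mono (not_lt.1 h'))
    omega
  · intro h
    have h1 : ∑ i ∈ Finset.range (s.1 + 1), f i ≤ ∑ i ∈ Finset.range M, f i :=
      Finset.sum_le_sum_of_subset (Finset.range_mono h)
    rw [Finset.sum_range_succ] at h1
    have h2 : f s.1 = m s.1 := by simp [f]
    have h3 := s.2.2
    omega

variable {m} (hle : oddDim m ≤ evenDim m)

/-- The place of a variable in the list of all variables. -/
def idxEmb (s : Idx m) : Fin (evenDim m + evenDim m) :=
  ⟨finSigmaFinEquiv s, (finSigmaFinEquiv s).2.trans_le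
    ((sum_eq_evenDim_add_oddDim m).trans_le (Nat.add_le_add_left hle _))⟩

theorem idxEmb_val (s : Idx m) : (idxEmb hle s : ℕ) = finSigmaFinEquiv s := rfl

theorem idxEmb_val_lt (s : Idx m) : (idxEmb hle s : ℕ) < ∑ i, m i := (finSigmaFinEquiv s).2

theorem idxEmb_injective : Function.Injective (idxEmb hle) := fun _ _ h =>
  finSigmaFinEquiv.injective (Fin.ext (Fin.mk.inj h))

theorem exists_idxEmb_eq {a : Fin (evenDim m + evenDim m)} (h : (a : ℕ) < ∑ i, m i) :
    ∃ s, idxEmb hle s = a :=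
  ⟨finSigmaFinEquiv.symm ⟨a, h⟩, Fin.ext (by simp [idxEmb])⟩

theorem complete_idxEmb (x : Idx m → ℤ) (s : Idx m) :
    complete m (evenDim m) x (idxEmb hle s) = x s := by
  rw [complete, dif_pos (idxEmb_val_lt hle s)]
  exact congrArg x (finSigmaFinEquiv.symm_apply_apply s)

theorem blockKey_idxEmb (s : Idx m) : blockKey m π (evenDim m) (idxEmb hle s) = π s.1 := by
  rw [blockKey, dif_pos (idxEmb_val_lt hle s)]
  exact congrArg (fun s : Idx m => (π s.1 : ℕ)) (finSigmaFinEquiv.symm_apply_apply s)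

theorem blockKey_of_le {n : ℕ} {a : Fin (n + n)} (h : ∑ i, m i ≤ a) :
    blockKey m π n a = M + N := dif_neg (not_lt.2 h)

theorem blockKey_le {n : ℕ} (a : Fin (n + n)) : blockKey m π n a ≤ M + N := by
  unfold blockKey
  split_ifs
  · exact Fin.is_le'
  · exact le_rfl

variable (m) in
theorem refine_lt_iff {n : ℕ} (a b : Fin (n + n)) : refine m π n a < refine m π n b ↔
    blockKey m π n a < blockKey m π n b ∨ (blockKey m π n a = blockKey m π n b ∧ a < b) := by
  obtain ⟨h1, h2⟩ := (Tuple.eq_sort_iff (f := blockKey m π n)).1 rfl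
  have key : ∀ a b, refine m π n a < refine m π n b →
      blockKey m π n a < blockKey m π n b ∨ (blockKey m π n a = blockKey m π n b ∧ a < b) := by
    intro a b h
    have h3 := h1 h.le
    have h4 := h2 _ _ h
    have h6 : ∀ c, Tuple.sort (blockKey m π n) (refine m π n c) = c :=
      (Tuple.sort (blockKey m π n)).apply_symm_apply
    simp only [Function.comp_apply, h6] at h3 h4
    rcases h3.lt_or_eq with h5 | h5
    · exact Or.inl h5
    · exact Or.inr ⟨h5, h4 h5⟩
  refine ⟨key a b, fun h => ?_⟩
  by_contra h'
  rcases (not_lt.1 h').lt_or_eq with h6 | h6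
  · have := key b a h6
    omega
  · have := (refine m π n).injective h6
    subst this
    omega

/-- The order of the variables that `π` prescribes for the blocks, refined by the order in each
block. -/
def IdxLt (s t : Idx m) : Prop := π s.1 < π t.1 ∨ (s.1 = t.1 ∧ (s.2 : ℕ) < t.2)

theorem refine_idxEmb_lt_iff (s t : Idx m) :
    refine m π (evenDim m) (idxEmb hle s) < refine m π (evenDim m) (idxEmb hle t) ↔
      IdxLt π s t := by
  rw [refine_lt_iff, blockKey_idxEmb, blockKey_idxEmb, IdxLt]
  refine or_congr Iff.rfl ?_
  rw [Fin.val_inj, π.injective.eq_iff, Fin.lt_def, idxEmb_val, idxEmb_val, ← Fin.lt_def]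
  constructor
  · rintro ⟨h1, h2⟩
    obtain ⟨i, p⟩ := s
    obtain ⟨j, q⟩ := t
    obtain rfl : i = j := h1
    exact ⟨rfl, (finSigmaFinEquiv_lt_iff m).1 h2⟩
  · rintro ⟨h1, h2⟩
    obtain ⟨i, p⟩ := s
    obtain ⟨j, q⟩ := t
    obtain rfl : i = j := h1
    exact ⟨rfl, (finSigmaFinEquiv_lt_iff m).2 h2⟩

/-- Because `n = m₀`, the first `n` places are exactly the variables of the even blocks, and on
these blocks the shuffle `π` is increasing. -/
theorem refine_castAdd_strictMono (hle : oddDim m ≤ evenDim m) (hπ : IsShuffle π) :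
    StrictMono fun i => refine m π (evenDim m) (Fin.castAdd _ i) := by
  intro i j hij
  have hlt : ∀ i : Fin (evenDim m), (Fin.castAdd (evenDim m) i : ℕ) < ∑ i, m i := fun i => by
    rw [sum_eq_evenDim_add_oddDim, Fin.val_castAdd]
    omega
  obtain ⟨s, hs⟩ := exists_idxEmb_eq hle (hlt i)
  obtain ⟨t, ht⟩ := exists_idxEmb_eq hle (hlt j)
  have hs' : (s.1 : ℕ) < M := by
    rw [← finSigmaFinEquiv_lt_evenDim_iff, ← idxEmb_val hle, hs]
    exact i.2
  have ht' : (t.1 : ℕ) < M := by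
    rw [← finSigmaFinEquiv_lt_evenDim_iff, ← idxEmb_val hle, ht]
    exact j.2
  have hst : finSigmaFinEquiv s < finSigmaFinEquiv t := by
    rw [Fin.lt_def, ← idxEmb_val hle, ← idxEmb_val hle, hs, ht]
    exact hij
  change refine m π _ (Fin.castAdd _ i) < refine m π _ (Fin.castAdd _ j)
  rw [refine_lt_iff, ← hs, ← ht, blockKey_idxEmb, blockKey_idxEmb]
  have h1 : (⟨s.1, hs'⟩ : Fin M) ≤ ⟨t.1, ht'⟩ := fst_le_of_finSigmaFinEquiv_le m hst.le
  have h2 : π s.1 ≤ π t.1 := hπ.1.monotone h1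
  rcases h2.lt_or_eq with h3 | h3
  · exact Or.inl h3
  · exact Or.inr ⟨congrArg Fin.val h3, hst⟩

/-- The last `n` places hold the variables of the odd blocks, on which `π` is increasing, followed
by the additional ones, whose common key `M + N` exceeds all others. -/
theorem refine_natAdd_strictMono (hle : oddDim m ≤ evenDim m) (hπ : IsShuffle π) :
    StrictMono fun i => refine m π (evenDim m) (Fin.natAdd _ i) := by
  intro i j hij
  have hij' : Fin.natAdd (evenDim m) i < Fin.natAdd (evenDim m) j := by simpa using hij
  change refine m π _ (Fin.natAdd _ i) < refine m π _ (Fin.natAdd _ j)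
  rw [refine_lt_iff]
  by_cases hj : (Fin.natAdd (evenDim m) j : ℕ) < ∑ i, m i
  · obtain ⟨s, hs⟩ := exists_idxEmb_eq hle (lt_trans (Fin.lt_def.1 hij') hj)
    obtain ⟨t, ht⟩ := exists_idxEmb_eq hle hj
    have hs' : M ≤ (s.1 : ℕ) := by
      rw [← not_lt, ← finSigmaFinEquiv_lt_evenDim_iff, ← idxEmb_val hle, hs]
      simp
    have ht' : M ≤ (t.1 : ℕ) := by
      rw [← not_lt, ← finSigmaFinEquiv_lt_evenDim_iff, ← idxEmb_val hle, ht]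
      simp
    have hst : finSigmaFinEquiv s < finSigmaFinEquiv t := by
      rw [Fin.lt_def, ← idxEmb_val hle, ← idxEmb_val hle, hs, ht]
      exact hij'
    rw [← hs, ← ht, blockKey_idxEmb, blockKey_idxEmb]
    have h1 := fst_le_of_finSigmaFinEquiv_le m hst.le
    have h2 : π s.1 ≤ π t.1 := by
      have h3 := hπ.2.monotone (a := ⟨s.1 - M, by omega⟩) (b := ⟨t.1 - M, by omega⟩)
        (Nat.sub_le_sub_right h1 M)
      have h4 : ∀ (r : Fin (M + N)) (hr : M ≤ (r : ℕ)),
          Fin.natAdd M ⟨r - M, by omega⟩ = r := fun r hr => Fin.ext (by simp; omega)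
      simpa only [h4 _ hs', h4 _ ht'] using h3
    rcases h2.lt_or_eq with h3 | h3
    · exact Or.inl h3
    · exact Or.inr ⟨congrArg Fin.val h3, hst⟩
  · rw [blockKey_of_le π (not_lt.1 hj)]
    rcases (blockKey_le (m := m) π (Fin.natAdd (evenDim m) i)).lt_or_eq with h | h
    · exact Or.inl h
    · exact Or.inr ⟨h, hij'⟩

/-- `complete`, as a homomorphism. -/
def completeHom (m : Fin (M + N) → ℕ) (n : ℕ) : (Idx m → ℤ) →+ (Fin (n + n) → ℤ) where
  toFun := complete m n
  map_zero' := by ext; simp [complete]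
  map_add' x y := by
    ext a
    simp only [complete, Pi.add_apply]
    split_ifs <;> simp

theorem completeHom_single (s : Idx m) (c : ℤ) :
    completeHom m (evenDim m) (Pi.single s c) = Pi.single (idxEmb hle s) c := by
  ext a
  change complete m (evenDim m) (Pi.single s c) a = _
  by_cases h : (a : ℕ) < ∑ i, m i
  · obtain ⟨t, rfl⟩ := exists_idxEmb_eq hle h
    rw [complete_idxEmb, Pi.single_apply, Pi.single_apply]
    exact if_congr (idxEmb_injective hle).eq_iff.symm rfl rfl
  · rw [complete, dif_neg h, Pi.single_eq_of_ne]
    rintro rfl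
    exact h (idxEmb_val_lt hle s)

theorem completeHom_rootOf (q : Idx m × Idx m) :
    completeHom m (evenDim m) (rootOf q) = rootOf (idxEmb hle q.1, idxEmb hle q.2) := by
  rw [rootOf, map_sub, completeHom_single hle, completeHom_single hle, rootOf]

theorem completeHom_injective (hle : oddDim m ≤ evenDim m) : Function.Injective (completeHom m (evenDim m)) := by
  intro x y h
  ext s
  rw [← complete_idxEmb hle x, ← complete_idxEmb hle y]
  exact congrFun h _

variable (m) in
/-- A linear form that is positive on the positive roots that involve additional variables, and
zero on the other roots. -/
def extraLevel (n : ℕ) : (Fin (n + n) → ℤ) →+ ℤ :=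
  -- The `+ 1` keeps the coefficient of an additional variable strictly negative even at index `0`;
  -- the decrease with `a` makes roots between two additional variables positive.
  weightedSum fun a => if (a : ℕ) < ∑ i, m i then 0 else -((a : ℕ) + 1 : ℤ)

theorem extraLevel_complete (x : Idx m → ℤ) (n : ℕ) : extraLevel m n (completeHom m n x) = 0 := by
  change ∑ a, _ * complete m n x a = 0
  refine Finset.sum_eq_zero fun a _ => ?_
  unfold complete
  split_ifs <;> simp

theorem extraLevel_nonneg {n : ℕ} {q : Fin (n + n) × Fin (n + n)}
    (h : refine m π n q.1 < refine m π n q.2) : 0 ≤ extraLevel m n (rootOf q) := by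
  rw [extraLevel, weightedSum_rootOf]
  rw [refine_lt_iff] at h
  split_ifs with h1 h2 h2
  · rfl
  · omega
  · rw [blockKey_of_le π (not_lt.1 h1)] at h
    have h3 : blockKey m π n q.2 < M + N := by
      rw [blockKey, dif_pos h2]
      exact Fin.is_lt _
    omega
  · rw [blockKey_of_le π (not_lt.1 h1), blockKey_of_le π (not_lt.1 h2), Fin.lt_def] at h
    omega

theorem extraLevel_pos {n : ℕ} {q : Fin (n + n) × Fin (n + n)}
    (h : refine m π n q.1 < refine m π n q.2)
    (hq : ¬((q.1 : ℕ) < ∑ i, m i ∧ (q.2 : ℕ) < ∑ i, m i)) : 0 < extraLevel m n (rootOf q) := by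
  rw [extraLevel, weightedSum_rootOf]
  rw [refine_lt_iff] at h
  split_ifs with h1 h2 h2
  · exact absurd ⟨h1, h2⟩ hq
  · omega
  · rw [blockKey_of_le π (not_lt.1 h1)] at h
    have h3 : blockKey m π n q.2 < M + N := by
      rw [blockKey, dif_pos h2]
      exact Fin.is_lt _
    omega
  · rw [blockKey_of_le π (not_lt.1 h1), blockKey_of_le π (not_lt.1 h2), Fin.lt_def] at h
    omega

/-- The additional variables disappear on the weights that do not involve them. -/
theorem act_denom_comp_complete
    (C : Fin (evenDim m + evenDim m) × Fin (evenDim m + evenDim m) → Prop)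
    (hC : ∀ q, C q → refine m π (evenDim m) q.1 < refine m π (evenDim m) q.2)
    {f : (Fin (evenDim m + evenDim m) → ℤ) → ℤ} (hf : ∀ x, extraLevel m _ x < 0 → f x = 0) :
    act (denom C) f ∘ completeHom m (evenDim m) =
      act (denom fun q : Idx m × Idx m => C (idxEmb hle q.1, idxEmb hle q.2))
        (f ∘ completeHom m (evenDim m)) := by
  classical
  let e : Idx m × Idx m ↪ Fin (evenDim m + evenDim m) × Fin (evenDim m + evenDim m) :=
    (⟨idxEmb hle, idxEmb_injective hle⟩ : Idx m ↪ _).prodMap ⟨idxEmb hle, idxEmb_injective hle⟩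
  let inner : Fin (evenDim m + evenDim m) × Fin (evenDim m + evenDim m) → Prop :=
    fun q => (q.1 : ℕ) < ∑ i, m i ∧ (q.2 : ℕ) < ∑ i, m i
  -- The factors that involve an additional variable have positive level. By `act_prod_of_pos` they
  -- do not affect values at level zero, where the image of `completeHom` lies.
  have h1 : denom C = (∏ q : Idx m × Idx m with C (idxEmb hle q.1, idxEmb hle q.2),
      (1 - mono (completeHom m (evenDim m) (rootOf q)))) *
      ∏ q with C q ∧ ¬ inner q, (1 - mono (rootOf q)) := by
    rw [denom_eq_prod, ← Finset.prod_filter_mul_prod_filter_not _ inner, Finset.filter_filter,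
      Finset.filter_filter]
    congr 1
    have : (Finset.univ.filter fun q => C q ∧ inner q) = (Finset.univ.filter
        fun q : Idx m × Idx m => C (idxEmb hle q.1, idxEmb hle q.2)).map e := by
      ext ⟨a, b⟩
      simp only [Finset.mem_filter, Finset.mem_univ, true_and, Finset.mem_map, inner]
      constructor
      · rintro ⟨h, ha, hb⟩
        obtain ⟨s, rfl⟩ := exists_idxEmb_eq hle ha
        obtain ⟨t, rfl⟩ := exists_idxEmb_eq hle hb
        exact ⟨(s, t), h, rfl⟩
      · rintro ⟨q, h, hq⟩
        obtain ⟨rfl, rfl⟩ := Prod.mk.inj hq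
        exact ⟨h, idxEmb_val_lt hle _, idxEmb_val_lt hle _⟩
    rw [this, Finset.prod_map]
    exact Finset.prod_congr rfl fun q _ => by rw [completeHom_rootOf hle]; rfl
  obtain ⟨-, h2⟩ := act_prod_of_pos (extraLevel m (evenDim m))
    (Finset.univ.filter fun q => C q ∧ ¬ inner q) rootOf (fun q hq =>
      extraLevel_pos π (hC q (Finset.mem_filter.1 hq).2.1) (Finset.mem_filter.1 hq).2.2) hf
  rw [h1, act_mul, act_prod_comp, denom_eq_prod]
  congr 1
  ext x
  exact h2 _ (extraLevel_complete x _)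

theorem coeff_one_comp {Λ Λ' : Type*} [AddCommGroup Λ] [AddCommGroup Λ'] {c : Λ' →+ Λ}
    (hc : Function.Injective c) : ⇑(1 : AddMonoidAlgebra ℤ Λ).coeff ∘ c =
      ⇑(1 : AddMonoidAlgebra ℤ Λ').coeff := by
  classical
  ext x
  rw [AddMonoidAlgebra.one_def, AddMonoidAlgebra.one_def, Function.comp_apply,
    AddMonoidAlgebra.coeff_single, AddMonoidAlgebra.coeff_single, Finsupp.single_apply,
    Finsupp.single_apply]
  refine if_congr ?_ rfl rfl
  rw [← map_zero c, hc.eq_iff]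

/-- The pairs of variables of the same parity, in the order of `IdxLt`. -/
def EvenIdx (q : Idx m × Idx m) : Prop := IdxLt π q.1 q.2 ∧ (IdxOdd m q.1 ↔ IdxOdd m q.2)

/-- The pairs of variables of different parity, in the order of `IdxLt`. -/
def OddIdx (q : Idx m × Idx m) : Prop := IdxLt π q.1 q.2 ∧ ¬(IdxOdd m q.1 ↔ IdxOdd m q.2)

theorem idxEmb_lt_evenDim_iff (s : Idx m) : (idxEmb hle s : ℕ) < evenDim m ↔ ¬ IdxOdd m s := by
  rw [idxEmb_val, finSigmaFinEquiv_lt_evenDim_iff, IdxOdd, not_le]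

/-- The denominator identity of `𝔤𝔩(m₀ | m₁)`. -/
theorem act_sectorSum_complete (hle : oddDim m ≤ evenDim m) (hπ : IsShuffle π) :
    act (denom (OddIdx π))
      (fun x : Idx m → ℤ => sectorSum (refine m π (evenDim m)) (complete m (evenDim m) x)) =
      ⇑(denom (EvenIdx π) : AddMonoidAlgebra ℤ (Idx m → ℤ)).coeff := by
  have h1 := refine_castAdd_strictMono π hle hπ
  have h2 := refine_natAdd_strictMono π hle hπ
  have h3 := congrArg (· ∘ completeHom m (evenDim m)) (act_sectorSum _ h1 h2)
  rw [← denom_oddPos, ← denom_evenPos _ h1 h2, act_denom_comp_complete π hle _ (fun q hq => hq.1)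
    fun x hx => sectorSum_eq_zero _ h1 h2 (extraLevel m _) (fun q hq => extraLevel_nonneg π hq) hx,
    ← act_eq_coeff, act_denom_comp_complete π hle _ (fun q hq => hq.1),
    coeff_one_comp (completeHom_injective hle), act_eq_coeff] at h3
  · have hE : ∀ q : Idx m × Idx m, EvenPos (refine m π (evenDim m)) (idxEmb hle q.1, idxEmb hle q.2)
        ↔ EvenIdx π q := fun q => by
      simp only [EvenPos, EvenIdx, refine_idxEmb_lt_iff, idxEmb_lt_evenDim_iff, not_iff_not]
    have hO : ∀ q : Idx m × Idx m, OddPos (refine m π (evenDim m)) (idxEmb hle q.1, idxEmb hle q.2)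
        ↔ OddIdx π q := fun q => by
      simp only [OddPos, OddIdx, refine_idxEmb_lt_iff, idxEmb_lt_evenDim_iff, not_iff_not]
    rw [denom_congr hE, denom_congr hO] at h3
    exact h3
  · intro x hx
    rw [AddMonoidAlgebra.one_def, AddMonoidAlgebra.coeff_single, Finsupp.single_apply, if_neg]
    rintro rfl
    simp at hx

end Embedding

/-! ### Alternants for a product of symmetric groups -/

section Vandermonde

open Finset

theorem alternant_rho {r : ℕ} : alternant (rho : Fin r → ℤ) = ∏ p, ∏ q ∈ Ioi p,
    (mono (Pi.single p 1) - mono (Pi.single q 1)) := by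
  have hrho : (rho : Fin r → ℤ) = fun p => ((p.rev : ℕ) : ℤ) := by
    funext p
    simp only [rho, Fin.val_rev]
    omega
  rw [hrho, alternant_natCast, ← Matrix.det_transpose]
  have h1 := Matrix.det_projVandermonde (fun _ => 1)
    fun p : Fin r => (mono (Pi.single p 1) : Laurent (Fin r))
  simp only [one_mul] at h1
  rw [← h1]
  congr 1
  ext1 i j
  rw [Matrix.projVandermonde_apply]
  simp

theorem sum_card_Ioi (r : ℕ) : ∑ p : Fin r, (Ioi p).card = r.choose 2 := by
  simp only [Fin.card_Ioi]
  rw [Fin.sum_univ_eq_sum_range (fun i => r - 1 - i), sum_range_reflect (fun i => i) r,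
    sum_range_id, Nat.choose_two_right]

/-- Each Vandermonde factor is `z_p - z_q = -z_q(1 - z_p/z_q)`. The variable `z_q` is extracted once
for every `p < q`, which produces the monomial of `ρ*` and one sign per pair. -/
theorem alternant_rho_eq {r : ℕ} : alternant (rho : Fin r → ℤ) =
    (-1) ^ r.choose 2 * mono rhoStar *
      ∏ p, ∏ q ∈ Ioi p, (1 - mono (Pi.single p 1 - Pi.single q 1)) := by
  have h1 : ∀ p q : Fin r, mono (Pi.single p 1 : Fin r → ℤ) - mono (Pi.single q 1) =
      -1 * mono (Pi.single q 1) * (1 - mono (Pi.single p 1 - Pi.single q 1)) := by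
    intro p q
    rw [mul_assoc, mul_sub, mul_one, mono_mul, add_sub_cancel]
    ring
  simp only [alternant_rho, h1, prod_mul_distrib, prod_mono, prod_const]
  rw [prod_pow_eq_pow_sum, sum_card_Ioi]
  congr 3
  ext a
  simp only [Finset.sum_apply]
  have h2 : ∀ p : Fin r, ∑ q ∈ Ioi p, (Pi.single q 1 : Fin r → ℤ) a = if p < a then 1 else 0 := by
    intro p
    simp [Pi.single_apply]
  simp only [h2, sum_boole, rhoStar]
  congr 1
  rw [filter_gt_eq_Iio, Fin.card_Iio]

end Vandermonde

/-! ### The Weyl group of the Levi subgroup and antisymmetric functions -/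

section Weyl

variable {M N : ℕ} {m : Fin (M + N) → ℕ}

/-- The permutation of the variables by an element of the Weyl group of the Levi subgroup. -/
def weylPerm (w : ∀ i, Equiv.Perm (Fin (m i))) : Equiv.Perm (Idx m) := Equiv.sigmaCongrRight w

theorem weylPerm_mul (w u : ∀ i, Equiv.Perm (Fin (m i))) (s : Idx m) :
    weylPerm (w * u) s = weylPerm w (weylPerm u s) := rfl

/-- The action of a permutation of the variables on the weights. -/
def weightPerm {J : Type} (σ : Equiv.Perm J) : (J → ℤ) ≃+ (J → ℤ) where
  toFun x := x ∘ σ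
  invFun x := x ∘ σ.symm
  left_inv x := by ext; simp
  right_inv x := by ext; simp
  map_add' x y := rfl

theorem weightPerm_apply {J : Type} (σ : Equiv.Perm J) (x : J → ℤ) : weightPerm σ x = x ∘ σ := rfl

/-- The sign of an element of the Weyl group. -/
def weylSign (w : ∀ i, Equiv.Perm (Fin (m i))) : ℤ := ∏ i, ((Equiv.Perm.sign (w i) : ℤˣ) : ℤ)

theorem weylSign_mul (w u : ∀ i, Equiv.Perm (Fin (m i))) :
    weylSign (w * u) = weylSign w * weylSign u := by
  simp [weylSign, Finset.prod_mul_distrib]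

theorem weylSign_mul_self (w : ∀ i, Equiv.Perm (Fin (m i))) : weylSign w * weylSign w = 1 := by
  simp only [weylSign, ← Finset.prod_mul_distrib]
  refine Finset.prod_eq_one fun i _ => ?_
  rw [← Units.val_mul, Int.units_mul_self, Units.val_one]

/-- The embedding of the weights of a block. -/
def blockEmb (i : Fin (M + N)) : (Fin (m i) → ℤ) →+ (Idx m → ℤ) where
  toFun μ := ∑ p, Pi.single (⟨i, p⟩ : Idx m) (μ p)
  map_zero' := by simp
  map_add' x y := by simp [Pi.single_add, Finset.sum_add_distrib]

theorem blockEmb_apply (i : Fin (M + N)) (μ : Fin (m i) → ℤ) :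
    blockEmb i μ = ∑ p, Pi.single (⟨i, p⟩ : Idx m) (μ p) := rfl

theorem sum_blockEmb (β : Idx m → ℤ) : ∑ i, blockEmb i (fun p => β ⟨i, p⟩) = β := by
  simp only [blockEmb_apply]
  rw [← Fintype.sum_sigma (fun s : Idx m => (Pi.single s (β s) : Idx m → ℤ)),
    Finset.univ_sum_single]

/-- The product over the blocks of the alternants. -/
def alternantProd (β : Idx m → ℤ) : Laurent (Idx m) :=
  ∏ i, (alternant fun p => β ⟨i, p⟩).mapDomain (blockEmb i)

theorem schurProd_mul_alternantProd (α : Idx m → ℤ) :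
    schurProd m α * alternantProd (blockRho m) = alternantProd (α + blockRho m) := by
  unfold schurProd alternantProd
  rw [← Finset.prod_mul_distrib]
  refine Finset.prod_congr rfl fun i _ => ?_
  have h := (exists_schur fun p => α ⟨i, p⟩).choose_spec
  exact (AddMonoidAlgebra.mapDomain_mul (blockEmb i) _ _).symm.trans
    (congrArg (AddMonoidAlgebra.mapDomain (blockEmb i)) h)

theorem alternantProd_eq_sum (β : Idx m → ℤ) : alternantProd β =
    ∑ w : ∀ i, Equiv.Perm (Fin (m i)), weylSign w • mono (β ∘ weylPerm w) := by
  have h1 : ∀ i, (alternant fun p => β ⟨i, p⟩).mapDomain (blockEmb i) =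
      ∑ w : Equiv.Perm (Fin (m i)), ((Equiv.Perm.sign w : ℤˣ) : ℤ) •
        mono (blockEmb i fun p => β ⟨i, w p⟩) := by
    intro i
    unfold alternant
    rw [← AddMonoidAlgebra.mapDomainRingHom_apply, map_sum]
    refine Finset.sum_congr rfl fun w _ => ?_
    rw [AddMonoidAlgebra.mapDomainRingHom_apply, AddMonoidAlgebra.mapDomain_single,
      AddMonoidAlgebra.smul_single, smul_eq_mul, mul_one]
  unfold alternantProd
  simp only [h1]
  rw [Finset.prod_univ_sum, Fintype.piFinset_univ]
  refine Finset.sum_congr rfl fun w _ => ?_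
  rw [Finset.prod_smul, prod_mono, ← sum_blockEmb (β ∘ weylPerm w)]
  rfl

/-- The pairs of variables of the same block, in increasing order. -/
def BlockPair (q : Idx m × Idx m) : Prop := q.1.1 = q.2.1 ∧ (q.1.2 : ℕ) < q.2.2

theorem denom_blockPair : denom (BlockPair (m := m)) =
    ∏ i, ∏ p, ∏ q ∈ Finset.Ioi p, (1 - mono (rootOf ((⟨i, p⟩ : Idx m), (⟨i, q⟩ : Idx m)))) := by
  classical
  rw [denom_eq_prod_ite, Fintype.prod_sigma]
  refine Finset.prod_congr rfl fun i _ => Finset.prod_congr rfl fun p _ => ?_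
  rw [Fintype.prod_sigma, Fintype.prod_eq_single i]
  · rw [← Finset.filter_lt_eq_Ioi, Finset.prod_filter]
    refine Finset.prod_congr rfl fun q _ => ?_
    simp only [BlockPair, true_and, Fin.lt_def]
  · intro j hj
    exact Finset.prod_eq_one fun q _ => if_neg fun h => hj h.1.symm

theorem alternantProd_blockRho : alternantProd (blockRho m) =
    (-1) ^ (∑ i, (m i).choose 2) * mono (blockRhoStar m) * denom (BlockPair (m := m)) := by
  have h0 : ∀ i (p q : Fin (m i)), blockEmb i (Pi.single p 1 - Pi.single q 1) =
      rootOf ((⟨i, p⟩ : Idx m), (⟨i, q⟩ : Idx m)) := by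
    have : ∀ i (p : Fin (m i)), blockEmb i (Pi.single p 1) = Pi.single (⟨i, p⟩ : Idx m) 1 := by
      intro i p
      rw [blockEmb_apply, Finset.sum_eq_single p] <;> simp +contextual [Pi.single_eq_of_ne]
    intro i p q
    rw [map_sub, this, this, rootOf]
  rw [denom_blockPair, ← Finset.prod_pow_eq_pow_sum, ← sum_blockEmb (blockRhoStar m), ← prod_mono,
    ← Finset.prod_mul_distrib, ← Finset.prod_mul_distrib]
  refine Finset.prod_congr rfl fun i _ => ?_
  have h1 : (alternant fun p => blockRho m ⟨i, p⟩).mapDomain (blockEmb i) =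
      AddMonoidAlgebra.mapDomainRingHom ℤ (blockEmb (m := m) i) (alternant rho) := rfl
  rw [h1, alternant_rho_eq]
  simp only [map_mul, map_pow, map_neg, map_one, map_prod, map_sub,
    AddMonoidAlgebra.mapDomainRingHom_apply, AddMonoidAlgebra.mapDomain_single, h0]
  rfl

theorem act_comp_equiv {Λ Λ' : Type*} [AddCommGroup Λ] [AddCommGroup Λ'] (c : Λ' ≃+ Λ)
    (p : AddMonoidAlgebra ℤ Λ) (f : Λ → ℤ) :
    act p f ∘ c = act (p.mapDomain c.symm) (f ∘ c) := by
  induction p using AddMonoidAlgebra.induction_linear with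
  | zero => ext; simp
  | add p q hp hq =>
    rw [AddMonoidAlgebra.mapDomain_add, map_add, map_add, LinearMap.add_apply,
      LinearMap.add_apply, ← hp, ← hq]
    rfl
  | single r a =>
    ext x
    rw [AddMonoidAlgebra.mapDomain_single, Function.comp_apply, act_single, act_single,
      Function.comp_apply, map_sub, AddEquiv.apply_symm_apply]

theorem mapDomain_alternantProd (u : ∀ i, Equiv.Perm (Fin (m i))) (β : Idx m → ℤ) :
    (alternantProd β).mapDomain (weightPerm (weylPerm u)).symm = weylSign u • alternantProd β := by
  rw [alternantProd_eq_sum, Finset.smul_sum]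
  change AddMonoidAlgebra.mapDomainRingHom ℤ (weightPerm (weylPerm u)).symm.toAddMonoidHom _ = _
  rw [map_sum, ← Equiv.sum_comp (Equiv.mulRight u)]
  refine Finset.sum_congr rfl fun w _ => ?_
  rw [map_zsmul, smul_smul, Equiv.coe_mulRight, weylSign_mul, mul_comm]
  congr 1
  rw [AddMonoidAlgebra.mapDomainRingHom_apply, AddMonoidAlgebra.mapDomain_single]
  congr 1
  ext s
  change β (weylPerm (w * u) ((weylPerm u).symm s)) = _
  rw [weylPerm_mul, Equiv.apply_symm_apply]
  rfl

/-- The functions that change by the sign under the Weyl group. -/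
def Antisymmetric (g : (Idx m → ℤ) → ℤ) : Prop :=
  ∀ (w : ∀ i, Equiv.Perm (Fin (m i))) x, g (x ∘ weylPerm w) = weylSign w * g x

theorem antisymmetric_act (β : Idx m → ℤ) {f : (Idx m → ℤ) → ℤ}
    (hf : ∀ (w : ∀ i, Equiv.Perm (Fin (m i))) x, f (x ∘ weylPerm w) = f x) :
    Antisymmetric (act (alternantProd β) f) := by
  intro w x
  have h1 := congrFun (act_comp_equiv (weightPerm (weylPerm w)) (alternantProd β) f) x
  have h2 : f ∘ weightPerm (weylPerm w) = f := funext (hf w)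
  rw [h2, mapDomain_alternantProd, map_zsmul] at h1
  exact h1

theorem antisymmetric_coeff (β : Idx m → ℤ) : Antisymmetric ⇑(alternantProd β).coeff := by
  rw [← act_eq_coeff]
  refine antisymmetric_act β fun w x => ?_
  have := coeff_one_comp (c := (weightPerm (weylPerm w)).toAddMonoidHom)
    (weightPerm (weylPerm w)).injective
  exact congrFun this x

theorem Antisymmetric.sub {f g : (Idx m → ℤ) → ℤ} (hf : Antisymmetric f) (hg : Antisymmetric g) :
    Antisymmetric (f - g) := fun w x => by
  rw [Pi.sub_apply, Pi.sub_apply, hf, hg, mul_sub]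

theorem Antisymmetric.sum {ι : Type*} {A : Finset ι} (c : ι → ℤ) {f : ι → (Idx m → ℤ) → ℤ}
    (hf : ∀ i ∈ A, Antisymmetric (f i)) : Antisymmetric fun x => ∑ i ∈ A, c i * f i x :=
  fun w x => by
    rw [Finset.mul_sum]
    refine Finset.sum_congr rfl fun i hi => ?_
    rw [hf i hi, mul_left_comm]

theorem exists_antitone_comp_weylPerm (x : Idx m → ℤ) :
    ∃ w : ∀ i, Equiv.Perm (Fin (m i)), BlockDominant m (x ∘ weylPerm w) :=
  ⟨fun i => Tuple.sort fun p => OrderDual.toDual (x ⟨i, p⟩), fun i =>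
    Tuple.monotone_sort fun p => OrderDual.toDual (x ⟨i, p⟩)⟩

/-- An antisymmetric function vanishes if it does on the strictly dominant weights. -/
theorem Antisymmetric.eq_zero {g : (Idx m → ℤ) → ℤ} (hg : Antisymmetric g)
    (h : ∀ x : Idx m → ℤ, (∀ i, StrictAnti fun p : Fin (m i) => x ⟨i, p⟩) → g x = 0) : g = 0 := by
  classical
  ext x
  obtain ⟨w, hw⟩ := exists_antitone_comp_weylPerm x
  suffices g (x ∘ weylPerm w) = 0 by
    rw [hg] at this
    have h1 := congrArg (weylSign w * ·) this
    simpa [← mul_assoc, weylSign_mul_self] using h1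
  generalize x ∘ weylPerm w = y at hw
  by_cases hy : ∀ i, StrictAnti fun p : Fin (m i) => y ⟨i, p⟩
  · exact h y hy
  · push Not at hy
    obtain ⟨i, hi⟩ := hy
    have h1 : ¬ Function.Injective fun p : Fin (m i) => y ⟨i, p⟩ := fun h' =>
      hi ((hw i).strictAnti_of_injective h')
    simp only [Function.Injective, not_forall] at h1
    obtain ⟨p, q, hpq, hne⟩ := h1
    -- If two coordinates of a block coincide, exchanging them fixes `y` and has sign `-1`, whence
    -- `g y = -g y`.
    have h2 := hg (Function.update 1 i (Equiv.swap p q)) y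
    have h3 : y ∘ weylPerm (Function.update 1 i (Equiv.swap p q)) = y := by
      ext ⟨j, r⟩
      change y ⟨j, Function.update (1 : ∀ i, Equiv.Perm (Fin (m i))) i (Equiv.swap p q) j r⟩ = _
      by_cases hj : j = i
      · subst hj
        rw [Function.update_self]
        rcases eq_or_ne r p with rfl | hp
        · rw [Equiv.swap_apply_left, hpq]
        · rcases eq_or_ne r q with rfl | hq
          · rw [Equiv.swap_apply_right, hpq]
          · rw [Equiv.swap_apply_of_ne_of_ne hp hq]
      · rw [Function.update_of_ne hj]
        rfl
    have h4 : weylSign (Function.update (1 : ∀ i, Equiv.Perm (Fin (m i))) i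
        (Equiv.swap p q)) = -1 := by
      unfold weylSign
      rw [Finset.prod_eq_single i]
      · rw [Function.update_self, Equiv.Perm.sign_swap hne]
        rfl
      · intro j _ hj
        rw [Function.update_of_ne hj]
        simp
      · simp
    rw [h3, h4] at h2
    change g y = 0
    omega

theorem weylPerm_eq_of_strictAnti {x y : Idx m → ℤ}
    (hx : ∀ i, StrictAnti fun p : Fin (m i) => x ⟨i, p⟩)
    (hy : ∀ i, StrictAnti fun p : Fin (m i) => y ⟨i, p⟩) {w : ∀ i, Equiv.Perm (Fin (m i))}
    (h : x ∘ weylPerm w = y) : w = 1 := by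
  ext1 i
  rw [Pi.one_apply, ← Equiv.Perm.monotone_iff]
  refine StrictMono.monotone fun p q hpq => ?_
  have h1 := hy i hpq
  simp only [← h] at h1
  exact (hx i).lt_iff_gt.1 h1

/-- Only the identity of the Weyl group can carry one strictly dominant weight to another: such an
element preserves the order within each block. So an alternant meets the strictly dominant weights
in a single term. -/
theorem coeff_alternantProd {x y : Idx m → ℤ}
    (hx : ∀ i, StrictAnti fun p : Fin (m i) => x ⟨i, p⟩)
    (hy : ∀ i, StrictAnti fun p : Fin (m i) => y ⟨i, p⟩) :
    (alternantProd x).coeff y = if x = y then 1 else 0 := by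
  rw [alternantProd_eq_sum, AddMonoidAlgebra.coeff_sum, Finsupp.finsetSum_apply,
    Finset.sum_eq_single 1]
  · have h1 : x ∘ weylPerm 1 = x := rfl
    rw [h1, AddMonoidAlgebra.coeff_smul, Finsupp.smul_apply, AddMonoidAlgebra.coeff_single,
      Finsupp.single_apply]
    have h2 : weylSign (1 : ∀ i, Equiv.Perm (Fin (m i))) = 1 := by simp [weylSign]
    rw [h2, one_smul]
  · intro w _ hw
    rw [AddMonoidAlgebra.coeff_smul, Finsupp.smul_apply, AddMonoidAlgebra.coeff_single,
      Finsupp.single_apply, if_neg, smul_zero]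
    exact fun h => hw (weylPerm_eq_of_strictAnti hx hy h)
  · simp

theorem strictAnti_add_blockRho {α : Idx m → ℤ} (h : BlockDominant m α) (i : Fin (M + N)) :
    StrictAnti fun p : Fin (m i) => (α + blockRho m) ⟨i, p⟩ := by
  intro p q hpq
  have h1 := h i hpq.le
  simp only [Pi.add_apply, blockRho, rho] at h1 ⊢
  rw [Fin.lt_def] at hpq
  omega

/-- Strictly decreasing integers drop by at least `1` at each step, exactly the drop of `ρ`. With
`strictAnti_add_blockRho` this matches block-dominant weights with strictly dominant ones. -/
theorem blockDominant_sub_blockRho {x : Idx m → ℤ}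
    (h : ∀ i, StrictAnti fun p : Fin (m i) => x ⟨i, p⟩) : BlockDominant m (x - blockRho m) := by
  intro i
  have h1 : ∀ (n : ℕ) (p q : Fin (m i)), (q : ℕ) = p + n → x ⟨i, q⟩ + n ≤ x ⟨i, p⟩ := by
    intro n
    induction n with
    | zero =>
      intro p q hpq
      obtain rfl : q = p := Fin.ext hpq
      simp
    | succ n ih =>
      intro p q hpq
      have h2 := ih p ⟨p + n, by omega⟩ rfl
      have h3 := h i (a := ⟨p + n, by omega⟩) (b := q) (Fin.lt_def.2 (by simp only; omega))
      simp only at h3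
      push_cast
      omega
  intro p q hpq
  have h2 := h1 (q - p) p q (by rw [Fin.le_def] at hpq; omega)
  rw [Fin.le_def] at hpq
  simp only [Pi.sub_apply, blockRho, rho]
  omega

/-- An antisymmetric function is a combination of alternants. -/
theorem Antisymmetric.eq_sum_alternantProd {g : (Idx m → ℤ) → ℤ} (hg : Antisymmetric g)
    (A : Finset (Idx m → ℤ)) (hA : ∀ α ∈ A, BlockDominant m α)
    (hA' : ∀ α, BlockDominant m α → g (α + blockRho m) ≠ 0 → α ∈ A) (x : Idx m → ℤ) :
    g x = ∑ α ∈ A, g (α + blockRho m) * (alternantProd (α + blockRho m)).coeff x := by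
  classical
  rw [← sub_eq_zero]
  refine congrFun (Antisymmetric.eq_zero (g := g - fun x => ∑ α ∈ A, g (α + blockRho m) *
    (alternantProd (α + blockRho m)).coeff x) (hg.sub (Antisymmetric.sum _
      fun α _ => antisymmetric_coeff _)) fun y hy => ?_) x
  rw [Pi.sub_apply, sub_eq_zero]
  have h1 := blockDominant_sub_blockRho hy
  rw [Finset.sum_congr rfl fun α hα => by
    rw [coeff_alternantProd (strictAnti_add_blockRho (hA α hα)) hy]]
  have h2 : ∀ α : Idx m → ℤ, α + blockRho m = y ↔ y - blockRho m = α := fun α => by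
    rw [sub_eq_iff_eq_add, eq_comm]
  simp only [h2, mul_ite, mul_one, mul_zero, Finset.sum_ite_eq, sub_add_cancel]
  split_ifs with h3
  · rfl
  · by_contra h4
    exact h3 (hA' _ h1 (by rwa [sub_add_cancel]))

end Weyl

/-! ### Functions with finite support for given sums over the blocks -/

section BlockSum

variable {M N : ℕ} {m : Fin (M + N) → ℕ}

/-- The sums of the coordinates over the blocks. -/
def blockSum : (Idx m → ℤ) →+ (Fin (M + N) → ℤ) where
  toFun x i := ∑ p, x ⟨i, p⟩
  map_zero' := by ext; simp
  map_add' x y := by ext; simp [Finset.sum_add_distrib]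

theorem blockSum_apply (x : Idx m → ℤ) (i : Fin (M + N)) : blockSum x i = ∑ p, x ⟨i, p⟩ := rfl

theorem blockSum_comp_weylPerm (x : Idx m → ℤ) (w : ∀ i, Equiv.Perm (Fin (m i))) :
    blockSum (x ∘ weylPerm w) = blockSum x := by
  ext i
  exact Equiv.sum_comp (w i) fun p => x ⟨i, p⟩

theorem blockSum_single (s : Idx m) (c : ℤ) : blockSum (Pi.single s c) = Pi.single s.1 c := by
  obtain ⟨j, q⟩ := s
  ext i
  rw [blockSum_apply]
  by_cases h : i = j
  · subst h
    rw [Finset.sum_eq_single q]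
    · simp
    · intro p _ hp
      rw [Pi.single_eq_of_ne]
      exact fun h => hp (eq_of_heq (Sigma.mk.inj h).2)
    · simp
  · rw [Pi.single_eq_of_ne h]
    refine Finset.sum_eq_zero fun p _ => ?_
    rw [Pi.single_eq_of_ne]
    exact fun h' => h (congrArg Sigma.fst h')

theorem blockSum_rootOf {q : Idx m × Idx m} (h : BlockPair q) : blockSum (rootOf q) = 0 := by
  rw [rootOf, map_sub, blockSum_single, blockSum_single, h.1, sub_self]

theorem blockSum_blockRho : blockSum (blockRho m) = blockSum (blockRhoStar m) := by
  ext i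
  rw [blockSum_apply, blockSum_apply, ← Equiv.sum_comp Fin.revPerm]
  refine Finset.sum_congr rfl fun p _ => ?_
  simp only [blockRho, blockRhoStar, rho, rhoStar, Fin.revPerm_apply, Fin.val_rev]
  omega

/-- The functions with finitely many nonzero values for given sums over the blocks. -/
def BlockFinite (h : (Idx m → ℤ) → ℤ) : Prop := ∀ b, {x | h x ≠ 0 ∧ blockSum x = b}.Finite

theorem BlockFinite.sub {f g : (Idx m → ℤ) → ℤ} (hf : BlockFinite f) (hg : BlockFinite g) :
    BlockFinite (f - g) := fun b => by
  refine ((hf b).union (hg b)).subset fun x ⟨h1, h2⟩ => ?_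
  by_cases h : f x = 0
  · exact Or.inr ⟨fun h' => h1 (by simp [h, h']), h2⟩
  · exact Or.inl ⟨h, h2⟩

theorem BlockFinite.act_mono {f : (Idx m → ℤ) → ℤ} (hf : BlockFinite f) (r : Idx m → ℤ) :
    BlockFinite (act (mono r) f) := fun b => by
  refine ((hf (b - blockSum r)).image (· + r)).subset fun x ⟨h1, h2⟩ => ?_
  rw [SuperKostant.act_mono] at h1
  exact ⟨x - r, ⟨h1, by rw [map_sub, h2]⟩, sub_add_cancel _ _⟩

theorem BlockFinite.act_one_sub {f : (Idx m → ℤ) → ℤ} (hf : BlockFinite f) (r : Idx m → ℤ) :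
    BlockFinite (act (1 - mono r) f) := by
  rw [map_sub, map_one]
  exact hf.sub (hf.act_mono r)

theorem BlockFinite.act_prod {ι : Type*} {f : (Idx m → ℤ) → ℤ} (hf : BlockFinite f)
    (S : Finset ι) (w : ι → Idx m → ℤ) : BlockFinite (act (∏ i ∈ S, (1 - mono (w i))) f) := by
  classical
  induction S using Finset.induction_on with
  | empty => simpa using hf
  | insert a S ha ih =>
    rw [Finset.prod_insert ha, act_mul]
    exact ih.act_one_sub _

theorem blockFinite_coeff (p : Laurent (Idx m)) : BlockFinite ⇑p.coeff := fun _ =>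
  p.coeff.hasFiniteSupport.subset fun _ h => h.1

/-- The restriction of a function to given sums over the blocks. -/
def blockRestrict (b : Fin (M + N) → ℤ) (f : (Idx m → ℤ) → ℤ) (x : Idx m → ℤ) : ℤ :=
  if blockSum x = b then f x else 0

theorem BlockFinite.blockRestrict {f : (Idx m → ℤ) → ℤ} (hf : BlockFinite f)
    (b : Fin (M + N) → ℤ) : BlockFinite (blockRestrict b f) := fun c =>
  (hf c).subset fun x ⟨h1, h2⟩ => by
    unfold SuperKostant.blockRestrict at h1
    split_ifs at h1 with h3
    · exact ⟨h1, h2⟩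
    · exact absurd rfl h1

theorem act_denom_blockPair_blockRestrict (b : Fin (M + N) → ℤ) (f : (Idx m → ℤ) → ℤ) :
    act (denom BlockPair) (blockRestrict b f) = blockRestrict b (act (denom BlockPair) f) := by
  classical
  rw [denom_eq_prod]
  have hS : ∀ q ∈ Finset.univ.filter (BlockPair (m := m)), blockSum (rootOf q) = 0 := fun q hq =>
    blockSum_rootOf (Finset.mem_filter.1 hq).2
  generalize Finset.univ.filter (BlockPair (m := m)) = S at hS
  induction S using Finset.induction_on with
  | empty => simp
  | insert a S ha ih =>
    rw [Finset.prod_insert ha, act_mul, act_mul, ih fun q hq => hS q (Finset.mem_insert_of_mem hq)]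
    ext x
    rw [act_one_sub]
    unfold blockRestrict
    rw [act_one_sub, map_sub, hS a (Finset.mem_insert_self _ _), sub_zero]
    split_ifs <;> simp

/-- Translation by a root of the Levi subgroup preserves block sums. A nonzero invariant function
would have infinitely many nonzero values with the same block sums, so the division is unique
without any choice of half-space. -/
theorem eq_of_act_denom_blockPair_eq {f g : (Idx m → ℤ) → ℤ} (hf : BlockFinite f)
    (hg : BlockFinite g) (h : act (denom BlockPair) f = act (denom BlockPair) g) : f = g := by
  classical
  rw [← sub_eq_zero, ← map_sub, denom_eq_prod] at h
  rw [← sub_eq_zero]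
  refine eq_zero_of_act_prod _ _ BlockFinite (fun _ hh _ _ => hh.act_one_sub _)
    (fun f hf q hq x => ?_) (hf.sub hg) h
  have hq := (Finset.mem_filter.1 hq).2
  by_contra h'
  push Not at h'
  have h1 : Function.Injective fun n : ℕ => x - n • rootOf q := by
    intro a b hab
    have h2 := congrFun (sub_right_injective hab) q.1
    have h3 : q.1 ≠ q.2 := fun h => by
      have := hq.2
      rw [h] at this
      exact lt_irrefl _ this
    simpa [rootOf, h3] using h2
  refine Set.infinite_of_injective_forall_mem h1 (fun n => ?_) (hf (blockSum x))
  exact ⟨h' n, by rw [map_sub, map_nsmul, blockSum_rootOf hq, smul_zero, sub_zero]⟩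

theorem blockSum_eq_of_coeff_alternantProd_ne_zero {β x : Idx m → ℤ}
    (h : (alternantProd β).coeff x ≠ 0) : blockSum x = blockSum β := by
  rw [alternantProd_eq_sum, AddMonoidAlgebra.coeff_sum, Finsupp.finsetSum_apply] at h
  obtain ⟨w, _, hw⟩ := Finset.exists_ne_zero_of_sum_ne_zero h
  rw [AddMonoidAlgebra.coeff_smul, Finsupp.smul_apply, AddMonoidAlgebra.coeff_single] at hw
  have h1 : β ∘ weylPerm w = x := by
    by_contra h'
    exact hw (by rw [Finsupp.single_eq_of_ne (Ne.symm h'), smul_zero])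
  rw [← h1, blockSum_comp_weylPerm]

variable (m) in
/-- The Weyl denominator is a product of `1 - s_a / s_b` up to this unit. -/
def denomUnit : Laurent (Idx m) := (-1) ^ (∑ i, (m i).choose 2) * mono (-blockRhoStar m)

theorem denomUnit_mul : denomUnit m * alternantProd (blockRho m) = denom BlockPair := by
  rw [denomUnit, alternantProd_blockRho]
  have h1 := mono_mul_mono_neg (blockRhoStar m)
  have h2 : ((-1) ^ (∑ i, (m i).choose 2) * (-1) ^ (∑ i, (m i).choose 2) : Laurent (Idx m)) = 1 := by
    rw [← mul_pow]
    simp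
  linear_combination (mono (blockRhoStar m) * mono (-blockRhoStar m) * denom BlockPair) * h2 +
    denom BlockPair * h1

theorem act_denomUnit (f : (Idx m → ℤ) → ℤ) (x : Idx m → ℤ) :
    act (denomUnit m) f x = (-1) ^ (∑ i, (m i).choose 2) * f (x + blockRhoStar m) := by
  rw [denomUnit, act_mul, act_neg_one_pow, Pi.smul_apply, act_mono, sub_neg_eq_add, smul_eq_mul]

theorem act_denom_schurProd (α : Idx m → ℤ) : act (denom BlockPair) (schurProd m α).coeff =
    act (denomUnit m) (alternantProd (α + blockRho m)).coeff := by
  rw [← denomUnit_mul, act_mul, act_coeff, mul_comm, schurProd_mul_alternantProd]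

/-- Homogeneity is inherited from alternants: truncation to given block sums commutes with the
product over Levi roots, and division by that product is unique. -/
theorem blockSum_eq_of_coeff_schurProd_ne_zero {α x : Idx m → ℤ}
    (h : (schurProd m α).coeff x ≠ 0) : blockSum x = blockSum α := by
  have h1 : blockRestrict (blockSum α) (schurProd m α).coeff = (schurProd m α).coeff := by
    refine eq_of_act_denom_blockPair_eq ((blockFinite_coeff _).blockRestrict _)
      (blockFinite_coeff _) ?_
    rw [act_denom_blockPair_blockRestrict, act_denom_schurProd]
    ext y
    refine ite_eq_left_iff.2 fun hy => ?_
    by_contra h2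
    rw [act_denomUnit] at h2
    have h3 := blockSum_eq_of_coeff_alternantProd_ne_zero
      (fun h' => h2 (by rw [h', mul_zero]) : (alternantProd (α + blockRho m)).coeff
        (y + blockRhoStar m) ≠ 0)
    rw [map_add, map_add, blockSum_blockRho] at h3
    exact hy (add_right_cancel h3)
  by_contra h2
  rw [← h1, blockRestrict, if_neg h2] at h
  exact h rfl

/-- A Weyl-invariant function is a combination of Schur polynomials, with the coefficients of
its product with the Weyl denominator. -/
theorem eq_finsum_schurProd {f : (Idx m → ℤ) → ℤ} (hf : BlockFinite f)
    (hinv : ∀ (w : ∀ i, Equiv.Perm (Fin (m i))) x, f (x ∘ weylPerm w) = f x)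
    {c : (Idx m → ℤ) → ℤ}
    (hc : ∀ α, c α = act (alternantProd (blockRho m)) f (α + blockRho m)) (x : Idx m → ℤ) :
    {α : Idx m → ℤ | BlockDominant m α ∧ c α * (schurProd m α).coeff x ≠ 0}.Finite ∧
      f x = ∑ᶠ (α : Idx m → ℤ) (_ : BlockDominant m α), c α * (schurProd m α).coeff x := by
  classical
  set g := act (alternantProd (blockRho m)) f with hg
  have hdenom : act (denom BlockPair) f = act (denomUnit m) g := by
    rw [← denomUnit_mul, act_mul]
  have hgfin : BlockFinite g := by
    have h1 : g = (-1) ^ (∑ i, (m i).choose 2) • act (mono (blockRhoStar m))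
        (act (denom BlockPair) f) := by
      rw [hg, alternantProd_blockRho, act_mul, act_mul, act_neg_one_pow]
    intro b
    have h2 := (hf.act_prod (Finset.univ.filter BlockPair) rootOf).act_mono (blockRhoStar m) b
    rw [← denom_eq_prod] at h2
    refine h2.subset fun x ⟨h3, h4⟩ => ⟨fun h5 => h3 ?_, h4⟩
    rw [h1, Pi.smul_apply, h5, smul_zero]
  set b := blockSum x with hb
  -- By homogeneity only Schur polynomials with the block sums of `x` can contribute at `x`, and `g`
  -- has finitely many nonzero values with the correspondingly shifted block sums. All that follows
  -- takes place within these sums.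
  have hfin : {α : Idx m → ℤ | BlockDominant m α ∧ c α ≠ 0 ∧ blockSum α = b}.Finite := by
    refine ((hgfin (b + blockSum (blockRho m))).image (· - blockRho m)).subset ?_
    rintro α ⟨-, h1, h2⟩
    exact ⟨α + blockRho m, ⟨by rwa [hc] at h1, by rw [map_add, h2]⟩, add_sub_cancel_right _ _⟩
  have hsub : {α : Idx m → ℤ | BlockDominant m α ∧ c α * (schurProd m α).coeff x ≠ 0} ⊆
      {α : Idx m → ℤ | BlockDominant m α ∧ c α ≠ 0 ∧ blockSum α = b} := fun α ⟨h1, h2⟩ =>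
    ⟨h1, left_ne_zero_of_mul h2,
      (blockSum_eq_of_coeff_schurProd_ne_zero (right_ne_zero_of_mul h2)).symm⟩
  refine ⟨hfin.subset hsub, ?_⟩
  have hanti : Antisymmetric (blockRestrict (b + blockSum (blockRho m)) g) := by
    intro w y
    unfold blockRestrict
    rw [blockSum_comp_weylPerm]
    split_ifs
    · exact antisymmetric_act _ hinv w y
    · rw [mul_zero]
  have hexp : blockRestrict (b + blockSum (blockRho m)) g =
      fun y => ∑ α ∈ hfin.toFinset, c α * (alternantProd (α + blockRho m)).coeff y := by
    ext y
    rw [hanti.eq_sum_alternantProd hfin.toFinset (fun α hα => (hfin.mem_toFinset.1 hα).1)]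
    · refine Finset.sum_congr rfl fun α hα => ?_
      rw [blockRestrict, map_add, (hfin.mem_toFinset.1 hα).2.2, if_pos rfl, hc]
    · intro α h1 h2
      unfold blockRestrict at h2
      split_ifs at h2 with h3
      · rw [map_add] at h3
        exact hfin.mem_toFinset.2 ⟨h1, by rwa [hc], add_right_cancel h3⟩
      · exact absurd rfl h2
  -- After multiplication by the product over the Levi roots this is the expansion `hexp` into
  -- alternants, translated by `ρ*`. The product may be cancelled because both sides are
  -- block-finite.
  have hres : blockRestrict b f = ∑ α ∈ hfin.toFinset, c α • ⇑(schurProd m α).coeff := by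
    refine eq_of_act_denom_blockPair_eq (hf.blockRestrict b) ?_ ?_
    · have : ∑ α ∈ hfin.toFinset, c α • ⇑(schurProd m α).coeff =
          ⇑(∑ α ∈ hfin.toFinset, c α • schurProd m α).coeff := by
        rw [AddMonoidAlgebra.coeff_sum, Finsupp.coe_finsetSum]
        rfl
      rw [this]
      exact blockFinite_coeff _
    · rw [act_denom_blockPair_blockRestrict, hdenom, map_sum]
      simp only [map_smul, act_denom_schurProd]
      rw [← Finset.sum_congr rfl fun α _ => map_smul (act (denomUnit m)) (c α) _, ← map_sum]
      ext y
      have h1 := congrFun hexp (y + blockRhoStar m)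
      rw [act_denomUnit, Finset.sum_apply]
      simp only [Pi.smul_apply, smul_eq_mul]
      rw [← h1]
      unfold blockRestrict
      rw [act_denomUnit, map_add, blockSum_blockRho]
      simp only [add_left_inj, mul_ite, mul_zero]
  have hx := congrFun hres x
  rw [blockRestrict, if_pos rfl, Finset.sum_apply] at hx
  rw [hx]
  simp only [Pi.smul_apply, smul_eq_mul]
  have h1 : ∀ α : Idx m → ℤ, (∑ᶠ (_ : BlockDominant m α), c α * (schurProd m α).coeff x) =
      if BlockDominant m α then c α * (schurProd m α).coeff x else 0 := fun α => by
    rw [finsum_eq_if]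
  simp only [h1]
  rw [finsum_eq_sum_of_support_subset (s := hfin.toFinset)]
  · refine Finset.sum_congr rfl fun α hα => ?_
    rw [if_pos (hfin.mem_toFinset.1 hα).1]
  · intro α hα
    rw [Function.mem_support, ne_eq, ite_eq_right_iff, Classical.not_imp] at hα
    rw [Set.Finite.coe_toFinset]
    exact hsub hα

end BlockSum

/-! ### The character of the cochain algebra of the nilpotent radical -/

section Character

variable {M N : ℕ} {m : Fin (M + N) → ℕ} (π : Equiv.Perm (Fin (M + N)))

/-- The pairs of variables of the same parity that index roots of the nilpotent radical. -/
def NilEven (q : Idx m × Idx m) : Prop := π q.1.1 < π q.2.1 ∧ (IdxOdd m q.1 ↔ IdxOdd m q.2)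

/-- The pairs of variables of different parity that index roots of the nilpotent radical. -/
def NilOdd (q : Idx m × Idx m) : Prop := π q.1.1 < π q.2.1 ∧ ¬(IdxOdd m q.1 ↔ IdxOdd m q.2)

theorem idxOdd_congr {s t : Idx m} (h : s.1 = t.1) : IdxOdd m s ↔ IdxOdd m t := by
  unfold IdxOdd
  rw [h]

theorem denom_oddIdx : denom (OddIdx (m := m) π) = denom (NilOdd π) := by
  refine denom_congr fun q => ?_
  unfold OddIdx NilOdd IdxLt
  have := idxOdd_congr (s := q.1) (t := q.2)
  tauto

theorem denom_evenIdx :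
    denom (EvenIdx (m := m) π) = denom (NilEven π) * denom BlockPair := by
  classical
  rw [denom_eq_prod, denom_eq_prod, denom_eq_prod, ← Finset.prod_union]
  · refine Finset.prod_congr ?_ fun _ _ => rfl
    ext q
    have := idxOdd_congr (s := q.1) (t := q.2)
    simp only [Finset.mem_union, Finset.mem_filter, Finset.mem_univ, true_and]
    unfold EvenIdx NilEven IdxLt BlockPair
    tauto
  · refine Finset.disjoint_filter.2 fun q _ h1 h2 => ?_
    have := h1.1
    rw [h2.1] at this
    exact lt_irrefl _ this

variable (m) in
/-- The weights of the exterior generators of the cochain algebra. -/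
def extWeight (r : {r : NilRoot m π // ¬ NilRoot.odd m π r}) : Idx m → ℤ := rootOf r.1.1

variable (m) in
/-- The weights of the polynomial generators of the cochain algebra. -/
def polyWeight (r : {r : NilRoot m π // NilRoot.odd m π r}) : Idx m → ℤ := rootOf r.1.1

variable (m) in
/-- The graded superdimension of the cochain algebra. -/
def nilChar : (Idx m → ℤ) → ℤ := partitionFun (extWeight m π) (polyWeight m π)

/-- A height that is positive on the roots of the nilpotent radical. -/
def nilHeight : (Idx m → ℤ) →+ ℤ := weightedSum fun s => -((π s.1 : ℕ) : ℤ)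

theorem nilHeight_pos {q : Idx m × Idx m} (h : π q.1.1 < π q.2.1) : 0 < nilHeight π (rootOf q) := by
  rw [nilHeight, weightedSum_rootOf]
  rw [Fin.lt_def] at h
  omega

theorem nilHeight_eq (x : Idx m → ℤ) :
    nilHeight π x = ∑ i, -((π i : ℕ) : ℤ) * blockSum x i := by
  change ∑ s : Idx m, -((π s.1 : ℕ) : ℤ) * x s = _
  rw [Fintype.sum_sigma]
  simp only [blockSum_apply, Finset.mul_sum]

theorem prod_extWeight : ∏ r, (1 - mono (extWeight m π r)) = denom (NilEven π) := by
  classical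
  rw [denom_eq_prod_subtype]
  exact Fintype.prod_equiv
    { toFun := fun r => ⟨r.1.1, r.1.2, not_not.1 r.2⟩
      invFun := fun q => ⟨⟨q.1, q.2.1⟩, not_not.2 q.2.2⟩
      left_inv := fun _ => rfl
      right_inv := fun _ => rfl } _ _ fun r =>
        congrArg (fun x => 1 - mono x) (rfl : extWeight m π r = rootOf r.1.1)

theorem prod_polyWeight : ∏ r, (1 - mono (polyWeight m π r)) = denom (NilOdd π) := by
  classical
  rw [denom_eq_prod_subtype]
  exact Fintype.prod_equiv
    { toFun := fun r => ⟨r.1.1, r.1.2, r.2⟩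
      invFun := fun q => ⟨⟨q.1, q.2.1⟩, q.2.2⟩
      left_inv := fun _ => rfl
      right_inv := fun _ => rfl } _ _ fun r =>
        congrArg (fun x => 1 - mono x) (rfl : polyWeight m π r = rootOf r.1.1)

theorem act_nilChar : act (denom (NilOdd π)) (nilChar m π) =
    (denom (NilEven π) : Laurent (Idx m)).coeff := by
  rw [← prod_polyWeight, ← prod_extWeight]
  exact act_partitionFun (nilHeight π) _ _ fun r => nilHeight_pos π r.1.2

theorem nilChar_boundedBelow (ht : (Idx m → ℤ) →+ ℤ)
    (h : ∀ r : NilRoot m π, 0 < ht (rootOf r.1)) : BoundedBelow ht (nilChar m π) :=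
  ⟨0, fun _ hx => partitionFun_nonneg ht (polyWeight m π) (extWeight m π)
    (fun r => (h r.1).le) (fun r => (h r.1).le) hx⟩

/-- The height is constant on each block, so fixing the block sums fixes it, and a partition
function has finitely many nonzero values of bounded height. -/
theorem blockFinite_nilChar : BlockFinite (nilChar m π) := fun b => by
  refine (finite_partitionFun (nilHeight π) (polyWeight m π) (extWeight m π)
    (fun r => (nilHeight_pos π r.1.2).le) (fun r => nilHeight_pos π r.1.2)
    (∑ i, -((π i : ℕ) : ℤ) * b i)).subset fun x ⟨h1, h2⟩ => ?_
  exact ⟨h1, by rw [nilHeight_eq, h2]⟩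

theorem mapDomain_denom (C : Idx m × Idx m → Prop) (σ : Equiv.Perm (Idx m))
    (hC : ∀ q, C (σ q.1, σ q.2) ↔ C q) :
    (denom C).mapDomain (weightPerm σ).symm = denom C := by
  classical
  change AddMonoidAlgebra.mapDomainRingHom ℤ (weightPerm σ).symm.toAddMonoidHom _ = _
  rw [denom_eq_prod, map_prod]
  refine Finset.prod_equiv (σ.prodCongr σ) (fun q => ?_) fun q _ => ?_
  · simp only [Finset.mem_filter, Finset.mem_univ, true_and]
    exact (hC q).symm
  · rw [map_sub, map_one, AddMonoidAlgebra.mapDomainRingHom_apply,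
      AddMonoidAlgebra.mapDomain_single]
    congr 2
    have h1 : ∀ a, (Pi.single a 1 : Idx m → ℤ) ∘ σ.symm = Pi.single (σ a) 1 := by
      intro a
      ext s
      rw [Function.comp_apply, Pi.single_apply, Pi.single_apply]
      exact if_congr (Equiv.symm_apply_eq σ) rfl rfl
    change (Pi.single q.1 1 : Idx m → ℤ) ∘ σ.symm - (Pi.single q.2 1 : Idx m → ℤ) ∘ σ.symm = _
    rw [h1, h1]
    rfl

/-- Permutations within blocks preserve the even and the odd roots of the radical and the height.
The permuted function therefore solves the same equation with the same kind of support. -/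
theorem nilChar_comp_weylPerm (w : ∀ i, Equiv.Perm (Fin (m i))) (x : Idx m → ℤ) :
    nilChar m π (x ∘ weylPerm w) = nilChar m π x := by
  classical
  have hodd : ∀ s : Idx m, IdxOdd m (weylPerm w s) ↔ IdxOdd m s := fun s => Iff.rfl
  have h1 : nilChar m π ∘ weightPerm (weylPerm w) = nilChar m π := by
    refine eq_of_act_prod_eq (ht := nilHeight π) (Finset.univ.filter (NilOdd π)) rootOf
      (fun q hq => nilHeight_pos π (Finset.mem_filter.1 hq).2.1) ?_
      (nilChar_boundedBelow π _ fun r => nilHeight_pos π r.2) ?_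
    · obtain ⟨C, hC⟩ := nilChar_boundedBelow π (nilHeight π) fun r => nilHeight_pos π r.2
      refine ⟨C, fun y hy => ?_⟩
      have := hC _ hy
      rwa [nilHeight_eq, weightPerm_apply, blockSum_comp_weylPerm, ← nilHeight_eq] at this
    · have h2 := act_comp_equiv (weightPerm (weylPerm w)) (denom (NilOdd π)) (nilChar m π)
      rw [mapDomain_denom _ _ fun q => by rfl, act_nilChar, ← act_eq_coeff (p := denom (NilEven π)),
        act_comp_equiv,
        mapDomain_denom _ _ fun q => by rfl] at h2
      have h3 := coeff_one_comp (c := (weightPerm (weylPerm w)).toAddMonoidHom)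
        (weightPerm (weylPerm w)).injective
      rw [← denom_eq_prod, ← h2, act_nilChar, ← act_eq_coeff (p := denom (NilEven π))]
      exact congrArg _ h3
  exact congrFun h1 x


/-- Multiplied by the odd factors, both sides become the product over all even positive roots: on
the left this is radical times Levi, on the right the denominator identity. The cancellation uses
the height defined by `refine`, for which both functions are known to be bounded below. -/
theorem act_denom_nilChar (hle : oddDim m ≤ evenDim m) (hπ : IsShuffle π) : act (denom BlockPair) (nilChar m π) =
    fun x : Idx m → ℤ => sectorSum (refine m π (evenDim m)) (complete m (evenDim m) x) := by
  classical
  let ht : (Idx m → ℤ) →+ ℤ :=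
    (permHeight (refine m π (evenDim m))).comp (completeHom m (evenDim m))
  have hpos : ∀ q : Idx m × Idx m, π q.1.1 < π q.2.1 → 0 < ht (rootOf q) := by
    intro q hq
    change 0 < permHeight _ (completeHom m (evenDim m) (rootOf q))
    rw [completeHom_rootOf hle]
    exact permHeight_pos ((refine_idxEmb_lt_iff π hle _ _).2 (Or.inl hq))
  refine eq_of_act_prod_eq (ht := ht) (Finset.univ.filter (NilOdd π)) rootOf
    (fun q hq => hpos q (Finset.mem_filter.1 hq).2.1) ?_ ?_ ?_
  · rw [denom_eq_prod]
    exact (nilChar_boundedBelow π ht fun r => hpos _ r.2).act_prod _ _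
  · obtain ⟨C, hC⟩ := sectorSum_boundedBelow (refine m π (evenDim m))
    exact ⟨C, fun x hx => hC _ hx⟩
  · rw [← denom_eq_prod, ← act_mul, mul_comm, act_mul, act_nilChar, act_coeff, ← denom_oddIdx,
      act_sectorSum_complete π hle hπ, denom_evenIdx, mul_comm]

/-- The sign and the monomial `s^{ρ*}` of the Weyl denominator account for the prefactor and for the
argument `α + ρ - ρ*` of the sector sum. -/
theorem schurCoeff_eq (hle : oddDim m ≤ evenDim m) (hπ : IsShuffle π)
    (α : Idx m → ℤ) : schurCoeff m π α =
    act (alternantProd (blockRho m)) (nilChar m π) (α + blockRho m) := by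
  rw [alternantProd_blockRho, act_mul, act_denom_nilChar π hle hπ, act_mul, act_neg_one_pow,
    Pi.smul_apply, act_mono]
  rfl

/-- The expansion of the graded superdimension of the cochains in Schur polynomials. -/
theorem nilChar_eq_finsum (hle : oddDim m ≤ evenDim m) (hπ : IsShuffle π)
    (x : Idx m → ℤ) :
    {α : Idx m → ℤ | BlockDominant m α ∧ schurCoeff m π α * (schurProd m α).coeff x ≠ 0}.Finite ∧
      nilChar m π x = ∑ᶠ (α : Idx m → ℤ) (_ : BlockDominant m α),
        schurCoeff m π α * (schurProd m α).coeff x :=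
  eq_finsum_schurProd (blockFinite_nilChar π) (nilChar_comp_weylPerm π)
    (schurCoeff_eq π hle hπ) x

end Character

/-! ### Superderivations of the cochain algebra -/

section Exterior

variable {k V : Type*} [Field k] [AddCommGroup V] [Module k V]

/-- The exterior algebra is the Clifford algebra of the zero form, from which the induction
principle, the parity involution and the contractions are taken. -/
theorem ExteriorAlgebra.induction_ι {p : ExteriorAlgebra k V → Prop}
    (h1 : ∀ r, p (algebraMap k _ r)) (h2 : ∀ x y, p x → p y → p (x + y))
    (h3 : ∀ v x, p x → p (ExteriorAlgebra.ι k v * x)) (x : ExteriorAlgebra k V) : p x :=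
  CliffordAlgebra.left_induction (Q := (0 : QuadraticForm k V)) (P := p) h1 h2
    (fun x v hx => h3 v x hx) x

/-- The parity involution of the exterior algebra. -/
def extInvolute : ExteriorAlgebra k V →ₐ[k] ExteriorAlgebra k V :=
  CliffordAlgebra.involute (Q := (0 : QuadraticForm k V))

theorem extInvolute_ι (v : V) :
    extInvolute (ExteriorAlgebra.ι k v) = -ExteriorAlgebra.ι k v :=
  CliffordAlgebra.involute_ι (Q := (0 : QuadraticForm k V)) v

theorem extInvolute_extInvolute (x : ExteriorAlgebra k V) : extInvolute (extInvolute x) = x :=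
  CliffordAlgebra.involute_involute (Q := (0 : QuadraticForm k V)) x

theorem ι_mul_eq (v : V) (x : ExteriorAlgebra k V) :
    ExteriorAlgebra.ι k v * x = extInvolute x * ExteriorAlgebra.ι k v := by
  induction x using ExteriorAlgebra.induction_ι with
  | h1 r => rw [AlgHom.commutes, Algebra.commutes]
  | h2 x y hx hy => rw [mul_add, map_add, add_mul, hx, hy]
  | h3 w x hx =>
    have h := ExteriorAlgebra.ι_add_mul_swap (R := k) v w
    rw [← mul_assoc, eq_neg_of_add_eq_zero_left h, map_mul, extInvolute_ι, neg_mul, neg_mul,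
      neg_mul, mul_assoc, hx, mul_assoc]

/-- The interior product with a linear form. -/
def extContract (f : Module.Dual k V) : ExteriorAlgebra k V →ₗ[k] ExteriorAlgebra k V :=
  CliffordAlgebra.contractLeft (Q := (0 : QuadraticForm k V)) f

theorem extContract_algebraMap (f : Module.Dual k V) (r : k) :
    extContract f (algebraMap k _ r) = 0 :=
  CliffordAlgebra.contractLeft_algebraMap (Q := (0 : QuadraticForm k V)) f r

theorem extContract_one (f : Module.Dual k V) : extContract f 1 = 0 :=
  CliffordAlgebra.contractLeft_one (Q := (0 : QuadraticForm k V)) f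

theorem extContract_ι_mul (f : Module.Dual k V) (v : V) (x : ExteriorAlgebra k V) :
    extContract f (ExteriorAlgebra.ι k v * x) = f v • x - ExteriorAlgebra.ι k v * extContract f x :=
  CliffordAlgebra.contractLeft_ι_mul (Q := (0 : QuadraticForm k V)) f v x

theorem extContract_ι (f : Module.Dual k V) (v : V) :
    extContract f (ExteriorAlgebra.ι k v) = algebraMap k _ (f v) :=
  CliffordAlgebra.contractLeft_ι (Q := (0 : QuadraticForm k V)) f v

theorem extContract_mul (f : Module.Dual k V) (x y : ExteriorAlgebra k V) :
    extContract f (x * y) = extContract f x * y + extInvolute x * extContract f y := by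
  induction x using ExteriorAlgebra.induction_ι with
  | h1 r =>
    rw [extContract_algebraMap, AlgHom.commutes, ← Algebra.smul_def, ← Algebra.smul_def, map_smul,
      zero_mul, zero_add]
  | h2 x x' hx hx' =>
    rw [add_mul, map_add, map_add, map_add, add_mul, add_mul, hx, hx']
    abel
  | h3 v x hx =>
    rw [mul_assoc, extContract_ι_mul, extContract_ι_mul, hx, map_mul, extInvolute_ι, sub_mul,
      mul_add, smul_mul_assoc, mul_assoc, neg_mul, neg_mul, mul_assoc]
    abel

theorem extContract_map {f : Module.Dual k V} {g : V →ₗ[k] V} {c : k} (h : ∀ v, f (g v) = c * f v)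
    (x : ExteriorAlgebra k V) :
    extContract f (ExteriorAlgebra.map g x) = c • ExteriorAlgebra.map g (extContract f x) := by
  induction x using ExteriorAlgebra.induction_ι with
  | h1 r => rw [AlgHom.commutes, extContract_algebraMap, map_zero, smul_zero]
  | h2 x y hx hy => rw [map_add, map_add, map_add, map_add, smul_add, hx, hy]
  | h3 v x hx =>
    rw [map_mul, ExteriorAlgebra.map_apply_ι, extContract_ι_mul, extContract_ι_mul, hx, map_sub,
      map_smul, map_mul, ExteriorAlgebra.map_apply_ι, h, smul_sub, mul_smul, mul_smul_comm]

end Exterior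

/-! ### Coordinates and partial superderivatives on cochains -/

section Superderivation

variable (k : Type*) [Field k] {ι : Type} (odd : ι → Prop)

/-- The parity involution on cochains. -/
def parityInv : Cochains k odd →ₐ[k] Cochains k odd :=
  Algebra.TensorProduct.map (AlgHom.id k _) extInvolute

theorem cochains_induction {p : Cochains k odd → Prop} (h0 : p 0)
    (h1 : ∀ x y, p (x ⊗ₜ[k] y)) (h2 : ∀ x y, p x → p y → p (x + y)) (x : Cochains k odd) : p x :=
  TensorProduct.induction_on x h0 h1 h2

theorem parityInv_tmul (x : MvPolynomial {i : ι // odd i} k)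
    (y : ExteriorAlgebra k ({i : ι // ¬ odd i} → k)) :
    parityInv k odd (x ⊗ₜ[k] y) = x ⊗ₜ[k] extInvolute y := rfl

theorem parityInv_parityInv (x : Cochains k odd) : parityInv k odd (parityInv k odd x) = x := by
  induction x using cochains_induction with
  | h0 => simp
  | h1 x y => rw [parityInv_tmul, parityInv_tmul, extInvolute_extInvolute]
  | h2 x y hx hy => rw [map_add, map_add, hx, hy]

variable [DecidablePred odd]

/-- The power of the parity involution by which a generator commutes with cochains. -/
def parityPow (i : ι) : Cochains k odd →ₐ[k] Cochains k odd :=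
  if odd i then AlgHom.id k _ else parityInv k odd

theorem parityPow_of_odd {i : ι} (h : odd i) (x : Cochains k odd) : parityPow k odd i x = x := by
  rw [parityPow, if_pos h]
  rfl

theorem parityPow_of_not_odd {i : ι} (h : ¬ odd i) (x : Cochains k odd) :
    parityPow k odd i x = parityInv k odd x := by
  rw [parityPow, if_neg h]

theorem coordDeriv_tmul_of_odd {i : ι} (h : odd i) (x : MvPolynomial {i : ι // odd i} k)
    (y : ExteriorAlgebra k ({i : ι // ¬ odd i} → k)) :
    coordDeriv k odd i (x ⊗ₜ[k] y) = MvPolynomial.pderiv ⟨i, h⟩ x ⊗ₜ[k] y := by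
  rw [coordDeriv, dif_pos h]
  rfl

theorem coordDeriv_tmul_of_not_odd {i : ι} (h : ¬ odd i) (x : MvPolynomial {i : ι // odd i} k)
    (y : ExteriorAlgebra k ({i : ι // ¬ odd i} → k)) :
    coordDeriv k odd i (x ⊗ₜ[k] y) = x ⊗ₜ[k] extContract (LinearMap.proj ⟨i, h⟩) y := by
  rw [coordDeriv, dif_neg h]
  rfl

/-- The super Leibniz rule: in the total parity `∂/∂ξ_i` is even on polynomial generators and odd on
exterior ones, so `parityPow` inserts the parity involution only in the second case. -/
theorem coordDeriv_mul (i : ι) (a b : Cochains k odd) :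
    coordDeriv k odd i (a * b) =
      coordDeriv k odd i a * b + parityPow k odd i a * coordDeriv k odd i b := by
  induction a using cochains_induction with
  | h0 => simp
  | h2 x y hx hy =>
    rw [add_mul, map_add, map_add, map_add, add_mul, add_mul, hx, hy]
    abel
  | h1 x y =>
    induction b using cochains_induction with
    | h0 => simp
    | h2 u v hu hv =>
      rw [mul_add, map_add, map_add, mul_add, mul_add, hu, hv]
      abel
    | h1 u v =>
      by_cases h : odd i
      · rw [parityPow_of_odd k odd h]
        simp only [Algebra.TensorProduct.tmul_mul_tmul, coordDeriv_tmul_of_odd k odd h]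
        rw [Derivation.leibniz, smul_eq_mul, smul_eq_mul, add_comm, TensorProduct.add_tmul,
          mul_comm u]
      · rw [parityPow_of_not_odd k odd h]
        simp only [Algebra.TensorProduct.tmul_mul_tmul, coordDeriv_tmul_of_not_odd k odd h,
          parityInv_tmul]
        rw [extContract_mul, TensorProduct.tmul_add]

theorem coordDeriv_one (i : ι) : coordDeriv k odd i 1 = 0 := by
  rw [Algebra.TensorProduct.one_def]
  by_cases h : odd i
  · rw [coordDeriv_tmul_of_odd k odd h, Derivation.map_one_eq_zero, TensorProduct.zero_tmul]
  · rw [coordDeriv_tmul_of_not_odd k odd h, extContract_one, TensorProduct.tmul_zero]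

variable [DecidableEq ι]

theorem coord_of_odd {i : ι} (h : odd i) :
    coord k odd i = MvPolynomial.X ⟨i, h⟩ ⊗ₜ[k] 1 := dif_pos h

theorem coord_of_not_odd {i : ι} (h : ¬ odd i) :
    coord k odd i = 1 ⊗ₜ[k] ExteriorAlgebra.ι k (Pi.single ⟨i, h⟩ 1) := dif_neg h

theorem coord_mul (i : ι) (a : Cochains k odd) :
    coord k odd i * a = parityPow k odd i a * coord k odd i := by
  by_cases h : odd i
  · rw [parityPow_of_odd k odd h, coord_of_odd k odd h]
    induction a using cochains_induction with
    | h0 => simp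
    | h1 x y =>
      rw [Algebra.TensorProduct.tmul_mul_tmul, Algebra.TensorProduct.tmul_mul_tmul, mul_comm,
        one_mul, mul_one]
    | h2 x y hx hy => rw [mul_add, add_mul, hx, hy]
  · rw [parityPow_of_not_odd k odd h, coord_of_not_odd k odd h]
    induction a using cochains_induction with
    | h0 => simp
    | h1 x y =>
      rw [parityInv_tmul, Algebra.TensorProduct.tmul_mul_tmul,
        Algebra.TensorProduct.tmul_mul_tmul, one_mul, mul_one, ι_mul_eq]
    | h2 x y hx hy => rw [mul_add, map_add, add_mul, hx, hy]

theorem coordDeriv_coord (i j : ι) :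
    coordDeriv k odd i (coord k odd j) = if i = j then 1 else 0 := by
  by_cases hi : odd i
  · by_cases hj : odd j
    · rw [coord_of_odd k odd hj, coordDeriv_tmul_of_odd k odd hi, MvPolynomial.pderiv_X]
      split_ifs with h
      · subst h
        rw [Pi.single_eq_same]
        rfl
      · rw [Pi.single_eq_of_ne, TensorProduct.zero_tmul]
        exact fun h' => h (congrArg Subtype.val h').symm
    · rw [coord_of_not_odd k odd hj, coordDeriv_tmul_of_odd k odd hi, Derivation.map_one_eq_zero,
        TensorProduct.zero_tmul, if_neg]
      rintro rfl
      exact hj hi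
  · by_cases hj : odd j
    · rw [coord_of_odd k odd hj, coordDeriv_tmul_of_not_odd k odd hi, extContract_one,
        TensorProduct.tmul_zero, if_neg]
      rintro rfl
      exact hi hj
    · rw [coord_of_not_odd k odd hj, coordDeriv_tmul_of_not_odd k odd hi, extContract_ι,
        LinearMap.proj_apply]
      split_ifs with h
      · subst h
        rw [Pi.single_eq_same, map_one]
        rfl
      · rw [Pi.single_eq_of_ne, map_zero, TensorProduct.tmul_zero]
        exact fun h' => h (congrArg Subtype.val h')

variable [Fintype ι]

/-- The cochain algebra is generated by the coordinates. -/
theorem eq_top_of_coord_mem (S : Subalgebra k (Cochains k odd))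
    (h : ∀ i, coord k odd i ∈ S) : S = ⊤ := by
  have h1 : ∀ x : MvPolynomial {i : ι // odd i} k, x ⊗ₜ[k] 1 ∈ S := by
    intro x
    induction x using MvPolynomial.induction_on with
    | C a => exact S.algebraMap_mem a
    | add x y hx hy => rw [TensorProduct.add_tmul]; exact S.add_mem hx hy
    | mul_X x i hx =>
      have := S.mul_mem hx (h i.1)
      rwa [coord_of_odd k odd i.2, Algebra.TensorProduct.tmul_mul_tmul, one_mul] at this
  have h2 : ∀ v : {i : ι // ¬ odd i} → k, 1 ⊗ₜ[k] ExteriorAlgebra.ι k v ∈ S := by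
    intro v
    rw [pi_eq_sum_univ' v, map_sum, TensorProduct.tmul_sum]
    refine S.sum_mem fun i _ => ?_
    have := S.smul_mem (h i.1) (v i)
    rw [coord_of_not_odd k odd i.2, ← TensorProduct.tmul_smul, ← map_smul] at this
    convert this using 3
  have h3 : ∀ x : ExteriorAlgebra k ({i : ι // ¬ odd i} → k), 1 ⊗ₜ[k] x ∈ S := by
    intro x
    induction x using ExteriorAlgebra.induction_ι with
    | h1 r =>
      have := S.algebraMap_mem r
      rwa [Algebra.TensorProduct.algebraMap_apply'] at this
    | h2 x y hx hy => rw [TensorProduct.tmul_add]; exact S.add_mem hx hy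
    | h3 v x hx =>
      have := S.mul_mem (h2 v) hx
      rwa [Algebra.TensorProduct.tmul_mul_tmul, one_mul] at this
  refine eq_top_iff.2 fun x _ => ?_
  induction x using cochains_induction with
  | h0 => exact S.zero_mem
  | h1 x y =>
    have := S.mul_mem (h1 x) (h3 y)
    rwa [Algebra.TensorProduct.tmul_mul_tmul, one_mul, mul_one] at this
  | h2 x y hx hy => exact S.add_mem (hx trivial) (hy trivial)

end Superderivation

/-! ### The Chevalley–Eilenberg differential as an odd superderivation -/

section Differential

variable (k : Type*) [Field k] {ι : Type} (odd : ι → Prop)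

theorem neg_one_smul_cochains (x : Cochains k odd) : (-1 : k) • x = -x :=
  neg_one_smul k x

theorem neg_smul_cochains (r : k) (x : Cochains k odd) : (-r) • x = -(r • x) :=
  neg_smul r x

theorem sub_smul_cochains (r s : k) (x : Cochains k odd) : (r - s) • x = r • x - s • x :=
  sub_smul r s x

theorem diagAct_tmul (u : ι → k) (x : MvPolynomial {i : ι // odd i} k)
    (y : ExteriorAlgebra k ({i : ι // ¬ odd i} → k)) :
    diagAct k u (x ⊗ₜ[k] y) =
      (MvPolynomial.aeval (fun i : {i : ι // odd i} =>
          MvPolynomial.C (u i) * MvPolynomial.X i) x : MvPolynomial {i : ι // odd i} k) ⊗ₜ[k]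
        ExteriorAlgebra.map (LinearMap.pi fun i : {i : ι // ¬ odd i} =>
          u i • (LinearMap.proj i : ({i : ι // ¬ odd i} → k) →ₗ[k] k)) y := rfl

theorem pderiv_aeval_C_mul_X {P : Type} (u : P → k) (i : P) (x : MvPolynomial P k) :
    MvPolynomial.pderiv i (MvPolynomial.aeval (fun i =>
      MvPolynomial.C (u i) * MvPolynomial.X i) x : MvPolynomial P k) =
      u i • MvPolynomial.aeval (fun i => MvPolynomial.C (u i) * MvPolynomial.X i)
        (MvPolynomial.pderiv i x) := by
  classical
  induction x using MvPolynomial.induction_on with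
  | C a => simp
  | add x y hx hy => rw [map_add, map_add, map_add, map_add, smul_add, hx, hy]
  | mul_X x j hx =>
    rw [map_mul, Derivation.leibniz, hx, Derivation.leibniz, MvPolynomial.aeval_X,
      Derivation.leibniz, MvPolynomial.pderiv_C, MvPolynomial.pderiv_X]
    by_cases h : j = i
    · subst h
      simp [MvPolynomial.smul_eq_C_mul]
      ring
    · rw [Pi.single_eq_of_ne h]
      simp [MvPolynomial.smul_eq_C_mul]
      ring

variable [DecidablePred odd]

theorem coordDeriv_diagAct (u : ι → k) (i : ι) (a : Cochains k odd) :
    coordDeriv k odd i (diagAct k u a) = u i • diagAct k u (coordDeriv k odd i a) := by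
  induction a using cochains_induction with
  | h0 => simp
  | h2 x y hx hy => rw [map_add, map_add, map_add, map_add, smul_add, hx, hy]
  | h1 x y =>
    by_cases h : odd i
    · rw [diagAct_tmul, coordDeriv_tmul_of_odd k odd h, coordDeriv_tmul_of_odd k odd h,
        diagAct_tmul, pderiv_aeval_C_mul_X k (fun i : {i : ι // odd i} => u i),
        TensorProduct.smul_tmul']
    · rw [diagAct_tmul, coordDeriv_tmul_of_not_odd k odd h, coordDeriv_tmul_of_not_odd k odd h,
        diagAct_tmul, extContract_map (c := u i) fun v => rfl, TensorProduct.tmul_smul]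

/-- The sign by which the parity involution acts on a generator. -/
def coordSign (i : ι) : k := if odd i then 1 else -1

variable [DecidableEq ι]

theorem diagAct_coord (u : ι → k) (i : ι) :
    diagAct k u (coord k odd i) = u i • coord k odd i := by
  by_cases h : odd i
  · rw [coord_of_odd k odd h, diagAct_tmul, MvPolynomial.aeval_X, map_one,
      TensorProduct.smul_tmul', MvPolynomial.smul_eq_C_mul]
  · rw [coord_of_not_odd k odd h, diagAct_tmul, map_one, ExteriorAlgebra.map_apply_ι,
      ← TensorProduct.tmul_smul, ← map_smul]
    congr 2
    funext j
    by_cases hj : j = ⟨i, h⟩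
    · subst hj
      simp
    · simp [Pi.single_eq_of_ne hj]

theorem parityInv_coord (i : ι) :
    parityInv k odd (coord k odd i) = coordSign k odd i • coord k odd i := by
  by_cases h : odd i
  · rw [coord_of_odd k odd h, parityInv_tmul, map_one, coordSign, if_pos h, one_smul]
  · rw [coord_of_not_odd k odd h, parityInv_tmul, extInvolute_ι, coordSign, if_neg h,
      TensorProduct.tmul_neg, neg_one_smul_cochains]

variable [Fintype ι]

theorem parityInv_eq_diagAct : parityInv k odd = diagAct k (coordSign k odd) := by
  have h := eq_top_of_coord_mem k odd
    (AlgHom.equalizer (parityInv k odd) (diagAct k (coordSign k odd)))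
    fun i => (parityInv_coord k odd i).trans (diagAct_coord k odd _ i).symm
  exact AlgHom.ext fun x => (h ▸ trivial : x ∈ AlgHom.equalizer _ _)

variable (c : ι → ι → ι → k)

/-- The value of the Chevalley–Eilenberg differential on a coordinate. -/
def ceForm (l : ι) : Cochains k odd :=
  -(2⁻¹ : k) • ∑ i, ∑ j,
    ((if odd i then -1 else 1) * c i j l) • (coord k odd i * coord k odd j)

theorem ceDiff_apply (a : Cochains k odd) :
    ceDiff k odd c a = ∑ l, ceForm k odd c l * coordDeriv k odd l a := by
  rw [ceDiff, LinearMap.sum_apply]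
  rfl

theorem ceDiff_one : ceDiff k odd c 1 = 0 := by
  rw [ceDiff_apply]
  exact Finset.sum_eq_zero fun l _ => by rw [coordDeriv_one, mul_zero]

theorem ceDiff_coord (l : ι) : ceDiff k odd c (coord k odd l) = ceForm k odd c l := by
  rw [ceDiff_apply, Finset.sum_eq_single l]
  · rw [coordDeriv_coord, if_pos rfl, mul_one]
  · intro i _ h
    rw [coordDeriv_coord, if_neg h, mul_zero]
  · exact fun h => absurd (Finset.mem_univ l) h

variable {c}

theorem diagAct_ceForm {u : ι → k} {κ : k} {l : ι}
    (h : ∀ i j, c i j l ≠ 0 → u i * u j = κ * u l) :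
    diagAct k u (ceForm k odd c l) = (κ * u l) • ceForm k odd c l := by
  rw [ceForm, map_smul, map_sum, smul_comm]
  congr 1
  rw [Finset.smul_sum]
  refine Finset.sum_congr rfl fun i _ => ?_
  rw [map_sum, Finset.smul_sum]
  refine Finset.sum_congr rfl fun j _ => ?_
  by_cases hc : c i j l = 0
  · simp [hc]
  · rw [map_smul, map_mul, diagAct_coord, diagAct_coord, smul_mul_smul_comm, h i j hc, smul_comm]

/-- One statement serves both gradings: `κ = 1` gives invariance of the differential under the
torus, and `κ = -1` its oddness, the parity involution being diagonal by `parityInv_eq_diagAct`. -/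
theorem diagAct_ceDiff {u : ι → k} {κ : k}
    (h : ∀ i j l, c i j l ≠ 0 → u i * u j = κ * u l) (a : Cochains k odd) :
    diagAct k u (ceDiff k odd c a) = κ • ceDiff k odd c (diagAct k u a) := by
  rw [ceDiff_apply, ceDiff_apply, map_sum, Finset.smul_sum]
  refine Finset.sum_congr rfl fun l _ => ?_
  rw [map_mul, diagAct_ceForm k odd fun i j => h i j l, coordDeriv_diagAct, smul_mul_assoc,
    mul_smul_comm, smul_smul]

theorem parityInv_ceDiff (hc : ∀ i j l, c i j l ≠ 0 → (odd l ↔ ¬(odd i ↔ odd j)))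
    (a : Cochains k odd) :
    parityInv k odd (ceDiff k odd c a) = -ceDiff k odd c (parityInv k odd a) := by
  rw [parityInv_eq_diagAct, diagAct_ceDiff (κ := -1) k odd _ a, neg_one_smul_cochains]
  intro i j l h
  have := hc i j l h
  by_cases hi : odd i <;> by_cases hj : odd j <;> simp_all [coordSign]

/-- Moving a cochain past `ξ_i ξ_j` applies the parity powers of `i` and `j`. Since the bracket
respects parity, these combined with that of `l` give the parity involution exactly once. This makes
the differential an odd superderivation. -/
theorem ceForm_mul (hc : ∀ i j l, c i j l ≠ 0 → (odd l ↔ ¬(odd i ↔ odd j))) (l : ι)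
    (a : Cochains k odd) :
    ceForm k odd c l * parityPow k odd l a = parityInv k odd a * ceForm k odd c l := by
  rw [ceForm, smul_mul_assoc, mul_smul_comm]
  congr 1
  rw [Finset.sum_mul, Finset.mul_sum]
  refine Finset.sum_congr rfl fun i _ => ?_
  rw [Finset.sum_mul, Finset.mul_sum]
  refine Finset.sum_congr rfl fun j _ => ?_
  by_cases h0 : c i j l = 0
  · simp [h0]
  · have h : parityPow k odd i (parityPow k odd j (parityPow k odd l a)) = parityInv k odd a := by
      have := hc i j l h0
      by_cases hi : odd i <;> by_cases hj : odd j <;>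
        simp_all [parityPow_of_odd, parityPow_of_not_odd, parityInv_parityInv]
    rw [smul_mul_assoc, mul_smul_comm, mul_assoc, coord_mul k odd j, ← mul_assoc, coord_mul k odd i,
      mul_assoc, h]

theorem ceDiff_mul (hc : ∀ i j l, c i j l ≠ 0 → (odd l ↔ ¬(odd i ↔ odd j)))
    (a b : Cochains k odd) :
    ceDiff k odd c (a * b) =
      ceDiff k odd c a * b + parityInv k odd a * ceDiff k odd c b := by
  simp only [ceDiff_apply]
  rw [Finset.sum_mul, Finset.mul_sum, ← Finset.sum_add_distrib]
  refine Finset.sum_congr rfl fun l _ => ?_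
  rw [coordDeriv_mul, mul_add, ← mul_assoc, ← mul_assoc, ceForm_mul k odd hc, mul_assoc _ (ceForm _ _ _ _)]

theorem add_neg_mul_add_mul_add {R : Type*} [Ring R] (x y u v : R) :
    x + -u * v + (u * v + y) = x + y := by
  noncomm_ring

/-- The square of an odd superderivation is a derivation, whose kernel is a subalgebra; it suffices
to test the generators. -/
theorem ceDiff_ceDiff (hc : ∀ i j l, c i j l ≠ 0 → (odd l ↔ ¬(odd i ↔ odd j)))
    (h : ∀ l, ceDiff k odd c (ceForm k odd c l) = 0) (a : Cochains k odd) :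
    ceDiff k odd c (ceDiff k odd c a) = 0 := by
  have key : ∀ a b : Cochains k odd, ceDiff k odd c (ceDiff k odd c (a * b)) =
      ceDiff k odd c (ceDiff k odd c a) * b + a * ceDiff k odd c (ceDiff k odd c b) := by
    intro a b
    rw [ceDiff_mul k odd hc, map_add, ceDiff_mul k odd hc, ceDiff_mul k odd hc,
      parityInv_ceDiff k odd hc, parityInv_parityInv]
    exact add_neg_mul_add_mul_add _ _ _ _
  let S : Subalgebra k (Cochains k odd) :=
    { carrier := {a | ceDiff k odd c (ceDiff k odd c a) = 0}
      mul_mem' := fun {a b} (ha : _ = 0) (hb : _ = 0) => by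
        change _ = 0
        rw [key, ha, hb, zero_mul, mul_zero, add_zero]
      add_mem' := fun {a b} (ha : _ = 0) (hb : _ = 0) => by
        change _ = 0
        rw [map_add, map_add, ha, hb, add_zero]
      algebraMap_mem' := fun r => by
        change _ = 0
        rw [Algebra.algebraMap_eq_smul_one, map_smul, ceDiff_one, smul_zero, map_zero] }
  have hS := eq_top_of_coord_mem k odd S fun l => by
    change ceDiff k odd c (ceDiff k odd c (coord k odd l)) = 0
    rw [ceDiff_coord, h]
  exact (hS ▸ trivial : a ∈ S)

end Differential

/-! ### The complex of the nilpotent radical -/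

section NilComplex

variable {M N : ℕ} (m : Fin (M + N) → ℕ) (π : Equiv.Perm (Fin (M + N))) (k : Type*) [Field k]

theorem unit_apply (r : NilRoot m π) (a b : Idx m) :
    r.unit m π k a b = if r.1.1 = a ∧ r.1.2 = b then 1 else 0 := by
  rw [NilRoot.unit, Matrix.single_apply]

theorem unit_ne_zero {r : NilRoot m π} {a b : Idx m} (h : r.unit m π k a b ≠ 0) :
    r.1 = (a, b) := by
  rw [unit_apply] at h
  by_contra h'
  exact h (if_neg fun h'' => h' (Prod.ext h''.1 h''.2))

theorem unit_mul_unit_ne_zero {r r' : NilRoot m π} {a b : Idx m}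
    (h : (r.unit m π k * r'.unit m π k) a b ≠ 0) :
    r.1.1 = a ∧ r.1.2 = r'.1.1 ∧ r'.1.2 = b := by
  rw [Matrix.mul_apply] at h
  obtain ⟨c, -, hc⟩ := Finset.exists_ne_zero_of_sum_ne_zero h
  have h1 := unit_ne_zero m π k (left_ne_zero_of_mul hc)
  have h2 := unit_ne_zero m π k (right_ne_zero_of_mul hc)
  rw [h1, h2]
  exact ⟨rfl, rfl, rfl⟩

theorem structConst_ne_zero {r r' r'' : NilRoot m π} (h : structConst m π k r r' r'' ≠ 0) :
    (r.1.1 = r''.1.1 ∧ r.1.2 = r'.1.1 ∧ r'.1.2 = r''.1.2) ∨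
      (r'.1.1 = r''.1.1 ∧ r'.1.2 = r.1.1 ∧ r.1.2 = r''.1.2) := by
  by_contra! h'
  refine h ?_
  have h1 : (r.unit m π k * r'.unit m π k) r''.1.1 r''.1.2 = 0 := by
    by_contra h0
    have := unit_mul_unit_ne_zero m π k h0
    exact h'.1 this.1 this.2.1 this.2.2
  have h2 : (r'.unit m π k * r.unit m π k) r''.1.1 r''.1.2 = 0 := by
    by_contra h0
    have := unit_mul_unit_ne_zero m π k h0
    exact h'.2 this.1 this.2.1 this.2.2
  rw [structConst, superBracket, Matrix.sub_apply, Matrix.smul_apply, h1, h2, smul_zero, sub_zero]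

theorem odd_of_structConst_ne_zero (r r' r'' : NilRoot m π) (h : structConst m π k r r' r'' ≠ 0) :
    NilRoot.odd m π r'' ↔ ¬(NilRoot.odd m π r ↔ NilRoot.odd m π r') := by
  unfold NilRoot.odd
  rcases structConst_ne_zero m π k h with ⟨h1, h2, h3⟩ | ⟨h1, h2, h3⟩
  · rw [← h1, ← h3, h2]
    tauto
  · rw [← h1, ← h3, h2]
    tauto

theorem torusAct_nilDiff (t : Idx m → kˣ) (x : NilCochains m π k) :
    torusAct π k t (nilDiff m π k x) = nilDiff m π k (torusAct π k t x) := by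
  refine (diagAct_ceDiff (κ := 1) k (NilRoot.odd m π) ?_ x).trans (one_smul k _)
  intro i j l h
  rw [one_mul, ← Units.val_mul]
  congr 1
  rcases structConst_ne_zero m π k h with ⟨h1, h2, h3⟩ | ⟨h1, h2, h3⟩
  · rw [← h1, ← h3, h2]
    group
  · rw [← h1, ← h3, h2, mul_comm]
    group

/-- The sign `-1` if exactly one of two indices is odd. -/
def idxSign (a b : Idx m) : k := if IdxOdd m a ↔ IdxOdd m b then 1 else -1

theorem idxSign_mul_self (a b : Idx m) : idxSign m k a b * idxSign m k a b = 1 := by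
  unfold idxSign
  split_ifs <;> simp

theorem idxSign_mul (a b c : Idx m) :
    idxSign m k a b * idxSign m k a c = idxSign m k c b := by
  unfold idxSign
  by_cases ha : IdxOdd m a <;> by_cases hb : IdxOdd m b <;> by_cases hc : IdxOdd m c <;>
    simp [ha, hb, hc]

theorem idxSign_root (r : NilRoot m π) :
    idxSign m k r.1.1 r.1.2 = if NilRoot.odd m π r then -1 else 1 := by
  unfold idxSign
  by_cases h : IdxOdd m r.1.1 ↔ IdxOdd m r.1.2
  · rw [if_pos h, if_neg fun h' : NilRoot.odd m π r => h' h]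
  · rw [if_neg h, if_pos (show NilRoot.odd m π r from h)]

/-- The entries of the generic matrix of the nilpotent radical. -/
def genMatrix (a b : Idx m) : NilCochains m π k :=
  ∑ i, NilRoot.unit m π k i a b • coord k (NilRoot.odd m π) i

theorem genMatrix_apply (i : NilRoot m π) :
    genMatrix m π k i.1.1 i.1.2 = coord k (NilRoot.odd m π) i := by
  rw [genMatrix, Finset.sum_eq_single i]
  · rw [unit_apply, if_pos ⟨rfl, rfl⟩, one_smul]
  · intro j _ hj
    by_contra h
    exact hj (Subtype.ext (unit_ne_zero m π k (left_ne_zero_of_smul h)))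
  · exact fun h => absurd (Finset.mem_univ i) h

theorem genMatrix_eq_zero {a b : Idx m} (h : ¬ π a.1 < π b.1) : genMatrix m π k a b = 0 := by
  refine Finset.sum_eq_zero fun i _ => ?_
  by_contra h'
  have h1 := unit_ne_zero m π k (left_ne_zero_of_smul h')
  have h2 := i.2
  rw [h1] at h2
  exact h h2

theorem coord_mul_coord (i j : NilRoot m π) :
    coord k (NilRoot.odd m π) j * coord k (NilRoot.odd m π) i =
      (if ¬ NilRoot.odd m π i ∧ ¬ NilRoot.odd m π j then (-1 : k) else 1) •
        (coord k (NilRoot.odd m π) i * coord k (NilRoot.odd m π) j) := by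
  rw [coord_mul]
  by_cases hj : NilRoot.odd m π j
  · rw [parityPow_of_odd _ _ hj, if_neg (fun h => h.2 hj), one_smul]
  · rw [parityPow_of_not_odd _ _ hj, parityInv_coord, smul_mul_assoc, coordSign]
    congr 1
    by_cases hi : NilRoot.odd m π i <;> simp [hi, hj]

theorem sum_idxSign_smul_genMatrix_mul (a b : Idx m) :
    ∑ c, idxSign m k a c • (genMatrix m π k a c * genMatrix m π k c b) =
      ∑ i, ∑ j, ((if NilRoot.odd m π i then -1 else 1) *
        (NilRoot.unit m π k i * NilRoot.unit m π k j) a b) •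
          (coord k (NilRoot.odd m π) i * coord k (NilRoot.odd m π) j) := by
  simp only [genMatrix, Finset.sum_mul, Finset.mul_sum, Finset.smul_sum, Matrix.mul_apply,
    Finset.sum_smul]
  rw [Finset.sum_comm]
  conv_rhs => rw [Finset.sum_comm]
  refine Finset.sum_congr rfl fun j _ => ?_
  rw [Finset.sum_comm]
  refine Finset.sum_congr rfl fun i _ => Finset.sum_congr rfl fun c _ => ?_
  rw [smul_mul_smul_comm, smul_smul]
  by_cases h : NilRoot.unit m π k i a c = 0
  · simp [h]
  · have h' : idxSign m k a c = if NilRoot.odd m π i then -1 else 1 := by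
      rw [← idxSign_root, unit_ne_zero m π k h]
    rw [h']

/-- The two terms of the supercommutator contribute equally, by supercommutativity of the
coordinates, and this absorbs the factor `1/2`. The result is the Maurer–Cartan equation `dX =
-X·X`, with signs, for the generic matrix `X`. -/
theorem ceForm_structConst [CharZero k] (l : NilRoot m π) :
    ceForm k (NilRoot.odd m π) (structConst m π k) l =
      -∑ c, idxSign m k l.1.1 c • (genMatrix m π k l.1.1 c * genMatrix m π k c l.1.2) := by
  rw [sum_idxSign_smul_genMatrix_mul]
  set S : NilCochains m π k := ∑ i, ∑ j, ((if NilRoot.odd m π i then -1 else 1) *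
    (NilRoot.unit m π k i * NilRoot.unit m π k j) l.1.1 l.1.2) •
      (coord k (NilRoot.odd m π) i * coord k (NilRoot.odd m π) j) with hS
  have h : ∑ i, ∑ j, ((if NilRoot.odd m π i then -1 else 1) * structConst m π k i j l) •
      (coord k (NilRoot.odd m π) i * coord k (NilRoot.odd m π) j) = (2 : k) • S := by
    have h2 : ∑ i, ∑ j, ((if NilRoot.odd m π i then -1 else 1) *
        ((if NilRoot.odd m π i ∧ NilRoot.odd m π j then (-1 : k) else 1) *
          (NilRoot.unit m π k j * NilRoot.unit m π k i) l.1.1 l.1.2)) •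
        (coord k (NilRoot.odd m π) i * coord k (NilRoot.odd m π) j) = -S := by
      rw [Finset.sum_comm, hS, ← Finset.sum_neg_distrib]
      refine Finset.sum_congr rfl fun i _ => ?_
      rw [← Finset.sum_neg_distrib]
      refine Finset.sum_congr rfl fun j _ => ?_
      rw [coord_mul_coord, smul_smul, ← neg_smul_cochains]
      congr 1
      by_cases hi : NilRoot.odd m π i <;> by_cases hj : NilRoot.odd m π j <;> simp [hi, hj]
    rw [two_smul, ← sub_neg_eq_add, ← h2, hS, ← Finset.sum_sub_distrib]
    refine Finset.sum_congr rfl fun i _ => ?_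
    rw [← Finset.sum_sub_distrib]
    refine Finset.sum_congr rfl fun j _ => ?_
    rw [← sub_smul_cochains, ← mul_sub, structConst, superBracket, Matrix.sub_apply, Matrix.smul_apply,
      smul_eq_mul]
  rw [ceForm, h, smul_smul, neg_mul, inv_mul_cancel₀ two_ne_zero, neg_one_smul_cochains]

/-- Allowing all pairs removes conditions on the summation index later. Off the radical both sides
vanish, since a nonzero product would force `π a.1 < π c.1 < π b.1`. -/
theorem nilDiff_genMatrix [CharZero k] (a b : Idx m) :
    nilDiff m π k (genMatrix m π k a b) =
      -∑ c, idxSign m k a c • (genMatrix m π k a c * genMatrix m π k c b) := by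
  by_cases h : π a.1 < π b.1
  · rw [genMatrix_apply m π k ⟨(a, b), h⟩, nilDiff, ceDiff_coord, ceForm_structConst]
  · rw [genMatrix_eq_zero m π k h, map_zero, Finset.sum_eq_zero, neg_zero]
    intro c _
    by_cases h1 : π a.1 < π c.1
    · rw [genMatrix_eq_zero m π k (fun h2 => h (h1.trans h2)), mul_zero, smul_zero]
    · rw [genMatrix_eq_zero m π k h1, zero_mul, smul_zero]

theorem parityInv_genMatrix (a b : Idx m) :
    parityInv k (NilRoot.odd m π) (genMatrix m π k a b) =
      -(idxSign m k a b • genMatrix m π k a b) := by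
  by_cases h : π a.1 < π b.1
  · have h' : coordSign k (NilRoot.odd m π) ⟨(a, b), h⟩ = -idxSign m k a b := by
      rw [idxSign_root m π k ⟨(a, b), h⟩, coordSign]
      split_ifs <;> simp
    rw [genMatrix_apply m π k ⟨(a, b), h⟩, parityInv_coord, h', neg_smul_cochains]
  · rw [genMatrix_eq_zero m π k h, map_zero, smul_zero, neg_zero]

theorem nilDiff_mul (x y : NilCochains m π k) :
    nilDiff m π k (x * y) =
      nilDiff m π k x * y + parityInv k (NilRoot.odd m π) x * nilDiff m π k y :=
  ceDiff_mul k (NilRoot.odd m π) (odd_of_structConst_ne_zero m π k) x y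

/-- This is `(X·X)·X = X·(X·X)` with signs. The relations on `s` give the two triple sums equal
coefficients up to an overall sign, and they cancel. It is the vanishing of the squared differential
on generators. -/
theorem sum_smul_triple_products {I R : Type*} [Fintype I] [Ring R] [Algebra k R] {s : I → I → k}
    (hs : ∀ a b, s a b * s a b = 1) (hs' : ∀ a b c, s a b * s a c = s c b) (X : I → I → R)
    (a b : I) :
    ∑ c, s a c • ((-∑ e, s a e • (X a e * X e c)) * X c b +
      (-(s a c • X a c)) * (-∑ e, s c e • (X c e * X e b))) = 0 := by
  have hs'' : ∀ x y, s a x * (s x y * s a x) = s x y := fun x y => by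
    rw [mul_comm (s x y), ← mul_assoc, hs, one_mul]
  simp only [smul_add, Finset.sum_add_distrib, neg_mul, mul_neg, smul_neg, Finset.sum_neg_distrib,
    Finset.sum_mul, Finset.mul_sum, Finset.smul_sum, smul_mul_assoc, mul_smul_comm, smul_smul,
    hs', hs'', mul_assoc, neg_neg]
  rw [Finset.sum_comm, neg_add_cancel]

theorem nilDiff_nilDiff [CharZero k] (x : NilCochains m π k) :
    nilDiff m π k (nilDiff m π k x) = 0 := by
  refine ceDiff_ceDiff k (NilRoot.odd m π) (odd_of_structConst_ne_zero m π k) (fun l => ?_) x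
  change nilDiff m π k _ = 0
  rw [ceForm_structConst, map_neg, map_sum, neg_eq_zero]
  simp only [map_smul, nilDiff_mul, nilDiff_genMatrix, parityInv_genMatrix]
  exact sum_smul_triple_products k (idxSign_mul_self m k) (idxSign_mul m k) _ _ _

end NilComplex

/-! ### Euler characteristics of differential graded vector spaces -/

section EulerCharacteristic

variable {k V : Type*} [Field k] [AddCommGroup V] [Module k V]

/-- The Euler–Poincaré principle for a `ℤ/2`-graded piece `W₀ ⊕ W₁` of a differential space. -/
theorem finrank_cohomology_sub {d : V →ₗ[k] V} (hd : ∀ v, d (d v) = 0) {W₀ W₁ : Submodule k V}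
    [FiniteDimensional k W₀] [FiniteDimensional k W₁] (h₀ : W₀.map d ≤ W₁) (h₁ : W₁.map d ≤ W₀)
    (h₀' : LinearMap.range d ⊓ W₁ ≤ W₀.map d) (h₁' : LinearMap.range d ⊓ W₀ ≤ W₁.map d) :
    (Module.finrank k ((LinearMap.ker d ⊓ W₀).map (LinearMap.range d).mkQ) : ℤ) -
      Module.finrank k ((LinearMap.ker d ⊓ W₁).map (LinearMap.range d).mkQ) =
      Module.finrank k W₀ - Module.finrank k W₁ := by
  have rn : ∀ {V' : Type _} [AddCommGroup V'] [Module k V'] (f : V →ₗ[k] V') (W : Submodule k V)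
      [FiniteDimensional k W],
      Module.finrank k (W.map f) + Module.finrank k (LinearMap.ker f ⊓ W : Submodule k V) =
        Module.finrank k W := by
    intro V' _ _ f W _
    have h := (f.domRestrict W).finrank_range_add_finrank_ker
    rw [LinearMap.range_domRestrict, LinearMap.ker_domRestrict] at h
    rw [← h, inf_comm, ← Submodule.map_comap_subtype, Submodule.finrank_map_subtype_eq]
  -- Rank–nullity is applied to `d` on `W'` and to the quotient map on the cocycles in `W`. The
  -- kernel of the latter is exactly `W'.map d`, because a boundary lying in `W` is the image of an
  -- element of `W'`.
  have step : ∀ {W W' : Submodule k V} [FiniteDimensional k W] [FiniteDimensional k W'],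
      W'.map d ≤ W → LinearMap.range d ⊓ W ≤ W'.map d →
      Module.finrank k ((LinearMap.ker d ⊓ W).map (LinearMap.range d).mkQ) +
        Module.finrank k W' =
      Module.finrank k (LinearMap.ker d ⊓ W : Submodule k V) +
        Module.finrank k (LinearMap.ker d ⊓ W' : Submodule k V) := by
    intro W W' _ _ h h'
    have : FiniteDimensional k (LinearMap.ker d ⊓ W : Submodule k V) :=
      Submodule.finiteDimensional_of_le inf_le_right
    have e : LinearMap.range d ⊓ (LinearMap.ker d ⊓ W) = W'.map d := by
      refine le_antisymm (le_trans (inf_le_inf_left _ inf_le_right) h') (le_inf ?_ (le_inf ?_ h))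
      · exact LinearMap.map_le_range
      · rintro _ ⟨v, -, rfl⟩
        exact hd v
    have r1 := rn (LinearMap.range d).mkQ (LinearMap.ker d ⊓ W)
    rw [Submodule.ker_mkQ, e] at r1
    have r2 := rn d W'
    omega
  have s0 := step h₁ h₁'
  have s1 := step h₀ h₀'
  omega

variable {I Γ : Type*} (b : Module.Basis I k V) (g : I → Γ)

/-- The span of the basis vectors of a given degree. -/
def degreePart (γ : Γ) : Submodule k V := Submodule.span k (b '' (g ⁻¹' {γ}))

theorem mem_degreePart {γ : Γ} {v : V} :
    v ∈ degreePart b g γ ↔ ∀ i, b.repr v i ≠ 0 → g i = γ := by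
  rw [degreePart, b.mem_span_image]
  exact ⟨fun h i hi => h (Finsupp.mem_support_iff.2 hi), fun h i hi =>
    h i (Finsupp.mem_support_iff.1 hi)⟩

theorem basis_mem_degreePart (i : I) : b i ∈ degreePart b g (g i) :=
  Submodule.subset_span ⟨i, rfl, rfl⟩

theorem finiteDimensional_degreePart {γ : Γ} (h : (g ⁻¹' {γ}).Finite) :
    FiniteDimensional k (degreePart b g γ) :=
  FiniteDimensional.span_of_finite k (h.image b)

theorem finrank_degreePart (γ : Γ) :
    Module.finrank k (degreePart b g γ) = (g ⁻¹' {γ}).ncard := by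
  rw [degreePart, Set.image_eq_range]
  exact Module.finrank_eq_nat_card_basis (Module.Basis.span
    (b.linearIndependent.comp (Subtype.val : g ⁻¹' {γ} → I) Subtype.val_injective))

variable {b g} {d : V →ₗ[k] V} {σ : Γ → Γ}

theorem map_degreePart_le (hd : ∀ i, d (b i) ∈ degreePart b g (σ (g i))) (γ : Γ) :
    (degreePart b g γ).map d ≤ degreePart b g (σ γ) := by
  rw [Submodule.map_le_iff_le_comap, degreePart, Submodule.span_le]
  rintro _ ⟨i, rfl, rfl⟩
  exact hd i

/-- A preimage of a homogeneous boundary may be replaced by its homogeneous component: `d`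
intertwines the projections to degrees `γ` and `σ γ`. Injectivity of `σ` prevents other degrees from
contributing. -/
theorem range_inf_degreePart_le (hσ : Function.Injective σ)
    (hd : ∀ i, d (b i) ∈ degreePart b g (σ (g i))) (γ : Γ) :
    LinearMap.range d ⊓ degreePart b g (σ γ) ≤ (degreePart b g γ).map d := by
  classical
  let p : Γ → V →ₗ[k] V := fun γ => b.constr k fun i => if g i = γ then b i else 0
  have hp : ∀ γ i, p γ (b i) = if g i = γ then b i else 0 := fun γ i => b.constr_basis k _ i
  have hp1 : ∀ γ v, v ∈ degreePart b g γ → p γ v = v := by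
    intro γ
    refine LinearMap.eqOn_span (g := LinearMap.id) ?_
    rintro _ ⟨i, hi, rfl⟩
    rw [hp, if_pos (show g i = γ from hi), LinearMap.id_apply]
  have hp2 : ∀ γ γ' v, γ' ≠ γ → v ∈ degreePart b g γ' → p γ v = 0 := by
    intro γ γ' v h hv
    refine LinearMap.eqOn_span (g := (0 : V →ₗ[k] V)) ?_ hv
    rintro _ ⟨i, rfl, rfl⟩
    rw [hp, if_neg h, LinearMap.zero_apply]
  have hp3 : ∀ γ v, p γ v ∈ degreePart b g γ := by
    intro γ v
    have h : ⊤ ≤ (degreePart b g γ).comap (p γ) := by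
      rw [← b.span_eq, Submodule.span_le]
      rintro _ ⟨i, rfl⟩
      change p γ (b i) ∈ degreePart b g γ
      rw [hp]
      split_ifs with h
      · exact h ▸ basis_mem_degreePart b g i
      · exact Submodule.zero_mem _
    exact h trivial
  have hcomm : d ∘ₗ p γ = p (σ γ) ∘ₗ d := by
    refine b.ext fun i => ?_
    rw [LinearMap.comp_apply, LinearMap.comp_apply, hp]
    split_ifs with h
    · subst h
      rw [hp1 _ _ (hd i)]
    · rw [map_zero, hp2 _ _ _ (fun h' => h (hσ h')) (hd i)]
  rintro _ ⟨⟨v, rfl⟩, hv⟩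
  exact ⟨p γ v, hp3 γ v, (LinearMap.congr_fun hcomm v).trans (hp1 _ _ hv)⟩

theorem mem_eigenspace_iff_of_basis {T : Module.End k V} {τ : I → k} (h : ∀ i, T (b i) = τ i • b i)
    {μ : k} {v : V} :
    v ∈ T.eigenspace μ ↔ ∀ i, b.repr v i ≠ 0 → τ i = μ := by
  have hT : ∀ i, b.repr (T v) i = τ i * b.repr v i := by
    intro i
    have : (b.coord i) ∘ₗ T = τ i • b.coord i := by
      refine b.ext fun j => ?_
      rw [LinearMap.comp_apply, h, map_smul, LinearMap.smul_apply, b.coord_apply, b.repr_self,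
        smul_eq_mul, smul_eq_mul]
      by_cases hij : j = i
      · rw [hij]
      · rw [Finsupp.single_eq_of_ne (Ne.symm hij), mul_zero, mul_zero]
    exact LinearMap.congr_fun this v
  rw [Module.End.mem_eigenspace_iff, ← b.repr.injective.eq_iff, DFunLike.ext_iff]
  refine forall_congr' fun i => ?_
  rw [hT, map_smul, Finsupp.smul_apply, smul_eq_mul, mul_eq_mul_right_iff]
  tauto

end EulerCharacteristic

/-! ### The monomial basis of the cochain algebra -/

section MonomialBasis

variable (k : Type*) [Field k]

theorem prod_ofFinEmbEquiv_symm {E : Type*} [LinearOrder E] (u : E → k) {n : ℕ}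
    (s : Set.powersetCard E n) :
    ∏ i, u (Set.powersetCard.ofFinEmbEquiv.symm s i) = ∏ i ∈ (s : Finset E), u i := by
  rw [← Finset.prod_image (s := Finset.univ) (f := u)
    (Set.powersetCard.ofFinEmbEquiv.symm s).injective.injOn]
  refine Finset.prod_congr ?_ fun _ _ => rfl
  ext i
  rw [Finset.mem_image]
  have h := Set.powersetCard.mem_range_ofFinEmbEquiv_symm_iff_mem s i
  exact ⟨fun ⟨a, _, ha⟩ => h.1 ⟨a, ha⟩, fun hi => let ⟨a, ha⟩ := h.2 hi; ⟨a, Finset.mem_univ a, ha⟩⟩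

theorem extMap_basis {E : Type*} [Fintype E] [DecidableEq E] [LinearOrder E] (u : E → k)
    (A : Finset E) :
    ExteriorAlgebra.map (LinearMap.pi fun i : E => u i • (LinearMap.proj i : (E → k) →ₗ[k] k))
        ((Pi.basisFun k E).ExteriorAlgebra A) =
      (∏ i ∈ A, u i) • (Pi.basisFun k E).ExteriorAlgebra A := by
  have hf : ∀ i, LinearMap.pi (fun i : E => u i • (LinearMap.proj i : (E → k) →ₗ[k] k))
      (Pi.basisFun k E i) = u i • Pi.basisFun k E i := by
    intro i
    rw [Pi.basisFun_apply]
    funext j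
    by_cases h : j = i
    · subst h
      simp
    · simp [Pi.single_eq_of_ne h]
  rw [ExteriorAlgebra.basis_apply, ExteriorAlgebra.map_apply_ιMulti]
  simp only [Function.comp_def, hf]
  rw [AlternatingMap.map_smul_univ]
  congr 1
  exact prod_ofFinEmbEquiv_symm k u (Set.powersetCard.prodEquiv.symm A).2

/-- The monomials in the coordinates form a basis of the cochain algebra. -/
theorem exists_cochainBasis {ι : Type} [Fintype ι] (odd : ι → Prop) [DecidablePred odd] :
    ∃ b : Module.Basis (({i : ι // odd i} →₀ ℕ) × Finset {i : ι // ¬ odd i}) k (Cochains k odd),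
      ∀ (u : ι → k) x, diagAct k u (b x) =
        (x.1.prod (fun i n => u i ^ n) * ∏ i ∈ x.2, u i) • b x := by
  classical
  -- An arbitrary linear order on the exterior generators, needed only to form the basis of ordered
  -- products.
  let _ : LinearOrder {i : ι // ¬ odd i} := linearOrderOfSTO WellOrderingRel
  refine ⟨(MvPolynomial.basisMonomials _ k).tensorProduct (Pi.basisFun k _).ExteriorAlgebra,
    fun u x => ?_⟩
  rw [Module.Basis.tensorProduct_apply', diagAct_tmul,
    extMap_basis k fun i : {i : ι // ¬ odd i} => u i]
  rw [MvPolynomial.coe_basisMonomials, TensorProduct.tmul_smul, mul_comm, mul_smul,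
    TensorProduct.smul_tmul']
  congr 2
  rw [MvPolynomial.aeval_monomial, MvPolynomial.smul_monomial]
  rw [map_one, one_mul, smul_eq_mul, mul_one, MvPolynomial.monomial_eq]
  simp only [mul_pow, Finsupp.prod, Finset.prod_mul_distrib, map_prod, map_pow]

end MonomialBasis

/-! ### The Euler characteristic of the cohomology of the nilpotent radical -/

section TorusCharacter

variable {J : Type} [Fintype J] {k : Type*} [Field k]

/-- The character `t ↦ t^w` of a torus, as a function of `w`. -/
def torusChar (t : J → kˣ) : (J → ℤ) →+ Additive kˣ where
  toFun w := Additive.ofMul (∏ a, t a ^ w a)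
  map_zero' := by simp
  map_add' w w' := by
    rw [← ofMul_mul, ← Finset.prod_mul_distrib]
    simp only [Pi.add_apply, zpow_add]

theorem torusChar_apply (t : J → kˣ) (w : J → ℤ) :
    (torusChar t w).toMul = ∏ a, t a ^ w a := rfl

theorem torusChar_rootOf [DecidableEq J] (t : J → kˣ) (q : J × J) :
    (torusChar t (rootOf q)).toMul = t q.1 * (t q.2)⁻¹ := by
  have h : ∀ a, (torusChar t (Pi.single a 1)).toMul = t a := fun a => by
    rw [torusChar_apply, Finset.prod_eq_single a]
    · simp
    · intro b _ hb
      rw [Pi.single_eq_of_ne hb, zpow_zero]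
    · simp
  rw [rootOf, map_sub, toMul_sub, h, h, div_eq_mul_inv]

theorem torusChar_injective [CharZero k] {w w' : J → ℤ}
    (h : ∀ t : J → kˣ, torusChar t w = torusChar t w') : w = w' := by
  classical
  funext a
  -- In characteristic zero `2` has infinite order, so a torus element equal to `2` in one
  -- coordinate and `1` elsewhere detects that coordinate of the weight.
  let u : kˣ := Units.mk0 2 two_ne_zero
  have h1 : ∀ w : J → ℤ, (torusChar (Function.update 1 a u) w).toMul = u ^ w a := fun w => by
    rw [torusChar_apply, Finset.prod_eq_single a]
    · rw [Function.update_self]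
    · intro b _ hb
      rw [Function.update_of_ne hb, Pi.one_apply, one_zpow]
    · simp
  have h2 : u ^ w a = u ^ w' a := by rw [← h1, ← h1, h]
  have h3 : ((2 : ℚ) : k) ^ w a = ((2 : ℚ) : k) ^ w' a := by
    simpa [u] using congrArg Units.val h2
  rw [← Rat.cast_zpow, ← Rat.cast_zpow, Rat.cast_inj] at h3
  exact zpow_right_injective₀ (by norm_num) (by norm_num) h3

end TorusCharacter

/-! ### Weight and parity components of the cochains and their Euler characteristic -/

section NilEuler

variable {M N : ℕ} (m : Fin (M + N) → ℕ) (π : Equiv.Perm (Fin (M + N))) (k : Type*) [Field k]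

/-- The indices of the monomials in the coordinates of the nilpotent radical. -/
abbrev NilMonomial : Type :=
  ({r : NilRoot m π // NilRoot.odd m π r} →₀ ℕ) × Finset {r : NilRoot m π // ¬ NilRoot.odd m π r}

/-- The weight of a monomial. -/
def monomialWeight (x : NilMonomial m π) : Idx m → ℤ :=
  ∑ r ∈ x.2, extWeight m π r + Finsupp.linearCombination ℕ (polyWeight m π) x.1

theorem torusChar_monomialWeight (t : Idx m → kˣ) (x : NilMonomial m π) :
    ((torusChar t (monomialWeight m π x)).toMul : k) =
      x.1.prod (fun r n => ((t r.1.1.1 * (t r.1.1.2)⁻¹ : kˣ) : k) ^ n) *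
        ∏ r ∈ x.2, ((t r.1.1.1 * (t r.1.1.2)⁻¹ : kˣ) : k) := by
  rw [monomialWeight, map_add, map_sum, toMul_add, toMul_sum, mul_comm,
    Finsupp.linearCombination_apply, Finsupp.sum, map_sum, toMul_sum, Units.val_mul,
    Units.coe_prod, Units.coe_prod, Finsupp.prod]
  congr 1
  · refine Finset.prod_congr rfl fun r _ => ?_
    rw [map_nsmul, toMul_nsmul, polyWeight, torusChar_rootOf, Units.val_pow_eq_pow_val]
  · refine Finset.prod_congr rfl fun r _ => ?_
    rw [extWeight, torusChar_rootOf]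

/-- The weight and the parity of a monomial. -/
def monomialDegree (x : NilMonomial m π) : (Idx m → ℤ) × Fin 2 :=
  (monomialWeight m π x, Fin.ofNat 2 x.2.card)

theorem neg_one_pow_ofNat_two (n : ℕ) : (-1 : k) ^ (Fin.ofNat 2 n : ℕ) = (-1) ^ n := by
  rw [Fin.val_ofNat, ← neg_one_pow_eq_pow_mod_two]

theorem neg_one_pow_fin_two_inj [CharZero k] {ε ε' : Fin 2} :
    (-1 : k) ^ (ε : ℕ) = (-1) ^ (ε' : ℕ) ↔ ε = ε' := by
  have h : (-1 : k) ≠ 1 := by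
    intro h
    have : (2 : k) = 0 := by linear_combination -h
    exact two_ne_zero this
  fin_cases ε <;> fin_cases ε' <;> simp [h, h.symm]

/-- Monomials are common eigenvectors of the torus and of the parity involution, and in
characteristic zero their eigenvalues determine weight and parity. Hence the common eigenspaces are
spans of monomials. -/
theorem exists_nilBasis [CharZero k] :
    ∃ b : Module.Basis (NilMonomial m π) k (NilCochains m π k), ∀ wt ε,
      weightPart m π k wt ⊓ parityPart k (NilRoot.odd m π) ε =
        degreePart b (monomialDegree m π) (wt, ε) := by
  obtain ⟨b, hb⟩ := exists_cochainBasis k (NilRoot.odd m π)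
  have h1 : ∀ t x, (torusAct π k t).toLinearMap (b x) =
      ((torusChar t (monomialWeight m π x)).toMul : k) • b x := by
    intro t x
    rw [AlgHom.toLinearMap_apply, torusAct, hb, torusChar_monomialWeight]
  have h2 : ∀ x, (parityInv k (NilRoot.odd m π)).toLinearMap (b x) =
      ((-1 : k) ^ (Fin.ofNat 2 x.2.card : ℕ)) • b x := by
    intro x
    rw [AlgHom.toLinearMap_apply, parityInv_eq_diagAct, hb]
    congr 1
    have e1 : x.1.prod (fun i n => coordSign k (NilRoot.odd m π) i ^ n) = 1 :=
      Finset.prod_eq_one fun i _ => by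
        dsimp only
        rw [coordSign, if_pos i.2, one_pow]
    rw [e1, one_mul, neg_one_pow_ofNat_two]
    exact Finset.prod_eq_pow_card fun i _ => if_neg i.2
  refine ⟨b, fun wt ε => ?_⟩
  ext v
  rw [mem_degreePart, Submodule.mem_inf, weightPart, Submodule.mem_iInf, parityPart]
  have e2 := mem_eigenspace_iff_of_basis (b := b) h2 (μ := (-1) ^ (ε : ℕ)) (v := v)
  refine (and_congr (forall_congr' fun t => mem_eigenspace_iff_of_basis (h1 t)) e2).trans ?_
  simp only [neg_one_pow_fin_two_inj]
  constructor
  · intro ⟨h, h'⟩ x hx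
    refine Prod.ext (torusChar_injective (k := k) fun t => ?_) (h' x hx)
    exact Units.ext (h t x hx)
  · intro h
    refine ⟨fun t x hx => ?_, fun x hx => congrArg Prod.snd (h x hx)⟩
    have e : monomialWeight m π x = wt := congrArg Prod.fst (h x hx)
    rw [e]
    rfl

theorem nilDiff_mem_weightPart {wt : Idx m → ℤ} {v : NilCochains m π k}
    (hv : v ∈ weightPart m π k wt) : nilDiff m π k v ∈ weightPart m π k wt := by
  rw [weightPart, Submodule.mem_iInf] at hv ⊢
  intro t
  have h := Module.End.mem_eigenspace_iff.1 (hv t)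
  rw [Module.End.mem_eigenspace_iff, ← map_smul, ← h]
  exact torusAct_nilDiff m π k t v

theorem nilDiff_mem_parityPart {ε : Fin 2} {v : NilCochains m π k}
    (hv : v ∈ parityPart k (NilRoot.odd m π) ε) :
    nilDiff m π k v ∈ parityPart k (NilRoot.odd m π) (1 - ε) := by
  have h : parityInv k (NilRoot.odd m π) v = (-1 : k) ^ (ε : ℕ) • v :=
    Module.End.mem_eigenspace_iff.1 hv
  refine Module.End.mem_eigenspace_iff.2 ?_
  change parityInv k (NilRoot.odd m π) (nilDiff m π k v) = _
  have h' := parityInv_ceDiff k (NilRoot.odd m π) (odd_of_structConst_ne_zero m π k) v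
  change parityInv k (NilRoot.odd m π) (nilDiff m π k v) = -nilDiff m π k _ at h'
  have h'' : (-1 : k) ^ ((1 - ε : Fin 2) : ℕ) = -(-1) ^ (ε : ℕ) := by
    fin_cases ε <;> simp
  rw [h', h, map_smul, h'', neg_smul_cochains]

theorem finite_monomialWeight (wt : Idx m → ℤ) : {x | monomialWeight m π x = wt}.Finite := by
  classical
  have h : ∀ A : Finset {r : NilRoot m π // ¬ NilRoot.odd m π r},
      {e : {r : NilRoot m π // NilRoot.odd m π r} →₀ ℕ | monomialWeight m π (e, A) = wt}.Finite := by
    intro A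
    refine (finite_linearCombination_eq (nilHeight π) (polyWeight m π)
      (fun r => nilHeight_pos π r.1.2) (wt - ∑ r ∈ A, extWeight m π r)).subset fun e he => ?_
    rw [Set.mem_ofPred_eq] at he ⊢
    rw [← he, monomialWeight, add_sub_cancel_left]
  refine (Set.finite_iUnion fun A => (h A).image fun e => (e, A)).subset fun x hx => ?_
  exact Set.mem_iUnion.2 ⟨x.2, x.1, hx, rfl⟩

theorem finite_monomialDegree (γ : (Idx m → ℤ) × Fin 2) : (monomialDegree m π ⁻¹' {γ}).Finite :=
  (finite_monomialWeight m π γ.1).subset fun _ hx => congrArg Prod.fst hx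

/-- Monomials are grouped by their exterior part `A`, whose cardinality gives the total parity
because the polynomial generators are even. -/
theorem ncard_monomialDegree_sub (wt : Idx m → ℤ) :
    ((monomialDegree m π ⁻¹' {(wt, 0)}).ncard : ℤ) - (monomialDegree m π ⁻¹' {(wt, 1)}).ncard =
      nilChar m π wt := by
  classical
  have hS := finite_monomialWeight m π wt
  set S : Finset (NilMonomial m π) := hS.toFinset with hS'
  have h1 : ∀ ε : Fin 2, (monomialDegree m π ⁻¹' {(wt, ε)}).ncard =
      (S.filter fun x => Fin.ofNat 2 x.2.card = ε).card := by
    intro ε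
    rw [← Set.ncard_coe_finset]
    congr 1
    ext x
    simp [hS', monomialDegree, Prod.ext_iff]
  have h2 : ∑ x ∈ S, (-1 : ℤ) ^ x.2.card = nilChar m π wt := by
    rw [nilChar, partitionFun, ← Finset.sum_fiberwise S fun x => x.2]
    refine Finset.sum_congr rfl fun A _ => ?_
    rw [Finset.sum_congr rfl fun x hx => by rw [(Finset.mem_filter.1 hx).2], Finset.sum_const,
      nsmul_eq_mul, mul_comm]
    congr 2
    have h : ((S.filter fun x => x.2 = A : Finset (NilMonomial m π)) : Set (NilMonomial m π)) =
        (fun e => (e, A)) '' {e | monomialWeight m π (e, A) = wt} := by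
      ext x
      simp only [hS', Set.mem_image, Set.mem_ofPred_eq, Finset.coe_filter,
        Set.Finite.mem_toFinset]
      constructor
      · rintro ⟨h, rfl⟩
        exact ⟨x.1, h, rfl⟩
      · rintro ⟨e, h, rfl⟩
        exact ⟨h, rfl⟩
    rw [← Set.ncard_coe_finset, h, Set.ncard_image_of_injective _ (Prod.mk_left_injective A)]
    rfl
  rw [← h2, h1, h1, Finset.card_filter, Finset.card_filter, Nat.cast_sum, Nat.cast_sum,
    ← Finset.sum_sub_distrib]
  refine Finset.sum_congr rfl fun x _ => ?_
  rw [neg_one_pow_eq_pow_mod_two]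
  rcases Nat.mod_two_eq_zero_or_one x.2.card with h | h <;> simp [Fin.ext_iff, h]

theorem finiteDimensional_cohomologyPart [CharZero k] (ε : Fin 2) (wt : Idx m → ℤ) :
    FiniteDimensional k (cohomologyPart m π k ε wt) := by
  obtain ⟨b, hb⟩ := exists_nilBasis m π k
  have := finiteDimensional_degreePart b (monomialDegree m π) (finite_monomialDegree m π (wt, ε))
  rw [cohomologyPart, inf_assoc, hb]
  have : FiniteDimensional k (LinearMap.ker (nilDiff m π k) ⊓
      degreePart b (monomialDegree m π) (wt, ε) : Submodule k (NilCochains m π k)) :=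
    Submodule.finiteDimensional_of_le inf_le_right
  infer_instance

theorem eulerChar_eq_nilChar [CharZero k] (wt : Idx m → ℤ) :
    eulerChar m π k wt = nilChar m π wt := by
  obtain ⟨b, hb⟩ := exists_nilBasis m π k
  -- The effect of the differential on degrees: the weight is kept and the parity flipped.
  let σ : (Idx m → ℤ) × Fin 2 → (Idx m → ℤ) × Fin 2 := fun γ => (γ.1, 1 - γ.2)
  have hσ : Function.Injective σ := fun γ γ' h =>
    Prod.ext (Prod.ext_iff.1 h).1 (sub_right_injective (Prod.ext_iff.1 h).2)
  have hd : ∀ x, nilDiff m π k (b x) ∈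
      degreePart b (monomialDegree m π) (σ (monomialDegree m π x)) := by
    intro x
    have hx := basis_mem_degreePart b (monomialDegree m π) x
    rw [← hb] at hx ⊢
    exact ⟨nilDiff_mem_weightPart m π k hx.1, nilDiff_mem_parityPart m π k hx.2⟩
  have hfin : ∀ γ, FiniteDimensional k (degreePart b (monomialDegree m π) γ) := fun γ =>
    finiteDimensional_degreePart b _ (finite_monomialDegree m π γ)
  have h := finrank_cohomology_sub (W₀ := degreePart b (monomialDegree m π) (wt, 0))
    (W₁ := degreePart b (monomialDegree m π) (wt, 1)) (nilDiff_nilDiff m π k)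
    (map_degreePart_le hd (wt, 0)) (map_degreePart_le hd (wt, 1))
    (range_inf_degreePart_le hσ hd (wt, 0)) (range_inf_degreePart_le hσ hd (wt, 1))
  rw [eulerChar, cohomologyPart, cohomologyPart, inf_assoc, inf_assoc, hb, hb, h,
    finrank_degreePart, finrank_degreePart, ncard_monomialDegree_sub]

end NilEuler

end SuperKostant

end

theorem mainTheorem4 (k : Type*) [Field k] [CharZero k] (M N : ℕ) (m : Fin (M + N) → ℕ)
    (hm : ∀ i, 0 < m i) (hle : oddDim m ≤ evenDim m)
    (π : Equiv.Perm (Fin (M + N))) (hπ : IsShuffle π) :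
    (∀ (ε : Fin 2) (wt : Idx m → ℤ), FiniteDimensional k (cohomologyPart m π k ε wt)) ∧
    ∀ wt : Idx m → ℤ,
      {α : Idx m → ℤ |
        BlockDominant m α ∧ schurCoeff m π α * (schurProd m α).coeff wt ≠ 0}.Finite ∧
      eulerChar m π k wt =
        ∑ᶠ (α : Idx m → ℤ) (_ : BlockDominant m α),
          schurCoeff m π α * (schurProd m α).coeff wt := by
  refine ⟨finiteDimensional_cohomologyPart m π k, fun wt => ?_⟩
  rw [eulerChar_eq_nilChar]
  exact nilChar_eq_finsum π hle hπ wt
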